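/- Let $\mathbb D$ be the open unit disc and $dA$ the area measure on $\mathbb D$ normalized to total mass $1$. A radial weight is a positive, measurable and integrable function $\omega$ on $[0,1)$, extended to $\mathbb D$ by $\omega(z)=\omega(|z|)$; it is called regular, $\omega\in\mathcal R$, if there are constants $0<c\le C<\infty$ such that $$c\le \frac{\int_r^1\omega(t)\,dt}{(1-r)\,\omega(r)}\le C\qquad\text{for all } r\in[0,1).$$ For $0<p<\infty$ the weighted Bergman space $A^p_\omega$ consists of all analytic functions $f$ on $\mathbb D$ with $\|f\|_{A^p_\omega}^p=\int_{\mathbb D}|f|^p\,\omega\,dA<\infty$. For $0<s<\infty$, a positive Borel measure $\mu$ on $\mathbb D$ is a vanishing $s$-Carleson measure for $A^p_\omega$ if the identity operator $I_d:A^p_\omega\to L^s_\mu$ is (well defined and) compact, i.e. $A^p_\omega\subset L^s_\mu$ and every bounded sequence in $A^p_\omega$ has a subsequence that converges in $L^s_\mu$. **Theorem 3.** Let $n\ge 1$, $0<p_i,q_i<\infty$ and $\omega_i\in\mathcal R$ for $i=1,\dots,n$, and let $\mu$ be a positive Borel measure on $\mathbb D$. Put $$\lambda=\sum_{i=1}^n\frac{q_i}{p_i},\qquad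 \omega(z)=\prod_{i=1}^n\omega_i(z)^{\frac{q_i}{\lambda p_i}}.$$ Then the following statements are equivalent. (i) $\mu$ is a vanishing $\lambda$-Carleson measure for $A^1_\omega$. (ii) For every sequence $\{f_{1,k}\}_{k=1}^\infty$ that is bounded in $A^{p_1}_{\omega_1}$ and converges to $0$ uniformly on compact subsets of $\mathbb D$, $\lim_{k\to\infty}F(k)=0$, where $$F(k)=\sup\Big\{\int_{\mathbb D}|f_{1,k}(z)|^{q_1}\prod_{i=2}^n|f_i(z)|^{q_i}\,d\mu(z)\;:\;f_i\in A^{p_i}_{\omega_i},\ \|f_i\|_{A^{p_i}_{\omega_i}}\le 1,\ i=2,\dots,n\Big\}\in[0,\infty].$$ (iii) For all sequences $\{f_{1,k}\}_{k=1}^\infty,\dots,\{f_{n,k}\}_{k=1}^\infty$ that are bounded in $A^{p_1}_{\omega_1},\dots,A^{p_n}_{\omega_n}$, respectively, and all converge to $0$ uniformly on compact subsets of $\mathbb D$, $$\lim_{k\to\infty}\int_{\mathbb D}\prod_{i=1}^n|f_{i,k}(z)|^{q_i}\,d\mu(z)=0.$$ -/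

import Mathlib

open MeasureTheory Filter Topology
open scoped ENNReal NNReal

noncomputable section

namespace WeightedBergman

/-- The open unit disc of the complex plane. -/
abbrev disc : Set ℂ := Metric.ball (0 : ℂ) 1

/-- The tail integral `∫_r^1 w(t) dt` of a function on `[0, 1)`. -/
def tail (w : ℝ → ℝ) (r : ℝ) : ℝ := ∫ t in r..1, w t

/-- A radial weight, given by its radial profile: only the values on `[0, 1)` matter.
`IntegrableOn` contains the (Lebesgue) measurability. -/
structure IsRadialWeight (w : ℝ → ℝ) : Prop where
  pos : ∀ r ∈ Set.Ico (0 : ℝ) 1, 0 < w r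
  integrableOn : IntegrableOn w (Set.Ico (0 : ℝ) 1)

/-- A regular weight: a radial weight whose tail at `r` is comparable to `(1 - r) w(r)`,
uniformly in `r ∈ [0, 1)`. -/
structure IsRegularWeight (w : ℝ → ℝ) : Prop extends IsRadialWeight w where
  comparable : ∃ c C : ℝ, 0 < c ∧ ∀ r ∈ Set.Ico (0 : ℝ) 1,
    c ≤ tail w r / ((1 - r) * w r) ∧ tail w r / ((1 - r) * w r) ≤ C

/-- The area measure on the unit disc, normalized to total mass one. -/
def discArea : Measure ℂ := ENNReal.ofReal (Real.pi⁻¹) • (volume.restrict disc)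

/-- The measure `w(|z|) dA(z)` on the unit disc. -/
def weightedArea (w : ℝ → ℝ) : Measure ℂ :=
  discArea.withDensity fun z => ENNReal.ofReal (w ‖z‖)

/-- The (quasi-)norm `(∫ |f|^p w dA)^(1/p)`, with values in `[0, ∞]`. -/
def bergmanNorm (p : ℝ) (w : ℝ → ℝ) (f : ℂ → ℂ) : ℝ≥0∞ :=
  eLpNorm f (ENNReal.ofReal p) (weightedArea w)

/-- The weighted Bergman space of the functions that are analytic in the disc and have finite
norm. The values outside the disc are irrelevant. -/
def bergmanSpace (p : ℝ) (w : ℝ → ℝ) : Set (ℂ → ℂ) :=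
  {f | DifferentiableOn ℂ f disc ∧ bergmanNorm p w f < ∞}

/-- A sequence that lies in the weighted Bergman space and is bounded there. -/
def BoundedSeq (p : ℝ) (w : ℝ → ℝ) (f : ℕ → ℂ → ℂ) : Prop :=
  (∀ k, f k ∈ bergmanSpace p w) ∧ ∃ C : ℝ≥0, ∀ k, bergmanNorm p w (f k) ≤ C

/-- Convergence to zero, uniformly on the compact subsets of the disc. -/
def TendstoZeroOnCompacts (f : ℕ → ℂ → ℂ) : Prop :=
  ∀ K ⊆ disc, IsCompact K → TendstoUniformlyOn f (fun _ => (0 : ℂ)) atTop K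

/-- `μ` is a vanishing `q`-Carleson measure for the weighted Bergman space with exponent `p`
and weight `w`: the identity maps this space into `L^q(μ)`, as a compact operator, i.e.
every bounded sequence has a subsequence that converges in `L^q(μ)`. (For `q < 1`, too, `L^q(μ)` is
metrizable, so sequences suffice. Only the restriction of `μ` to the disc matters.) -/
def IsVanishingCarleson (q p : ℝ) (w : ℝ → ℝ) (μ : Measure ℂ) : Prop :=
  (∀ f ∈ bergmanSpace p w, MemLp f (ENNReal.ofReal q) (μ.restrict disc)) ∧
  ∀ f : ℕ → ℂ → ℂ, BoundedSeq p w f →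
    ∃ g : ℂ → ℂ, MemLp g (ENNReal.ofReal q) (μ.restrict disc) ∧
      ∃ φ : ℕ → ℕ, StrictMono φ ∧
        Tendsto (fun k => eLpNorm (f (φ k) - g) (ENNReal.ofReal q) (μ.restrict disc))
          atTop (𝓝 0)

end WeightedBergman

end

noncomputable section

/-! All three statements are equivalent to one discrete condition, `CellCondition`, in which p_i,
q_i and ω_i enter only through λ and ω. Cut the disc into Whitney cells D_j with centers a_j, let
V_j = (1 - |a_j|)² Ω(a_j), where Ω is comparable to ω, and let m_j = μ(D_j) V_j^(-λ). The condition
says that μ is finite on compact subsets and that the supremum of ∑ m_j x_j^λ over x ≥ 0 with ∑ x_j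
≤ 1, taken over the cells close to the circle only, is small. For λ ≥ 1 this means that m_j → 0 at
the boundary; for λ < 1 it means that the tails of m are small in ℓ^(1/(1-λ)). Working with the
supremum avoids the case distinction.

The condition depends on λ and ω alone because of `prod_discSize_rpow`: the product of the powers
-q_i/p_i of the cell sizes for ω_i is V_j^(-λ). Hence statement (i) is the case of one factor with
exponents p = 1 and q = λ, and each direction is proved once, for any number of factors.

Sufficiency: by the sub-mean value property, ∏ |f_i|^(q_i) on D_j is at most a constant times
V_j^(-λ) y_j^λ, where y_j is a weighted geometric mean of the integrals of |f_i|^(p_i) ω_i over the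
enlarged cell. These cells overlap boundedly, so ∑ y_j is bounded by the norms, and the mass near
the circle is uniformly small (`CellCondition.exists_lintegral_le`). On the remaining compact part
one null factor suffices, which gives (ii). For (i), Montel's theorem and Fatou's lemma reduce
bounded sequences to null sequences.

Necessity: if the condition fails, there are sequences x living on deeper and deeper cells. The
functions ∑ ± x_j^(1/p_i) φ_{i,j}, with φ_{i,j} a normalized power of the Cauchy kernel of the cell,
are bounded and tend to zero locally uniformly. Averaging over independent signs bounds the integral
of their product below by ∑ m_j x_j^λ (`exists_signs_le`), contradicting (iii), or (i) in the case
of one factor.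

Regularity enters only by making each ω_i comparable to a power weight
(`IsRegularWeight.exists_isPowerWeight`), for which the Forelli–Rudin integral estimate is
elementary. -/

namespace WeightedBergman

/-! ### Power weights -/

/-- A measurable weight on `[0, 1)` that lies between two powers of `1 - r`: the function
`W(r) (1 - r)^(1 - α)` decreases and `W(r) (1 - r)^(1 - β)` increases. -/
structure IsPowerWeight (α β : ℝ) (W : ℝ → ℝ) : Prop where
  measurable : Measurable W
  pos : ∀ r ∈ Set.Ico (0 : ℝ) 1, 0 < W r
  anti : ∀ r s, 0 ≤ r → r ≤ s → s < 1 → W s * (1 - s) ^ (1 - α) ≤ W r * (1 - r) ^ (1 - α)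
  mono : ∀ r s, 0 ≤ r → r ≤ s → s < 1 → W r * (1 - r) ^ (1 - β) ≤ W s * (1 - s) ^ (1 - β)

namespace IsPowerWeight

variable {α β : ℝ} {W : ℝ → ℝ}

lemma upper_right (h : IsPowerWeight α β W) {r s : ℝ} (hr : 0 ≤ r) (hrs : r ≤ s) (hs : s < 1) :
    W s ≤ W r * ((1 - s) / (1 - r)) ^ (α - 1) := by
  have h1 := h.anti r s hr hrs hs
  have hs' : 0 < 1 - s := by linarith
  have hr' : 0 < 1 - r := by linarith
  have e1 : (1 - s) ^ (1 - α) * (1 - s) ^ (α - 1) = 1 := by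
    rw [← Real.rpow_add hs']; simp
  have e2 : (1 - r) ^ (α - 1) * (1 - r) ^ (1 - α) = 1 := by
    rw [← Real.rpow_add hr']; simp
  rw [Real.div_rpow hs'.le hr'.le]
  have p1 : 0 < (1 - s) ^ (α - 1) := Real.rpow_pos_of_pos hs' _
  have p2 : 0 < (1 - r) ^ (α - 1) := Real.rpow_pos_of_pos hr' _
  rw [← mul_div_assoc, le_div_iff₀ p2]
  calc W s * (1 - r) ^ (α - 1)
      = (W s * (1 - s) ^ (1 - α)) * ((1 - s) ^ (α - 1) * (1 - r) ^ (α - 1)) := by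
        linear_combination -(W s * (1 - r) ^ (α - 1)) * e1
    _ ≤ (W r * (1 - r) ^ (1 - α)) * ((1 - s) ^ (α - 1) * (1 - r) ^ (α - 1)) := by gcongr
    _ = W r * (1 - s) ^ (α - 1) := by
        linear_combination (W r * (1 - s) ^ (α - 1)) * e2

lemma upper_left (h : IsPowerWeight α β W) {r s : ℝ} (hr : 0 ≤ r) (hrs : r ≤ s) (hs : s < 1) :
    W r ≤ W s * ((1 - r) / (1 - s)) ^ (β - 1) := by
  have h1 := h.mono r s hr hrs hs
  have hs' : 0 < 1 - s := by linarith
  have hr' : 0 < 1 - r := by linarith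
  have e1 : (1 - r) ^ (1 - β) * (1 - r) ^ (β - 1) = 1 := by
    rw [← Real.rpow_add hr']; simp
  have e2 : (1 - s) ^ (β - 1) * (1 - s) ^ (1 - β) = 1 := by
    rw [← Real.rpow_add hs']; simp
  rw [Real.div_rpow hr'.le hs'.le]
  have p1 : 0 < (1 - s) ^ (β - 1) := Real.rpow_pos_of_pos hs' _
  have p2 : 0 < (1 - r) ^ (β - 1) := Real.rpow_pos_of_pos hr' _
  rw [← mul_div_assoc, le_div_iff₀ p1]
  calc W r * (1 - s) ^ (β - 1)
      = (W r * (1 - r) ^ (1 - β)) * ((1 - r) ^ (β - 1) * (1 - s) ^ (β - 1)) := by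
        linear_combination -(W r * (1 - s) ^ (β - 1)) * e1
    _ ≤ (W s * (1 - s) ^ (1 - β)) * ((1 - r) ^ (β - 1) * (1 - s) ^ (β - 1)) := by gcongr
    _ = W s * (1 - r) ^ (β - 1) := by
        linear_combination (W s * (1 - r) ^ (β - 1)) * e2

lemma mul_rpow (h : IsPowerWeight α β W) (x : ℝ) :
    IsPowerWeight (α + x) (β + x) (fun r => W r * (1 - r) ^ x) := by
  have key : ∀ (r y : ℝ), r < 1 → W r * (1 - r) ^ x * (1 - r) ^ (1 - (y + x))
      = W r * (1 - r) ^ (1 - y) := by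
    intro r y hr
    rw [mul_assoc, ← Real.rpow_add (by linarith)]
    congr 2; ring
  refine ⟨h.measurable.mul ((measurable_const.sub measurable_id).pow_const _), ?_, ?_, ?_⟩
  · intro r hr
    exact mul_pos (h.pos r hr) (Real.rpow_pos_of_pos (by linarith [hr.2]) _)
  · intro r s hr hrs hs
    rw [key s α hs, key r α (by linarith)]
    exact h.anti r s hr hrs hs
  · intro r s hr hrs hs
    rw [key s β hs, key r β (by linarith)]
    exact h.mono r s hr hrs hs

lemma one_sub_rpow (x : ℝ) : IsPowerWeight (1 + x) (1 + x) (fun r => (1 - r) ^ x) := by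
  have h1 : IsPowerWeight 1 1 (fun _ => (1 : ℝ)) :=
    ⟨measurable_const, by simp, by simp, by simp⟩
  simpa using h1.mul_rpow x

/-- Since ∑ θ_i = 1, the factor (1 - r)^(1 - ∑ θ_i y_i) distributes over the product, so both
monotonicity conditions are inherited factor by factor. This is how the weight ω of the theorem is
handled without proving it regular. -/
lemma prod {ι : Type*} [Fintype ι] {α β : ι → ℝ} {W : ι → ℝ → ℝ}
    (h : ∀ i, IsPowerWeight (α i) (β i) (W i)) {θ : ι → ℝ} (hθ : ∀ i, 0 ≤ θ i)
    (hsum : ∑ i, θ i = 1) :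
    IsPowerWeight (∑ i, θ i * α i) (∑ i, θ i * β i) (fun r => ∏ i, W i r ^ θ i) := by
  have key : ∀ (y : ι → ℝ) (r : ℝ), 0 ≤ r → r < 1 →
      (∏ i, W i r ^ θ i) * (1 - r) ^ (1 - ∑ i, θ i * y i)
        = ∏ i, (W i r * (1 - r) ^ (1 - y i)) ^ θ i := by
    intro y r hr hr1
    have hr' : 0 < 1 - r := by linarith
    have e : (1 - ∑ i, θ i * y i) = ∑ i, (1 - y i) * θ i := by
      simp only [sub_mul, one_mul, Finset.sum_sub_distrib, hsum]
      simp only [mul_comm]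
    rw [e, Real.rpow_sum_of_pos hr', ← Finset.prod_mul_distrib]
    refine Finset.prod_congr rfl fun i _ => ?_
    rw [Real.mul_rpow ((h i).pos r ⟨hr, hr1⟩).le (Real.rpow_nonneg hr'.le _),
      ← Real.rpow_mul hr'.le]
  have nn : ∀ (y : ι → ℝ) (r : ℝ), 0 ≤ r → r < 1 → ∀ i, 0 ≤ W i r * (1 - r) ^ (1 - y i) :=
    fun y r hr hr1 i =>
      mul_nonneg ((h i).pos r ⟨hr, hr1⟩).le (Real.rpow_nonneg (by linarith) _)
  refine ⟨Finset.measurable_prod _ fun i _ => (h i).measurable.pow_const _, ?_, ?_, ?_⟩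
  · intro r hr
    exact Finset.prod_pos fun i _ => Real.rpow_pos_of_pos ((h i).pos r hr) _
  · intro r s hr hrs hs
    rw [key α s (hr.trans hrs) hs, key α r hr (hrs.trans_lt hs)]
    exact Finset.prod_le_prod
      (fun i _ => Real.rpow_nonneg (nn α s (hr.trans hrs) hs i) _)
      (fun i _ => Real.rpow_le_rpow (nn α s (hr.trans hrs) hs i) ((h i).anti r s hr hrs hs) (hθ i))
  · intro r s hr hrs hs
    rw [key β s (hr.trans hrs) hs, key β r hr (hrs.trans_lt hs)]
    exact Finset.prod_le_prod
      (fun i _ => Real.rpow_nonneg (nn β r hr (hrs.trans_lt hs) i) _)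
      (fun i _ => Real.rpow_le_rpow (nn β r hr (hrs.trans_lt hs) i) ((h i).mono r s hr hrs hs)
        (hθ i))

/-- A power weight is essentially constant where `1 - r` changes by a factor of at most `2`. -/
lemma exists_comparable (h : IsPowerWeight α β W) :
    ∃ C : ℝ, 0 < C ∧ ∀ r ∈ Set.Ico (0 : ℝ) 1, ∀ s ∈ Set.Ico (0 : ℝ) 1,
      1 - r ≤ 2 * (1 - s) → 1 - s ≤ 2 * (1 - r) → W s ≤ C * W r := by
  have aux : ∀ x y : ℝ, 1 / 2 ≤ x → x ≤ 2 → x ^ y ≤ 2 ^ |y| := by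
    intro x y hx1 hx2
    rcases le_total 0 y with hy | hy
    · rw [abs_of_nonneg hy]
      exact Real.rpow_le_rpow (by linarith) hx2 hy
    · rw [abs_of_nonpos hy, Real.rpow_neg (by norm_num), ← Real.inv_rpow (by norm_num)]
      exact Real.rpow_le_rpow_of_nonpos (by norm_num) (by linarith) hy
  refine ⟨max (2 ^ |α - 1|) (2 ^ |β - 1|), lt_max_of_lt_left (by positivity), ?_⟩
  intro r hr s hs h1 h2
  have hr' : 0 < 1 - r := by linarith [hr.2]
  have hs' : 0 < 1 - s := by linarith [hs.2]
  have hb1 : 1 / 2 ≤ (1 - s) / (1 - r) := by rw [le_div_iff₀ hr']; linarith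
  have hb2 : (1 - s) / (1 - r) ≤ 2 := by rw [div_le_iff₀ hr']; linarith
  have hW := (h.pos r hr).le
  rw [mul_comm]
  rcases le_total r s with hrs | hrs
  · refine (h.upper_right hr.1 hrs hs.2).trans (mul_le_mul_of_nonneg_left ?_ hW)
    exact (aux _ _ hb1 hb2).trans (le_max_left _ _)
  · refine (h.upper_left hs.1 hrs hr.2).trans (mul_le_mul_of_nonneg_left ?_ hW)
    exact (aux _ _ hb1 hb2).trans (le_max_right _ _)

end IsPowerWeight

/-! ### Regular weights are comparable to power weights -/

/-- Two functions are comparable on `[0, 1)`. -/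
def Comparable (w W : ℝ → ℝ) : Prop :=
  ∃ C : ℝ, 0 < C ∧ ∀ r ∈ Set.Ico (0 : ℝ) 1, w r ≤ C * W r ∧ W r ≤ C * w r

/-- The tail T of w is comparable to (1 - r) w, but its derivative involves w, which is merely
measurable. Averaging once more helps: G(r) = ∫_r^1 T(t)/(1 - t) dt has G' = -T/(1 - r) on (0, 1)
and cT ≤ G ≤ CT. This bounds the logarithmic derivative of G between -1/(c(1 - r)) and -1/(C(1 -
r)), whence α = 1/C and β = 1/c for W = G/(1 - r). -/
lemma IsRegularWeight.exists_isPowerWeight {w : ℝ → ℝ} (hw : IsRegularWeight w) :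
    ∃ α β W, 0 < α ∧ IsPowerWeight α β W ∧ Comparable w W := by
  obtain ⟨c, C, hc, hcC⟩ := hw.comparable
  set T := tail w with hT
  have hpos := hw.pos
  have hT1 : ∀ r ∈ Set.Ico (0 : ℝ) 1, c * ((1 - r) * w r) ≤ T r ∧ T r ≤ C * ((1 - r) * w r) := by
    intro r hr
    have hd : 0 < (1 - r) * w r := mul_pos (by linarith [hr.2]) (hpos r hr)
    exact ⟨(le_div_iff₀ hd).1 (hcC r hr).1, (div_le_iff₀ hd).1 (hcC r hr).2⟩
  have hC : 0 < C := hc.trans_le ((hcC 0 (by simp)).1.trans (hcC 0 (by simp)).2)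
  have hint : IntervalIntegrable w volume 0 1 := by
    rw [intervalIntegrable_iff_integrableOn_Ico_of_le zero_le_one]; exact hw.integrableOn
  have contTail : ∀ {v : ℝ → ℝ}, IntervalIntegrable v volume 0 1 →
      ContinuousOn (tail v) (Set.Icc 0 1) := by
    intro v hv
    have := intervalIntegral.continuousOn_primitive_interval_left (a := (0:ℝ)) (b := 1)
      (f := v) (μ := volume) (by
        rw [Set.uIcc_of_le zero_le_one, integrableOn_Icc_iff_integrableOn_Ico]
        rwa [intervalIntegrable_iff_integrableOn_Ico_of_le zero_le_one] at hv)
    rwa [Set.uIcc_of_le zero_le_one] at this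
  have hTc : ContinuousOn T (Set.Icc 0 1) := contTail hint
  set h : ℝ → ℝ := fun t => T t / (1 - t) with hh
  have hhc : ContinuousOn h (Set.Ico 0 1) := by
    refine (hTc.mono Set.Ico_subset_Icc_self).div (by fun_prop) ?_
    intro x hx; linarith [hx.2]
  have hh1 : ∀ r ∈ Set.Ico (0 : ℝ) 1, c * w r ≤ h r ∧ h r ≤ C * w r := by
    intro r hr
    have hd : 0 < 1 - r := by linarith [hr.2]
    obtain ⟨h1, h2⟩ := hT1 r hr
    constructor
    · rw [hh, le_div_iff₀ hd]; linarith
    · rw [hh, div_le_iff₀ hd]; linarith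
  have hhi : IntegrableOn h (Set.Ico 0 1) := by
    refine (hw.integrableOn.const_mul C).mono' (hhc.aestronglyMeasurable measurableSet_Ico) ?_
    refine (ae_restrict_iff' measurableSet_Ico).2 (Eventually.of_forall fun r hr => ?_)
    rw [Real.norm_of_nonneg]
    · exact (hh1 r hr).2
    · exact (mul_pos hc (hpos r hr)).le.trans (hh1 r hr).1
  have hhint : IntervalIntegrable h volume 0 1 := by
    rwa [intervalIntegrable_iff_integrableOn_Ico_of_le zero_le_one]
  set G := tail h with hG
  have hGc : ContinuousOn G (Set.Icc 0 1) := contTail hhint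
  have sub : ∀ {v : ℝ → ℝ}, IntervalIntegrable v volume 0 1 → ∀ r ∈ Set.Ico (0:ℝ) 1,
      IntervalIntegrable v volume r 1 := by
    intro v hv r hr
    refine hv.mono_set ?_
    rw [Set.uIcc_of_le hr.2.le, Set.uIcc_of_le zero_le_one]
    exact Set.Icc_subset_Icc_left hr.1
  have hGT : ∀ r ∈ Set.Ico (0 : ℝ) 1, c * T r ≤ G r ∧ G r ≤ C * T r := by
    intro r hr
    have i1 := sub hint r hr
    have i2 := sub hhint r hr
    rw [hT, hG, tail, tail, ← intervalIntegral.integral_const_mul,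
      ← intervalIntegral.integral_const_mul]
    constructor
    · refine intervalIntegral.integral_mono_on_of_le_Ioo hr.2.le (i1.const_mul c) i2 ?_
      intro x hx; exact (hh1 x ⟨hr.1.trans hx.1.le, hx.2⟩).1
    · refine intervalIntegral.integral_mono_on_of_le_Ioo hr.2.le i2 (i1.const_mul C) ?_
      intro x hx; exact (hh1 x ⟨hr.1.trans hx.1.le, hx.2⟩).2
  have hTpos : ∀ r ∈ Set.Ico (0 : ℝ) 1, 0 < T r := fun r hr =>
    (mul_pos hc (mul_pos (by linarith [hr.2]) (hpos r hr))).trans_le (hT1 r hr).1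
  have hGd : ∀ r ∈ Set.Ioo (0 : ℝ) 1, HasDerivAt G (-h r) r := by
    intro r hr
    have hr' : r ∈ Set.Ico (0:ℝ) 1 := ⟨hr.1.le, hr.2⟩
    have hnhds : Set.Ico (0 : ℝ) 1 ∈ 𝓝 r := Ico_mem_nhds hr.1 hr.2
    refine intervalIntegral.integral_hasDerivAt_left (sub hhint r hr') ?_
      (hhc.continuousAt hnhds)
    exact ⟨_, hnhds, hhc.aestronglyMeasurable measurableSet_Ico⟩
  -- The sign of this derivative is that of x G - T: nonpositive for x = 1/C, nonnegative for x =
  -- 1/c.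
  have hder : ∀ x : ℝ, ∀ r ∈ Set.Ioo (0 : ℝ) 1,
      HasDerivAt (fun r => G r * (1 - r) ^ (-x)) ((1 - r) ^ (-x - 1) * (x * G r - T r)) r := by
    intro x r hr
    have hd : 0 < 1 - r := by linarith [hr.2]
    have d1 : HasDerivAt (fun r : ℝ => 1 - r) (-1) r := by
      simpa using (hasDerivAt_id r).const_sub 1
    have d2 := d1.rpow_const (p := -x) (Or.inl hd.ne')
    have := (hGd r hr).mul d2
    refine this.congr_deriv ?_
    have e : (1 - r) ^ (-x) = (1 - r) ^ (-x - 1) * (1 - r) := by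
      rw [← Real.rpow_add_one hd.ne']; congr 1; ring
    have e2 : h r * (1 - r) = T r := by rw [hh]; field_simp
    rw [e]
    linear_combination (-(1 - r) ^ (-x - 1)) * e2
  have hcont : ∀ x : ℝ, ContinuousOn (fun r => G r * (1 - r) ^ (-x)) (Set.Ico 0 1) := by
    intro x
    refine (hGc.mono Set.Ico_subset_Icc_self).mul ?_
    refine ContinuousOn.rpow_const (by fun_prop) ?_
    intro y hy; left; linarith [hy.2]
  have hanti : AntitoneOn (fun r => G r * (1 - r) ^ (-(1 / C))) (Set.Ico 0 1) := by
    refine antitoneOn_of_deriv_nonpos (convex_Ico 0 1) (hcont _) ?_ ?_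
    · rw [interior_Ico]
      exact fun r hr => (hder _ r hr).differentiableAt.differentiableWithinAt
    · rw [interior_Ico]
      intro r hr
      rw [(hder _ r hr).deriv]
      refine mul_nonpos_of_nonneg_of_nonpos (Real.rpow_nonneg (by linarith [hr.2]) _) ?_
      have := (hGT r ⟨hr.1.le, hr.2⟩).2
      rw [sub_nonpos, one_div, inv_mul_le_iff₀ hC]; exact this
  have hmono : MonotoneOn (fun r => G r * (1 - r) ^ (-(1 / c))) (Set.Ico 0 1) := by
    refine monotoneOn_of_deriv_nonneg (convex_Ico 0 1) (hcont _) ?_ ?_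
    · rw [interior_Ico]
      exact fun r hr => (hder _ r hr).differentiableAt.differentiableWithinAt
    · rw [interior_Ico]
      intro r hr
      rw [(hder _ r hr).deriv]
      refine mul_nonneg (Real.rpow_nonneg (by linarith [hr.2]) _) ?_
      have := (hGT r ⟨hr.1.le, hr.2⟩).1
      rw [sub_nonneg, one_div, le_inv_mul_iff₀ hc]; exact this
  set W : ℝ → ℝ := (Set.Ico (0 : ℝ) 1).indicator (fun r => G r / (1 - r)) with hW
  have hWv : ∀ r ∈ Set.Ico (0 : ℝ) 1, W r = G r / (1 - r) := fun r hr =>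
    Set.indicator_of_mem hr _
  have hWr : ∀ x : ℝ, ∀ r ∈ Set.Ico (0 : ℝ) 1, W r * (1 - r) ^ (1 - x) = G r * (1 - r) ^ (-x) := by
    intro x r hr
    have hd : 0 < 1 - r := by linarith [hr.2]
    rw [hWv r hr, sub_eq_add_neg 1 x, Real.rpow_add hd, Real.rpow_one]
    field_simp
  refine ⟨1 / C, 1 / c, W, by positivity, ⟨?_, ?_, ?_, ?_⟩, ?_⟩
  · classical
    rw [hW, ← Set.piecewise_eq_indicator]
    refine ContinuousOn.measurable_piecewise ?_ continuousOn_const measurableSet_Ico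
    refine (hGc.mono Set.Ico_subset_Icc_self).div (by fun_prop) ?_
    intro x hx; linarith [hx.2]
  · intro r hr
    rw [hWv r hr]
    exact div_pos ((mul_pos hc (hTpos r hr)).trans_le (hGT r hr).1) (by linarith [hr.2])
  · intro r s hr hrs hs
    rw [hWr _ r ⟨hr, hrs.trans_lt hs⟩, hWr _ s ⟨hr.trans hrs, hs⟩]
    exact hanti ⟨hr, hrs.trans_lt hs⟩ ⟨hr.trans hrs, hs⟩ hrs
  · intro r s hr hrs hs
    rw [hWr _ r ⟨hr, hrs.trans_lt hs⟩, hWr _ s ⟨hr.trans hrs, hs⟩]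
    exact hmono ⟨hr, hrs.trans_lt hs⟩ ⟨hr.trans hrs, hs⟩ hrs
  -- Each of the two averagings costs one factor c or C, so c² w ≤ W ≤ C² w.
  · refine ⟨max (1 / c ^ 2) (C ^ 2), by positivity, fun r hr => ?_⟩
    have hd : 0 < 1 - r := by linarith [hr.2]
    have w0 := hpos r hr
    have g1 : c * h r ≤ W r := by
      rw [hWv r hr, hh, ← mul_div_assoc]
      exact div_le_div_of_nonneg_right (hGT r hr).1 hd.le
    have g2 : W r ≤ C * h r := by
      rw [hWv r hr, hh, ← mul_div_assoc]
      exact div_le_div_of_nonneg_right (hGT r hr).2 hd.le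
    have g3 : c ^ 2 * w r ≤ W r := by nlinarith [(hh1 r hr).1]
    have g4 : W r ≤ C ^ 2 * w r := by nlinarith [(hh1 r hr).2]
    constructor
    · calc w r ≤ 1 / c ^ 2 * W r := by
            rw [one_div, le_inv_mul_iff₀ (by positivity)]; exact g3
        _ ≤ _ := by
            refine mul_le_mul_of_nonneg_right (le_max_left _ _) ?_
            exact le_trans (by positivity) g3
    · exact g4.trans (mul_le_mul_of_nonneg_right (le_max_right _ _) w0.le)

/-! ### The Whitney decomposition of the disc -/

/-- A decomposition of the disc into cells whose diameter is comparable to the distance to the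
unit circle, such that the enlarged cells overlap a bounded number of times. -/
structure WhitneyCover (ι : Type) where
  center : ι → ℂ
  cell : ι → Set ℂ
  center_mem : ∀ j, center j ∈ disc
  measurableSet_cell : ∀ j, MeasurableSet (cell j)
  pairwise_disjoint : Pairwise (Function.onFun Disjoint cell)
  iUnion_cell : ⋃ j, cell j = disc
  cell_subset : ∀ j, cell j ⊆ Metric.closedBall (center j) ((1 - ‖center j‖) / 4)
  overlap : ℕ
  tsum_indicator_le : ∀ z : ℂ, ∑' j,
    (Metric.ball (center j) ((1 - ‖center j‖) / 2)).indicator (fun _ => (1 : ℝ≥0∞)) z ≤ overlap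

/-- The index of the cell of a point: its dyadic level, and its position in the grid that belongs
to this level. -/
def cellIndex (z : ℂ) : ℕ × ℤ × ℤ :=
  let m := ⌊-Real.logb 2 (1 - ‖z‖)⌋₊
  (m, ⌊2 ^ (m + 4) * z.re⌋, ⌊2 ^ (m + 4) * z.im⌋)

lemma measurable_cellIndex : Measurable cellIndex := by
  have hm : Measurable fun z : ℂ => ⌊-Real.logb 2 (1 - ‖z‖)⌋₊ := by
    refine Nat.measurable_floor.comp ?_
    unfold Real.logb
    fun_prop
  have hp : Measurable fun z : ℂ => (2 : ℝ) ^ (⌊-Real.logb 2 (1 - ‖z‖)⌋₊ + 4) :=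
    (measurable_from_top (f := fun m : ℕ => (2 : ℝ) ^ (m + 4))).comp hm
  unfold cellIndex
  refine hm.prodMk ((Int.measurable_floor.comp ?_).prodMk (Int.measurable_floor.comp ?_))
  · exact hp.mul Complex.measurable_re
  · exact hp.mul Complex.measurable_im

lemma cellIndex_level {z : ℂ} (hz : z ∈ disc) :
    (1 / 2 : ℝ) ^ ((cellIndex z).1 + 1) < 1 - ‖z‖ ∧ 1 - ‖z‖ ≤ (1 / 2 : ℝ) ^ (cellIndex z).1 := by
  have hz1 : 0 < 1 - ‖z‖ := by
    have := mem_ball_zero_iff.1 hz; linarith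
  have hz2 : 1 - ‖z‖ ≤ 1 := by linarith [norm_nonneg z]
  set x := -Real.logb 2 (1 - ‖z‖) with hx
  have hx0 : 0 ≤ x := by
    have := Real.logb_nonpos one_lt_two hz1.le hz2
    linarith
  have e : 1 - ‖z‖ = (2 : ℝ) ^ (-x) := by
    rw [hx, neg_neg, Real.rpow_logb (by norm_num) (by norm_num) hz1]
  have hfst : (cellIndex z).1 = ⌊x⌋₊ := rfl
  have half : ∀ k : ℕ, (1 / 2 : ℝ) ^ k = (2 : ℝ) ^ (-(k : ℝ)) := by
    intro k; rw [Real.rpow_neg (by norm_num), Real.rpow_natCast]; simp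
  rw [hfst, half, half, e]
  constructor
  · refine Real.rpow_lt_rpow_of_exponent_lt one_lt_two ?_
    have := Nat.lt_floor_add_one x
    push_cast; linarith
  · refine Real.rpow_le_rpow_of_exponent_le one_le_two ?_
    have := Nat.floor_le hx0
    linarith

/-- The mesh 2^(-(m+4)) at level m is chosen for this: two points of one grid square are within 2 ·
2^(-(m+4)) = 2^(-(m+1))/4, and 2^(-(m+1)) < 1 - |a|. -/
lemma dist_le_of_cellIndex_eq {z a : ℂ} (ha : a ∈ disc) (h : cellIndex z = cellIndex a) :
    ‖z - a‖ ≤ (1 - ‖a‖) / 4 := by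
  obtain ⟨h1, -⟩ := cellIndex_level ha
  set m := (cellIndex a).1 with hm
  have hmz : (cellIndex z).1 = m := by rw [h]
  have hre : ⌊(2 : ℝ) ^ (m + 4) * z.re⌋ = ⌊(2 : ℝ) ^ (m + 4) * a.re⌋ := by
    have : ⌊(2 : ℝ) ^ ((cellIndex z).1 + 4) * z.re⌋ = ⌊(2 : ℝ) ^ ((cellIndex a).1 + 4) * a.re⌋ :=
      congrArg (fun t => t.2.1) h
    rwa [hmz] at this
  have him : ⌊(2 : ℝ) ^ (m + 4) * z.im⌋ = ⌊(2 : ℝ) ^ (m + 4) * a.im⌋ := by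
    have : ⌊(2 : ℝ) ^ ((cellIndex z).1 + 4) * z.im⌋ = ⌊(2 : ℝ) ^ ((cellIndex a).1 + 4) * a.im⌋ :=
      congrArg (fun t => t.2.2) h
    rwa [hmz] at this
  have p : (0 : ℝ) < 2 ^ (m + 4) := by positivity
  have r1 : |z.re - a.re| ≤ (1 / 2) ^ (m + 4) := by
    have := (Int.abs_sub_lt_one_of_floor_eq_floor hre).le
    rw [← mul_sub, abs_mul, abs_of_pos p] at this
    rw [div_pow, one_pow, le_div_iff₀ p]; linarith
  have r2 : |z.im - a.im| ≤ (1 / 2) ^ (m + 4) := by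
    have := (Int.abs_sub_lt_one_of_floor_eq_floor him).le
    rw [← mul_sub, abs_mul, abs_of_pos p] at this
    rw [div_pow, one_pow, le_div_iff₀ p]; linarith
  have r3 := Complex.norm_le_abs_re_add_abs_im (z - a)
  simp only [Complex.sub_re, Complex.sub_im] at r3
  have e : (1 / 2 : ℝ) ^ (m + 1) = 8 * (1 / 2) ^ (m + 4) := by ring
  rw [e] at h1
  linarith

/-- The indices of the cells whose enlargement can contain `z`. -/
@[irreducible] def nearCells (z : ℂ) : Finset (ℕ × ℤ × ℤ) :=
  ((Finset.range 3 ×ˢ Finset.Icc (-9 : ℤ) 9) ×ˢ Finset.Icc (-9 : ℤ) 9).image fun d =>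
    let m := (cellIndex z).1 + d.1.1 - 1
    (m, ⌊2 ^ (m + 4) * z.re⌋ + d.1.2, ⌊2 ^ (m + 4) * z.im⌋ + d.2)

/-- Three levels and 19 offsets in each coordinate: 1083 = 3 · 19 · 19. -/
lemma card_nearCells_le (z : ℂ) : (nearCells z).card ≤ 1083 := by
  unfold nearCells
  refine Finset.card_image_le.trans ?_
  simp [Finset.card_product]

lemma floor_sub_mem_Icc {x y : ℝ} (h : |x - y| ≤ 8) : ⌊x⌋ - ⌊y⌋ ∈ Finset.Icc (-9 : ℤ) 9 := by
  rw [abs_le] at h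
  have h1 := Int.floor_le x
  have h2 := Int.lt_floor_add_one x
  have h3 := Int.floor_le y
  have h4 := Int.lt_floor_add_one y
  rw [Finset.mem_Icc]
  constructor
  · have : (-10 : ℝ) < ((⌊x⌋ - ⌊y⌋ : ℤ) : ℝ) := by push_cast; linarith
    have : (-10 : ℤ) < ⌊x⌋ - ⌊y⌋ := by exact_mod_cast this
    omega
  · have : ((⌊x⌋ - ⌊y⌋ : ℤ) : ℝ) < 10 := by push_cast; linarith
    have : ⌊x⌋ - ⌊y⌋ < (10 : ℤ) := by exact_mod_cast this
    omega

-- If z is within (1 - |a|)/2 of a, then 1 - |z| and 1 - |a| agree up to a factor 2, so the levels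
-- differ by at most one. At the level m of a, the distance is at most 2^(-m)/2, which is 8 meshes,
-- so the integer parts differ by at most 9.
set_option maxRecDepth 10000 in
lemma cellIndex_mem_nearCells {z a : ℂ} (ha : a ∈ disc)
    (h : z ∈ Metric.ball a ((1 - ‖a‖) / 2)) : cellIndex a ∈ nearCells z := by
  have ha1 : ‖a‖ < 1 := mem_ball_zero_iff.1 ha
  rw [mem_ball_iff_norm] at h
  have n1 : ‖z‖ ≤ ‖a‖ + ‖z - a‖ := by simpa using norm_add_le a (z - a)
  have n2 : ‖a‖ ≤ ‖z‖ + ‖z - a‖ := by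
    have := norm_sub_le z (z - a); simpa using this
  have hz : z ∈ disc := mem_ball_zero_iff.2 (by linarith)
  have a1 := (cellIndex_level ha).1
  have a2 := (cellIndex_level ha).2
  have z1 := (cellIndex_level hz).1
  have z2 := (cellIndex_level hz).2
  set m := (cellIndex a).1 with hm
  set l := (cellIndex z).1 with hl
  have hanti : ∀ {i j : ℕ}, (1 / 2 : ℝ) ^ i < (1 / 2) ^ j → j < i := fun {i j} hij =>
    (pow_lt_pow_iff_right_of_lt_one₀ (by norm_num) (by norm_num)).1 hij
  have c1 : l < m + 2 := by
    have : (1 / 2 : ℝ) ^ (m + 2) < (1 / 2) ^ l := by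
      have : (1 / 2 : ℝ) ^ (m + 2) = (1 / 2) ^ (m + 1) / 2 := by ring
      linarith
    exact hanti this
  have c2 : m < l + 2 := by
    have : (1 / 2 : ℝ) ^ (l + 2) < (1 / 2) ^ m := by
      have : (1 / 2 : ℝ) ^ (l + 2) = (1 / 2) ^ (l + 1) / 2 := by ring
      have : 0 < (1 / 2 : ℝ) ^ (l + 1) := by positivity
      linarith
    exact hanti this
  have ea : cellIndex a = (m, ⌊(2 : ℝ) ^ (m + 4) * a.re⌋, ⌊(2 : ℝ) ^ (m + 4) * a.im⌋) := rfl
  clear_value m l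
  have p : (0 : ℝ) < 2 ^ (m + 4) := by positivity
  have sz : (2 : ℝ) ^ (m + 4) * ‖a - z‖ ≤ 8 := by
    rw [norm_sub_rev]
    have e : (2 : ℝ) ^ (m + 4) * (1 / 2) ^ m = 16 := by
      rw [pow_add, mul_right_comm, ← mul_pow]; norm_num
    have : (2 : ℝ) ^ (m + 4) * ‖z - a‖ ≤ 2 ^ (m + 4) * ((1 / 2) ^ m / 2) := by
      gcongr; linarith
    linarith
  have f1 : |(2 : ℝ) ^ (m + 4) * a.re - 2 ^ (m + 4) * z.re| ≤ 8 := by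
    rw [← mul_sub, abs_mul, abs_of_pos p]
    refine le_trans ?_ sz
    gcongr
    simpa using Complex.abs_re_le_norm (a - z)
  have f2 : |(2 : ℝ) ^ (m + 4) * a.im - 2 ^ (m + 4) * z.im| ≤ 8 := by
    rw [← mul_sub, abs_mul, abs_of_pos p]
    refine le_trans ?_ sz
    gcongr
    simpa using Complex.abs_im_le_norm (a - z)
  -- The level offset is shifted by one to stay in ℕ; l ≤ m + 1 keeps the subtraction from
  -- truncating.
  have em : l + (m + 1 - l) - 1 = m := by omega
  have hd : ((m + 1 - l, ⌊(2 : ℝ) ^ (m + 4) * a.re⌋ - ⌊(2 : ℝ) ^ (m + 4) * z.re⌋),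
      ⌊(2 : ℝ) ^ (m + 4) * a.im⌋ - ⌊(2 : ℝ) ^ (m + 4) * z.im⌋) ∈
      (Finset.range 3 ×ˢ Finset.Icc (-9 : ℤ) 9) ×ˢ Finset.Icc (-9 : ℤ) 9 := by
    rw [Finset.mem_product, Finset.mem_product]
    refine And.intro (And.intro ?_ ?_) ?_
    · exact Finset.mem_range.2 (show m + 1 - l < 3 by omega)
    · exact floor_sub_mem_Icc f1
    · exact floor_sub_mem_Icc f2
  unfold nearCells
  rw [← hl, ea]
  have := Finset.mem_image_of_mem (fun d : (ℕ × ℤ) × ℤ => (l + d.1.1 - 1,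
    ⌊(2 : ℝ) ^ (l + d.1.1 - 1 + 4) * z.re⌋ + d.1.2,
    ⌊(2 : ℝ) ^ (l + d.1.1 - 1 + 4) * z.im⌋ + d.2)) hd
  simpa only [em, add_sub_cancel] using this

/-- The indices of the nonempty cells. -/
abbrev CellIndex : Type := {j : ℕ × ℤ × ℤ // ∃ z ∈ disc, cellIndex z = j}

/-- Distinct cells have distinct indices, so the number of enlarged cells containing z is at most
the number of indices near z. -/
lemma tsum_indicator_ball_le {a : CellIndex → ℂ} (ha : ∀ j, a j ∈ disc)
    (hidx : ∀ j, cellIndex (a j) = j.1) (z : ℂ) :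
    ∑' j, (Metric.ball (a j) ((1 - ‖a j‖) / 2)).indicator (fun _ => (1 : ℝ≥0∞)) z
      ≤ (1083 : ℕ) := by
  classical
  rw [tsum_eq_sum (s := (nearCells z).subtype fun j => ∃ z ∈ disc, cellIndex z = j)]
  · calc _ ≤ ∑ j ∈ (nearCells z).subtype fun j => ∃ z ∈ disc, cellIndex z = j, (1 : ℝ≥0∞) :=
          Finset.sum_le_sum fun j _ => Set.indicator_le_self _ _ z
      _ = (((nearCells z).subtype fun j => ∃ z ∈ disc, cellIndex z = j).card : ℝ≥0∞) := by
          rw [Finset.sum_const, nsmul_one]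
      _ ≤ _ := by
          refine Nat.cast_le.2 (le_trans ?_ (card_nearCells_le z))
          rw [Finset.card_subtype]
          exact Finset.card_filter_le _ _
  · intro j hj
    refine Set.indicator_of_notMem (fun hz => hj ?_) _
    have h := cellIndex_mem_nearCells (ha j) hz
    rw [hidx j] at h
    exact Finset.mem_subtype.2 h

/-- The Whitney decomposition of the disc by dyadic squares. -/
def dyadicCover : WhitneyCover CellIndex where
  center j := j.2.choose
  cell j := disc ∩ cellIndex ⁻¹' {j.1}
  center_mem j := j.2.choose_spec.1
  measurableSet_cell j :=
    Metric.isOpen_ball.measurableSet.inter (measurable_cellIndex (measurableSet_singleton _))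
  pairwise_disjoint := by
    intro i j hij
    refine Set.disjoint_left.2 fun z hz hz' => hij (Subtype.ext ?_)
    exact hz.2.symm.trans hz'.2
  iUnion_cell := by
    ext z
    simp only [Set.mem_iUnion]
    exact ⟨fun ⟨j, hj⟩ => hj.1, fun hz => ⟨⟨cellIndex z, z, hz, rfl⟩, hz, rfl⟩⟩
  cell_subset := by
    intro j z hz
    rw [mem_closedBall_iff_norm]
    exact dist_le_of_cellIndex_eq j.2.choose_spec.1 (hz.2.trans j.2.choose_spec.2.symm)
  overlap := 1083
  tsum_indicator_le := tsum_indicator_ball_le (fun j => j.2.choose_spec.1)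
    (fun j => j.2.choose_spec.2)

/-! ### The sub-mean value property of |f|^p -/

lemma lintegral_ball_eq_polar {g : ℂ → ℝ≥0∞} {c : ℂ} {d : ℝ}
    (hg : Measurable ((Metric.ball c d).indicator g)) :
    ∫⁻ z in Metric.ball c d, g z = ∫⁻ r in Set.Ioo 0 d,
      ENNReal.ofReal r * ∫⁻ θ in Set.Ioo (-Real.pi) Real.pi, g (circleMap c r θ) := by
  set G := (Metric.ball c d).indicator g with hG
  have hcm : Measurable fun p : ℝ × ℝ => circleMap c p.1 p.2 := by
    unfold circleMap; fun_prop
  have e1 : ∀ p : ℝ × ℝ, c + Complex.polarCoord.symm p = circleMap c p.1 p.2 := by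
    intro p
    rw [Complex.polarCoord_symm_apply, circleMap, Complex.exp_mul_I]
    push_cast; rfl
  rw [← lintegral_indicator Metric.isOpen_ball.measurableSet, ← hG,
    ← lintegral_add_left_eq_self G c, ← Complex.lintegral_comp_polarCoord_symm, polarCoord_target,
    Measure.volume_eq_prod, ← Measure.prod_restrict, lintegral_prod]
  · have hsub : Set.Ioo (0 : ℝ) d = Set.Iio d ∩ Set.Ioi 0 := by
      ext x; simp [and_comm]
    rw [hsub, ← Measure.restrict_restrict measurableSet_Iio,
      ← lintegral_indicator measurableSet_Iio]
    refine setLIntegral_congr_fun measurableSet_Ioi fun r hr => ?_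
    simp only [e1, smul_eq_mul]
    have hmem : ∀ θ, circleMap c r θ ∈ Metric.ball c d ↔ r < d := by
      intro θ
      rw [mem_ball_iff_norm, circleMap_sub_center, norm_circleMap_zero, abs_of_pos hr]
    by_cases hrd : r < d
    · rw [Set.indicator_of_mem (show r ∈ Set.Iio d from hrd), lintegral_const_mul']
      · congr 1
        refine lintegral_congr fun θ => ?_
        rw [hG, Set.indicator_of_mem ((hmem θ).2 hrd)]
      · exact ENNReal.ofReal_ne_top
    · rw [Set.indicator_of_notMem (show r ∉ Set.Iio d from hrd), ← lintegral_zero (α := ℝ)]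
      refine lintegral_congr fun θ => ?_
      rw [hG, Set.indicator_of_notMem (fun h => hrd ((hmem θ).1 h)), mul_zero]
  · simp only [e1, smul_eq_mul]
    exact ((ENNReal.measurable_ofReal.comp measurable_fst).mul (hg.comp hcm)).aemeasurable

lemma measurable_indicator_enorm_rpow {f : ℂ → ℂ} {U : Set ℂ} (hU : IsOpen U)
    (hf : ContinuousOn f U) (p : ℝ) : Measurable (U.indicator fun z => ‖f z‖ₑ ^ p) := by
  classical
  have h1 : Measurable (U.indicator f) := by
    rw [← Set.piecewise_eq_indicator]
    exact hf.measurable_piecewise continuousOn_const hU.measurableSet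
  have h2 : U.indicator (fun z => ‖f z‖ₑ ^ p) = U.indicator (fun z => ‖U.indicator f z‖ₑ ^ p) := by
    ext z
    by_cases hz : z ∈ U <;> simp [hz]
  rw [h2]
  exact (h1.enorm.pow_const p).indicator hU.measurableSet

lemma two_pi_mul_enorm_le {f : ℂ → ℂ} {c : ℂ} {r d : ℝ} (hr : 0 < r) (hrd : r < d)
    (hf : DifferentiableOn ℂ f (Metric.ball c d)) :
    ENNReal.ofReal (2 * Real.pi) * ‖f c‖ₑ ≤
      ∫⁻ θ in Set.Ioo (-Real.pi) Real.pi, ‖f (circleMap c r θ)‖ₑ := by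
  have hdc : DiffContOnCl ℂ f (Metric.ball c |r|) := by
    refine DifferentiableOn.diffContOnCl_ball (U := Metric.ball c d) hf ?_
    rw [abs_of_pos hr]; exact Metric.closedBall_subset_ball hrd
  have hav := hdc.circleAverage
  have hper : ∫ θ in (0 : ℝ)..2 * Real.pi, f (circleMap c r θ) =
      ∫ θ in (-Real.pi)..Real.pi, f (circleMap c r θ) := by
    have hp : Function.Periodic (fun θ => f (circleMap c r θ)) (2 * Real.pi) := fun θ => by
      simp only [periodic_circleMap c r θ]
    have := hp.intervalIntegral_add_eq 0 (-Real.pi)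
    rw [zero_add] at this
    rw [this]; congr 1; ring
  have hpi : -Real.pi ≤ Real.pi := by linarith [Real.pi_pos]
  rw [Real.circleAverage_def, hper, intervalIntegral.integral_of_le hpi,
    integral_Ioc_eq_integral_Ioo] at hav
  have h2 : (2 * Real.pi) • f c = ∫ θ in Set.Ioo (-Real.pi) Real.pi, f (circleMap c r θ) := by
    rw [← hav, smul_smul, mul_inv_cancel₀ (by positivity), one_smul]
  have h3 : ENNReal.ofReal (2 * Real.pi) * ‖f c‖ₑ = ‖(2 * Real.pi) • f c‖ₑ := by
    rw [enorm_smul, Real.enorm_of_nonneg (by positivity)]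
  rw [h3, h2]
  exact enorm_integral_le_lintegral_enorm _

/-- The circle means, integrated against r dr. -/
lemma area_mul_enorm_le {f : ℂ → ℂ} {c : ℂ} {d : ℝ} (hd : 0 < d)
    (hf : DifferentiableOn ℂ f (Metric.ball c d)) :
    ENNReal.ofReal (Real.pi * d ^ 2) * ‖f c‖ₑ ≤ ∫⁻ z in Metric.ball c d, ‖f z‖ₑ := by
  have hm := measurable_indicator_enorm_rpow Metric.isOpen_ball hf.continuousOn 1
  simp only [ENNReal.rpow_one] at hm
  rw [lintegral_ball_eq_polar hm]
  calc ENNReal.ofReal (Real.pi * d ^ 2) * ‖f c‖ₑ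
      = (∫⁻ r in Set.Ioo 0 d, ENNReal.ofReal r) * (ENNReal.ofReal (2 * Real.pi) * ‖f c‖ₑ) := by
        have : ∫⁻ r in Set.Ioo 0 d, ENNReal.ofReal r = ENNReal.ofReal (d ^ 2 / 2) := by
          rw [← ofReal_integral_eq_lintegral_ofReal]
          · rw [← integral_Ioc_eq_integral_Ioo, ← intervalIntegral.integral_of_le hd.le,
              integral_id]
            simp
          · exact (continuous_id.integrableOn_Icc (a := 0) (b := d)).mono_set
              Set.Ioo_subset_Icc_self
          · exact (ae_restrict_iff' measurableSet_Ioo).2 (Eventually.of_forall fun x hx => hx.1.le)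
        rw [this, ← mul_assoc, ← ENNReal.ofReal_mul (by positivity)]
        congr 2; ring
    _ = ∫⁻ r in Set.Ioo 0 d, ENNReal.ofReal r * (ENNReal.ofReal (2 * Real.pi) * ‖f c‖ₑ) := by
        rw [lintegral_mul_const _ ENNReal.measurable_ofReal]
    _ ≤ _ := by
        refine setLIntegral_mono' measurableSet_Ioo fun r hr => ?_
        gcongr
        exact two_pi_mul_enorm_le hr.1 hr.2 hf

/-- A maximal-point argument in place of subharmonicity of |f|^p. Let y maximize (ρ - |y - c|)^(2/p)
|f(y)|. On the disc about y of half the remaining radius, |f| ≤ 2^(2/p) |f(y)|. In the area mean of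
|f| over that disc write |f| = |f|^(1-p) |f|^p, bound the first factor by this maximum, and cancel
|f(y)|^(1-p). The maximality of y carries the estimate back to c. -/
lemma sq_mul_enorm_rpow_le_of_le_one {p : ℝ} (hp : 0 < p) (hp1 : p ≤ 1) {f : ℂ → ℂ} {c : ℂ}
    {r : ℝ} (hr : 0 < r) (hf : DifferentiableOn ℂ f (Metric.ball c r)) :
    ENNReal.ofReal (r ^ 2) * ‖f c‖ₑ ^ p ≤
      ENNReal.ofReal (16 * (2 ^ (2 / p)) ^ (1 - p)) * ∫⁻ z in Metric.ball c r, ‖f z‖ₑ ^ p := by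
  -- Halving the radius gives a compact disc inside the open one, so that the maximum is attained.
  set ρ := r / 2 with hρ
  have hρ0 : 0 < ρ := by positivity
  have hsub : Metric.closedBall c ρ ⊆ Metric.ball c r :=
    Metric.closedBall_subset_ball (by linarith)
  obtain ⟨y, hy, hmax⟩ := (isCompact_closedBall c ρ).exists_isMaxOn
    ⟨c, Metric.mem_closedBall_self hρ0.le⟩
    (f := fun y => (ρ - ‖y - c‖) ^ (2 / p) * ‖f y‖) (by
      refine ContinuousOn.mul ?_ (hf.continuousOn.mono hsub).norm
      exact ContinuousOn.rpow_const (by fun_prop) fun _ _ => Or.inr (by positivity))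
  have hmax' : ∀ x ∈ Metric.closedBall c ρ,
    (ρ - ‖x - c‖) ^ (2 / p) * ‖f x‖ ≤ (ρ - ‖y - c‖) ^ (2 / p) * ‖f y‖ := fun x hx => hmax hx
  rw [mem_closedBall_iff_norm] at hy
  have hc := hmax' c (Metric.mem_closedBall_self hρ0.le)
  rw [sub_self, norm_zero, sub_zero] at hc
  rcases eq_or_ne (f c) 0 with h0 | h0
  · simp [h0, ENNReal.zero_rpow_of_pos hp]
  have hNpos : 0 < (ρ - ‖y - c‖) ^ (2 / p) * ‖f y‖ :=
    lt_of_lt_of_le (mul_pos (by positivity) (norm_pos_iff.2 h0)) hc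
  have hfy : 0 < ‖f y‖ := by
    by_contra h
    have : ‖f y‖ = 0 := le_antisymm (not_lt.1 h) (norm_nonneg _)
    rw [this] at hNpos; simp at hNpos
  set d := (ρ - ‖y - c‖) / 2 with hd
  have hd2 : ρ - ‖y - c‖ = 2 * d := by rw [hd]; ring
  have hd0 : 0 < d := by
    rcases (by linarith : 0 ≤ ρ - ‖y - c‖).eq_or_lt with h | h
    · rw [← h, Real.zero_rpow (by positivity)] at hNpos; simp at hNpos
    · linarith
  rw [hd2] at hc hmax' hNpos
  have hball : Metric.ball y d ⊆ Metric.closedBall c ρ := by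
    intro z hz
    rw [mem_ball_iff_norm] at hz
    rw [mem_closedBall_iff_norm]
    have := norm_add_le (z - y) (y - c)
    rw [sub_add_sub_cancel] at this
    linarith
  have hbd : ∀ z ∈ Metric.ball y d, ‖f z‖ ≤ 2 ^ (2 / p) * ‖f y‖ := by
    intro z hz
    have h1 := hmax' z (hball hz)
    have h2 : d ≤ ρ - ‖z - c‖ := by
      rw [mem_ball_iff_norm] at hz
      have := norm_add_le (z - y) (y - c)
      rw [sub_add_sub_cancel] at this
      linarith
    have h3 : d ^ (2 / p) * ‖f z‖ ≤ (2 * d) ^ (2 / p) * ‖f y‖ :=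
      le_trans (by gcongr) h1
    rw [Real.mul_rpow (by norm_num) hd0.le] at h3
    have h4 : 0 < d ^ (2 / p) := by positivity
    nlinarith
  set K := ENNReal.ofReal (2 ^ (2 / p)) with hK
  have hbdE : ∀ z ∈ Metric.ball y d, ‖f z‖ₑ ≤ K * ‖f y‖ₑ := by
    intro z hz
    rw [← ofReal_norm, ← ofReal_norm, hK, ← ENNReal.ofReal_mul (by positivity)]
    exact ENNReal.ofReal_le_ofReal (hbd z hz)
  have h1p : 0 ≤ 1 - p := by linarith
  have hsplit : ∀ x : ℝ≥0∞, x = x ^ (1 - p) * x ^ p := by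
    intro x
    rw [← ENNReal.rpow_add_of_nonneg _ _ h1p hp.le]; simp
  set I := ∫⁻ z in Metric.ball c r, ‖f z‖ₑ ^ p with hI
  have hm : ENNReal.ofReal (Real.pi * d ^ 2) * ‖f y‖ₑ ≤ (K * ‖f y‖ₑ) ^ (1 - p) * I := by
    refine (area_mul_enorm_le hd0 (hf.mono (hball.trans hsub))).trans ?_
    calc ∫⁻ z in Metric.ball y d, ‖f z‖ₑ
        ≤ ∫⁻ z in Metric.ball y d, (K * ‖f y‖ₑ) ^ (1 - p) * ‖f z‖ₑ ^ p := by
          refine setLIntegral_mono' Metric.isOpen_ball.measurableSet fun z hz => ?_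
          conv_lhs => rw [hsplit ‖f z‖ₑ]
          gcongr
          exact hbdE z hz
      _ = (K * ‖f y‖ₑ) ^ (1 - p) * ∫⁻ z in Metric.ball y d, ‖f z‖ₑ ^ p := by
          refine lintegral_const_mul' _ _ ?_
          exact ENNReal.rpow_ne_top_of_nonneg h1p
            (ENNReal.mul_ne_top ENNReal.ofReal_ne_top enorm_ne_top)
      _ ≤ _ := by
          gcongr
          exact lintegral_mono_set (hball.trans hsub)
  have hm2 : ENNReal.ofReal (Real.pi * d ^ 2) * ‖f y‖ₑ ^ p ≤ K ^ (1 - p) * I := by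
    rw [ENNReal.mul_rpow_of_nonneg _ _ h1p] at hm
    conv_lhs at hm => rw [hsplit ‖f y‖ₑ]
    have hne0 : ‖f y‖ₑ ^ (1 - p) ≠ 0 := by
      have : ‖f y‖ₑ ≠ 0 := by simpa using norm_pos_iff.1 hfy
      simp [ENNReal.rpow_eq_zero_iff, this]
    have hnet : ‖f y‖ₑ ^ (1 - p) ≠ ∞ := ENNReal.rpow_ne_top_of_nonneg h1p enorm_ne_top
    rw [← ENNReal.mul_le_mul_iff_right hne0 hnet]
    calc _ = ENNReal.ofReal (Real.pi * d ^ 2) * (‖f y‖ₑ ^ (1 - p) * ‖f y‖ₑ ^ p) := by ring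
      _ ≤ _ := hm
      _ = _ := by ring
  have hcp : ρ ^ 2 * ‖f c‖ ^ p ≤ (2 * d) ^ 2 * ‖f y‖ ^ p := by
    have := Real.rpow_le_rpow (by positivity) hc hp.le
    rw [Real.mul_rpow (by positivity) (by positivity), Real.mul_rpow (by positivity) (by positivity),
      ← Real.rpow_mul (by positivity), ← Real.rpow_mul (by positivity), div_mul_cancel₀ _ hp.ne',
      Real.rpow_two, Real.rpow_two] at this
    exact this
  -- 16 = 4 · 4, from r = 2ρ and from the remaining radius 2d at y, both squared.
  have hcp2 : r ^ 2 * ‖f c‖ ^ p ≤ 16 * ((Real.pi * d ^ 2) * ‖f y‖ ^ p) := by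
    have e : r = 2 * ρ := by rw [hρ]; ring
    have : d ^ 2 * ‖f y‖ ^ p ≤ Real.pi * (d ^ 2 * ‖f y‖ ^ p) :=
      le_mul_of_one_le_left (by positivity) (by linarith [Real.pi_gt_three])
    rw [e]; nlinarith
  have tE : ∀ (s : ℝ) (z : ℂ), 0 ≤ s →
      ENNReal.ofReal s * ‖f z‖ₑ ^ p = ENNReal.ofReal (s * ‖f z‖ ^ p) := by
    intro s z hs
    rw [← ofReal_norm, ENNReal.ofReal_rpow_of_nonneg (norm_nonneg _) hp.le,
      ENNReal.ofReal_mul hs]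
  calc ENNReal.ofReal (r ^ 2) * ‖f c‖ₑ ^ p
      ≤ ENNReal.ofReal 16 * (ENNReal.ofReal (Real.pi * d ^ 2) * ‖f y‖ₑ ^ p) := by
        rw [tE _ _ (by positivity), tE _ _ (by positivity), ← ENNReal.ofReal_mul (by positivity)]
        exact ENNReal.ofReal_le_ofReal hcp2
    _ ≤ ENNReal.ofReal 16 * (K ^ (1 - p) * I) := by gcongr
    _ = _ := by
        rw [ENNReal.ofReal_mul (by norm_num), hK, ENNReal.ofReal_rpow_of_nonneg (by positivity) h1p,
          mul_assoc]

/-- Hölder's inequality applied to the area mean of |f|. -/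
lemma sq_mul_enorm_rpow_le_of_one_lt {p : ℝ} (hp1 : 1 < p) {f : ℂ → ℂ} {c : ℂ}
    {r : ℝ} (hr : 0 < r) (hf : DifferentiableOn ℂ f (Metric.ball c r)) :
    ENNReal.ofReal (r ^ 2) * ‖f c‖ₑ ^ p ≤ ∫⁻ z in Metric.ball c r, ‖f z‖ₑ ^ p := by
  set I := ∫⁻ z in Metric.ball c r, ‖f z‖ₑ ^ p with hI
  set A := ENNReal.ofReal (Real.pi * r ^ 2) with hA
  have hp : 0 < p := by linarith
  have hA0 : A ≠ 0 := by rw [hA, Ne, ENNReal.ofReal_eq_zero, not_le]; positivity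
  have hAt : A ≠ ∞ := ENNReal.ofReal_ne_top
  have hpq := Real.HolderConjugate.conjExponent hp1
  have hvol : volume (Metric.ball c r) = A := by
    rw [Complex.volume_ball, hA, mul_comm Real.pi, ENNReal.ofReal_mul (by positivity),
      ENNReal.ofReal_pow hr.le]
    congr 1
    rw [← NNReal.coe_real_pi, ENNReal.ofReal_coe_nnreal]
  have hH : ∫⁻ z in Metric.ball c r, ‖f z‖ₑ ≤ I ^ (1 / p) * A ^ (1 / p.conjExponent) := by
    have := ENNReal.lintegral_mul_le_Lp_mul_Lq (volume.restrict (Metric.ball c r)) hpq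
      (f := fun z => ‖f z‖ₑ) (g := fun _ => 1)
      (hf.continuousOn.aemeasurable Metric.isOpen_ball.measurableSet).enorm aemeasurable_const
    simpa [hvol] using this
  have h1 := (area_mul_enorm_le hr hf).trans hH
  have h2 := ENNReal.rpow_le_rpow h1 hp.le
  rw [ENNReal.mul_rpow_of_nonneg _ _ hp.le, ENNReal.mul_rpow_of_nonneg _ _ hp.le,
    ← ENNReal.rpow_mul, ← ENNReal.rpow_mul, one_div_mul_cancel hp.ne', ENNReal.rpow_one] at h2
  have e : 1 / p.conjExponent * p = p - 1 := by
    rw [Real.conjExponent]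
    have : p - 1 ≠ 0 := by linarith
    field_simp
  rw [e] at h2
  have e2 : A ^ p = A * A ^ (p - 1) := by
    conv_lhs => rw [show p = 1 + (p - 1) by ring]
    rw [ENNReal.rpow_add _ _ hA0 hAt, ENNReal.rpow_one]
  rw [← hA, e2] at h2
  have h3 : A * ‖f c‖ₑ ^ p ≤ I := by
    have n0 : A ^ (p - 1) ≠ 0 := by simp [ENNReal.rpow_eq_zero_iff, hA0, hAt]
    have nt : A ^ (p - 1) ≠ ∞ := ENNReal.rpow_ne_top_of_nonneg (by linarith) hAt
    rw [← ENNReal.mul_le_mul_iff_right n0 nt]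
    calc _ = A * A ^ (p - 1) * ‖f c‖ₑ ^ p := by ring
      _ ≤ _ := h2
      _ = _ := by ring
  refine le_trans ?_ h3
  gcongr
  exact ENNReal.ofReal_le_ofReal (by nlinarith [Real.pi_gt_three, sq_nonneg r])

/-- The sub-mean value property of `|f|^p` on discs, up to a constant. -/
lemma exists_submean {p : ℝ} (hp : 0 < p) : ∃ C : ℝ, 0 < C ∧ ∀ (f : ℂ → ℂ) (c : ℂ) (r : ℝ), 0 < r →
    DifferentiableOn ℂ f (Metric.ball c r) →
    ENNReal.ofReal (r ^ 2) * ‖f c‖ₑ ^ p ≤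
      ENNReal.ofReal C * ∫⁻ z in Metric.ball c r, ‖f z‖ₑ ^ p := by
  rcases le_or_gt p 1 with h | h
  · exact ⟨_, by positivity, fun f c r hr hf => sq_mul_enorm_rpow_le_of_le_one hp h hr hf⟩
  · exact ⟨1, one_pos, fun f c r hr hf => by
      simpa using sq_mul_enorm_rpow_le_of_one_lt h hr hf⟩

/-! ### The Forelli–Rudin estimate for power weights -/

lemma lintegral_Ioi_rpow {a c : ℝ} (ha : a < -1) (hc : 0 < c) :
    ∫⁻ t in Set.Ioi c, ENNReal.ofReal (t ^ a) = ENNReal.ofReal (c ^ (a + 1) / (-(a + 1))) := by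
  rw [← ofReal_integral_eq_lintegral_ofReal (integrableOn_Ioi_rpow_of_lt ha hc),
    integral_Ioi_rpow_of_lt ha hc, neg_div, div_neg]
  exact (ae_restrict_iff' measurableSet_Ioi).2
    (Eventually.of_forall fun x hx => Real.rpow_nonneg (hc.trans hx).le _)

lemma lintegral_Ioo_rpow {a d : ℝ} (ha : -1 < a) (hd : 0 < d) :
    ∫⁻ t in Set.Ioo 0 d, ENNReal.ofReal (t ^ a) = ENNReal.ofReal (d ^ (a + 1) / (a + 1)) := by
  have hi : IntegrableOn (fun t : ℝ => t ^ a) (Set.Ioo 0 d) := by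
    have := intervalIntegral.intervalIntegrable_rpow' (a := 0) (b := d) ha
    rw [intervalIntegrable_iff_integrableOn_Ioc_of_le hd.le] at this
    exact this.mono_set Set.Ioo_subset_Ioc_self
  rw [← ofReal_integral_eq_lintegral_ofReal hi, ← integral_Ioc_eq_integral_Ioo,
    ← intervalIntegral.integral_of_le hd.le, integral_rpow (Or.inl ha),
    Real.zero_rpow (by linarith), sub_zero]
  exact (ae_restrict_iff' measurableSet_Ioo).2
    (Eventually.of_forall fun x hx => Real.rpow_nonneg hx.1.le _)

lemma measurePreserving_one_sub : MeasurePreserving (fun r : ℝ => 1 - r) := by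
  simpa [sub_eq_add_neg, Function.comp_def] using
    (measurePreserving_add_left volume (1 : ℝ)).comp (Measure.measurePreserving_neg volume)

lemma measurableEmbedding_one_sub : MeasurableEmbedding (fun r : ℝ => 1 - r) :=
  (Homeomorph.subLeft (1 : ℝ)).measurableEmbedding

/-- With x the norm on the right, 1 - t ≤ x, and (2/π)|θ| ≤ |e^(iθ) - 1| ≤ (1 - t) + x ≤ 2x. Hence
|θ| ≤ πx < 4x unless x = 0, and the constant is 1 + 4. -/
lemma one_sub_add_abs_le {t θ : ℝ} (ht0 : 0 ≤ t) (ht : t < 1) (hθ : |θ| ≤ Real.pi) :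
    (1 - t) + |θ| ≤ 5 * ‖1 - (t : ℂ) * Complex.exp (θ * Complex.I)‖ := by
  set x := ‖1 - (t : ℂ) * Complex.exp (θ * Complex.I)‖ with hx
  have h1 : 1 - t ≤ x := by
    have := norm_sub_norm_le (1 : ℂ) ((t : ℂ) * Complex.exp (θ * Complex.I))
    rw [norm_mul, Complex.norm_exp_ofReal_mul_I, Complex.norm_of_nonneg ht0] at this
    simpa using this
  have h2 : ‖Complex.exp (θ * Complex.I) - 1‖ ≤ (1 - t) + x := by
    have e : Complex.exp (θ * Complex.I) - 1 =
        ((1 - t : ℝ) : ℂ) * Complex.exp (θ * Complex.I) -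
          (1 - (t : ℂ) * Complex.exp (θ * Complex.I)) := by push_cast; ring
    rw [e]
    refine (norm_sub_le _ _).trans ?_
    rw [norm_mul, Complex.norm_exp_ofReal_mul_I, Complex.norm_of_nonneg (by linarith), mul_one]
  have h3 : 2 / Real.pi * |θ| ≤ ‖Complex.exp (θ * Complex.I) - 1‖ := by
    rw [mul_comm (θ : ℂ), Complex.norm_exp_I_mul_ofReal_sub_one, norm_mul, Real.norm_eq_abs,
      Real.norm_eq_abs, abs_two]
    have := Real.mul_abs_le_abs_sin (x := θ / 2) (by
      rw [abs_div, abs_two]; linarith)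
    rw [abs_div, abs_two] at this
    linarith
  have hpi := Real.pi_pos
  have h4 : |θ| ≤ Real.pi * x := by
    have : 2 / Real.pi * |θ| ≤ 2 * x := by linarith
    rw [div_mul_eq_mul_div, div_le_iff₀ hpi] at this
    linarith
  nlinarith [Real.pi_lt_four, (norm_nonneg _ : 0 ≤ x)]

lemma lintegral_Ioi_add_rpow {γ ε : ℝ} (hγ : 1 < γ) (hε : 0 < ε) :
    ∫⁻ θ in Set.Ioi (0 : ℝ), ENNReal.ofReal ((ε + θ) ^ (-γ)) =
      ENNReal.ofReal (ε ^ (1 - γ) / (γ - 1)) := by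
  have h := (measurePreserving_add_left volume ε).setLIntegral_comp_preimage_emb
    (measurableEmbedding_addLeft ε) (fun t => ENNReal.ofReal (t ^ (-γ))) (Set.Ioi ε)
  have e : (fun x => ε + x) ⁻¹' Set.Ioi ε = Set.Ioi 0 := by ext x; simp
  rw [e, lintegral_Ioi_rpow (by linarith) hε] at h
  rw [h]
  congr 2
  · congr 1; ring
  · ring

lemma lintegral_add_abs_rpow_le {γ ε : ℝ} (hγ : 1 < γ) (hε : 0 < ε) :
    ∫⁻ θ : ℝ, ENNReal.ofReal ((ε + |θ|) ^ (-γ)) ≤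
      ENNReal.ofReal (2 / (γ - 1) * ε ^ (1 - γ)) := by
  have h1 : ∫⁻ θ in Set.Ioi (0 : ℝ), ENNReal.ofReal ((ε + |θ|) ^ (-γ)) =
      ENNReal.ofReal (ε ^ (1 - γ) / (γ - 1)) := by
    rw [← lintegral_Ioi_add_rpow hγ hε]
    refine setLIntegral_congr_fun measurableSet_Ioi fun x hx => ?_
    simp only [abs_of_pos (Set.mem_Ioi.1 hx)]
  have h2 : ∫⁻ θ in (Set.Ioi (0 : ℝ))ᶜ, ENNReal.ofReal ((ε + |θ|) ^ (-γ)) =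
      ENNReal.ofReal (ε ^ (1 - γ) / (γ - 1)) := by
    rw [← h1, Set.compl_Ioi, setLIntegral_congr Iio_ae_eq_Iic.symm]
    have := (Measure.measurePreserving_neg (volume : Measure ℝ)).setLIntegral_comp_preimage_emb
      (MeasurableEquiv.neg ℝ).measurableEmbedding
      (fun θ => ENNReal.ofReal ((ε + |θ|) ^ (-γ))) (Set.Ioi 0)
    simpa using this
  rw [← lintegral_add_compl _ measurableSet_Ioi, h1, h2, ← ENNReal.ofReal_add]
  · refine ENNReal.ofReal_le_ofReal (le_of_eq ?_); ring
  all_goals exact div_nonneg (by positivity) (by linarith)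

lemma lintegral_kernel_circle_le {γ t : ℝ} (hγ : 1 < γ) (ht0 : 0 ≤ t) (ht : t < 1) :
    ∫⁻ θ in Set.Ioo (-Real.pi) Real.pi,
      ENNReal.ofReal (‖1 - (t : ℂ) * Complex.exp (θ * Complex.I)‖ ^ (-γ)) ≤
      ENNReal.ofReal (5 ^ γ * (2 / (γ - 1)) * (1 - t) ^ (1 - γ)) := by
  calc _ ≤ ∫⁻ θ in Set.Ioo (-Real.pi) Real.pi,
        ENNReal.ofReal (5 ^ γ) * ENNReal.ofReal (((1 - t) + |θ|) ^ (-γ)) := by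
        refine setLIntegral_mono' measurableSet_Ioo fun θ hθ => ?_
        rw [← ENNReal.ofReal_mul (by positivity)]
        refine ENNReal.ofReal_le_ofReal ?_
        have h := one_sub_add_abs_le ht0 ht (abs_le.2 ⟨hθ.1.le, hθ.2.le⟩)
        have hpos : 0 < (1 - t) + |θ| := by have := abs_nonneg θ; linarith
        have h5 : (5 : ℝ) ^ γ = (5⁻¹) ^ (-γ) := by
          rw [Real.inv_rpow (by norm_num), Real.rpow_neg (by norm_num), inv_inv]
        rw [h5, ← Real.mul_rpow (by norm_num) hpos.le]
        refine Real.rpow_le_rpow_of_nonpos (by positivity) ?_ (by linarith)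
        rw [inv_mul_le_iff₀ (by norm_num)]; exact h
    _ ≤ ENNReal.ofReal (5 ^ γ) * ∫⁻ θ : ℝ, ENNReal.ofReal (((1 - t) + |θ|) ^ (-γ)) := by
        rw [lintegral_const_mul' _ _ ENNReal.ofReal_ne_top]
        gcongr
        exact Measure.restrict_le_self
    _ ≤ _ := by
        rw [mul_assoc, ENNReal.ofReal_mul (by positivity)]
        gcongr
        exact lintegral_add_abs_rpow_le hγ (by linarith)

/-- Split at r = ρ. Below ρ, use 1 - ρr ≥ 1 - r and the exponent β: the integrand is at most a
multiple of (1 - r)^(β - γ), with β - γ < -1. Above ρ, use 1 - ρr ≥ 1 - ρ and the exponent α: what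
remains is (1 - r)^(α - 1), with α > 0. -/
lemma IsPowerWeight.lintegral_mul_rpow_le {α β γ : ℝ} {W : ℝ → ℝ} (hW : IsPowerWeight α β W)
    (hα : 0 < α) (hγ : 1 < γ) (hβ : β + 1 < γ) {ρ : ℝ} (hρ0 : 0 ≤ ρ) (hρ : ρ < 1) :
    ∫⁻ r in Set.Ioo 0 1, ENNReal.ofReal (W r * (1 - ρ * r) ^ (1 - γ)) ≤
      ENNReal.ofReal ((1 / (γ - β - 1) + 1 / α) * (W ρ * (1 - ρ) ^ (2 - γ))) := by
  have hδ : 0 < 1 - ρ := by linarith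
  have hWρ := hW.pos ρ ⟨hρ0, hρ⟩
  have hcov : Set.Ioo (0 : ℝ) 1 ⊆ Set.Ioc 0 ρ ∪ Set.Ioo ρ 1 := by
    intro r hr
    rcases le_or_gt r ρ with h | h
    · exact Or.inl ⟨hr.1, h⟩
    · exact Or.inr ⟨h, hr.2⟩
  refine (lintegral_mono_set hcov).trans ((lintegral_union_le _ _ _).trans ?_)
  rw [add_mul, ENNReal.ofReal_add (mul_nonneg (div_nonneg zero_le_one (by linarith)) (by positivity))
    (by positivity)]
  refine add_le_add ?_ ?_
  · calc _ ≤ ∫⁻ r in Set.Ioc 0 ρ, ENNReal.ofReal (W ρ * (1 - ρ) ^ (1 - β)) *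
          ENNReal.ofReal ((1 - r) ^ (β - γ)) := by
          refine setLIntegral_mono' measurableSet_Ioc fun r hr => ?_
          rw [← ENNReal.ofReal_mul (by positivity)]
          refine ENNReal.ofReal_le_ofReal ?_
          have hr1 : 0 < 1 - r := by linarith [hr.2]
          have h1 := hW.upper_left hr.1.le hr.2 hρ
          have h2 : (1 - ρ * r) ^ (1 - γ) ≤ (1 - r) ^ (1 - γ) :=
            Real.rpow_le_rpow_of_nonpos hr1 (by nlinarith [hr.1]) (by linarith)
          have h3 : 0 ≤ (1 - ρ * r) ^ (1 - γ) := Real.rpow_nonneg (by nlinarith [hr.1]) _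
          calc W r * (1 - ρ * r) ^ (1 - γ)
              ≤ (W ρ * ((1 - r) / (1 - ρ)) ^ (β - 1)) * (1 - r) ^ (1 - γ) := by gcongr
            _ = W ρ * (1 - ρ) ^ (1 - β) * (1 - r) ^ (β - γ) := by
                rw [Real.div_rpow hr1.le hδ.le, div_eq_mul_inv, ← Real.rpow_neg hδ.le,
                  show β - γ = (β - 1) + (1 - γ) by ring, Real.rpow_add hr1,
                  show -(β - 1) = 1 - β by ring]
                ring
      _ ≤ ENNReal.ofReal (W ρ * (1 - ρ) ^ (1 - β)) *
          ENNReal.ofReal ((1 - ρ) ^ (β - γ + 1) / (-(β - γ + 1))) := by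
          rw [lintegral_const_mul' _ _ ENNReal.ofReal_ne_top]
          gcongr
          rw [← lintegral_Ioi_rpow (by linarith) hδ, setLIntegral_congr Ioi_ae_eq_Ici,
            ← measurePreserving_one_sub.setLIntegral_comp_preimage_emb measurableEmbedding_one_sub
              (fun t => ENNReal.ofReal (t ^ (β - γ))) (Set.Ici (1 - ρ))]
          refine lintegral_mono_set fun r hr => ?_
          simp only [Set.mem_preimage, Set.mem_Ici]
          linarith [hr.2]
      _ = _ := by
          rw [← ENNReal.ofReal_mul (by positivity)]
          congr 1
          have e : (1 - ρ) ^ (2 - γ) = (1 - ρ) ^ (1 - β) * (1 - ρ) ^ (β - γ + 1) := by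
            rw [← Real.rpow_add hδ]; congr 1; ring
          rw [e, show -(β - γ + 1) = γ - β - 1 by ring]
          ring
  · calc _ ≤ ∫⁻ r in Set.Ioo ρ 1, ENNReal.ofReal (W ρ * (1 - ρ) ^ (2 - α - γ)) *
          ENNReal.ofReal ((1 - r) ^ (α - 1)) := by
          refine setLIntegral_mono' measurableSet_Ioo fun r hr => ?_
          rw [← ENNReal.ofReal_mul (by positivity)]
          refine ENNReal.ofReal_le_ofReal ?_
          have hr1 : 0 < 1 - r := by linarith [hr.2]
          have hr0 : 0 < r := by linarith [hr.1]
          have h1 := hW.upper_right hρ0 hr.1.le hr.2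
          have h2 : (1 - ρ * r) ^ (1 - γ) ≤ (1 - ρ) ^ (1 - γ) :=
            Real.rpow_le_rpow_of_nonpos hδ (by nlinarith [hr.1]) (by linarith)
          have h3 : 0 ≤ (1 - ρ * r) ^ (1 - γ) := Real.rpow_nonneg (by nlinarith [hr.1]) _
          calc W r * (1 - ρ * r) ^ (1 - γ)
              ≤ (W ρ * ((1 - r) / (1 - ρ)) ^ (α - 1)) * (1 - ρ) ^ (1 - γ) := by gcongr
            _ = W ρ * (1 - ρ) ^ (2 - α - γ) * (1 - r) ^ (α - 1) := by
                rw [Real.div_rpow hr1.le hδ.le, div_eq_mul_inv, ← Real.rpow_neg hδ.le,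
                  show 2 - α - γ = -(α - 1) + (1 - γ) by ring, Real.rpow_add hδ]
                ring
      _ = ENNReal.ofReal (W ρ * (1 - ρ) ^ (2 - α - γ)) *
          ENNReal.ofReal ((1 - ρ) ^ (α - 1 + 1) / (α - 1 + 1)) := by
          rw [lintegral_const_mul' _ _ ENNReal.ofReal_ne_top]
          congr 1
          rw [← lintegral_Ioo_rpow (by linarith) hδ,
            ← measurePreserving_one_sub.setLIntegral_comp_preimage_emb measurableEmbedding_one_sub
              (fun t => ENNReal.ofReal (t ^ (α - 1))) (Set.Ioo 0 (1 - ρ))]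
          congr 2
          ext r; simp
      _ = _ := by
          rw [← ENNReal.ofReal_mul (by positivity)]
          congr 1
          have e : (1 - ρ) ^ (2 - γ) = (1 - ρ) ^ (2 - α - γ) * (1 - ρ) ^ α := by
            rw [← Real.rpow_add hδ]; congr 1; ring
          rw [e, sub_add_cancel]
          ring

/-- The Forelli–Rudin estimate for a power weight. -/
lemma IsPowerWeight.lintegral_kernel_le {α β γ : ℝ} {W : ℝ → ℝ} (hW : IsPowerWeight α β W)
    (hα : 0 < α) (hγ : 1 < γ) (hβ : β + 1 < γ) : ∃ C : ℝ, 0 < C ∧ ∀ a ∈ disc,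
    ∫⁻ z in disc, ENNReal.ofReal (W ‖z‖ * ‖1 - starRingEnd ℂ a * z‖ ^ (-γ)) ≤
      ENNReal.ofReal (C * (W ‖a‖ * (1 - ‖a‖) ^ (2 - γ))) := by
  set K := 5 ^ γ * (2 / (γ - 1)) with hK
  have hK0 : 0 < K := mul_pos (by positivity) (div_pos two_pos (by linarith))
  refine ⟨K * (1 / (γ - β - 1) + 1 / α), mul_pos hK0 (add_pos (div_pos one_pos (by linarith))
    (by positivity)), fun a ha => ?_⟩
  have ha1 : ‖a‖ < 1 := mem_ball_zero_iff.1 ha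
  set ρ := ‖a‖ with hρ
  have hρ0 : 0 ≤ ρ := norm_nonneg a
  have hmeas : Measurable fun z : ℂ => ENNReal.ofReal (W ‖z‖ * ‖1 - (ρ : ℂ) * z‖ ^ (-γ)) := by
    have := hW.measurable
    fun_prop
  -- The weight is radial, so a rotation moves a to the positive axis.
  have hrot : ∫⁻ z in disc, ENNReal.ofReal (W ‖z‖ * ‖1 - starRingEnd ℂ a * z‖ ^ (-γ)) =
      ∫⁻ z in disc, ENNReal.ofReal (W ‖z‖ * ‖1 - (ρ : ℂ) * z‖ ^ (-γ)) := by
    set u := rotation (Circle.exp a.arg) with hu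
    rw [← u.measurePreserving.setLIntegral_comp_preimage_emb u.toHomeomorph.measurableEmbedding]
    have e1 : u ⁻¹' disc = disc := by
      ext z; simp
    rw [e1]
    refine lintegral_congr fun z => ?_
    have e2 : starRingEnd ℂ a * u z = ρ * z := by
      rw [hu, rotation_apply, Circle.coe_exp]
      conv_lhs => rw [← Complex.norm_mul_exp_arg_mul_I a]
      rw [map_mul, Complex.conj_ofReal, ← Complex.exp_conj, map_mul, Complex.conj_I,
        Complex.conj_ofReal, mul_assoc, ← mul_assoc (Complex.exp _), ← Complex.exp_add]
      simp [hρ]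
    rw [e2, u.norm_map]
  rw [hrot, lintegral_ball_eq_polar (hmeas.indicator Metric.isOpen_ball.measurableSet)]
  calc _ ≤ ∫⁻ r in Set.Ioo 0 1, ENNReal.ofReal K * ENNReal.ofReal (W r * (1 - ρ * r) ^ (1 - γ)) := by
        refine setLIntegral_mono' measurableSet_Ioo fun r hr => ?_
        have hr0 := hr.1
        have hr1 := hr.2
        have hWr := (hW.pos r ⟨hr.1.le, hr.2⟩).le
        calc _ ≤ 1 * ∫⁻ θ in Set.Ioo (-Real.pi) Real.pi, ENNReal.ofReal (W r) *
              ENNReal.ofReal (‖1 - ((ρ * r : ℝ) : ℂ) * Complex.exp (θ * Complex.I)‖ ^ (-γ)) := by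
              gcongr with θ
              · rw [ENNReal.ofReal_le_one]; exact hr1.le
              · rw [norm_circleMap_zero, abs_of_pos hr0, ← ENNReal.ofReal_mul hWr,
                  circleMap_zero]
                push_cast
                rw [mul_assoc]
          _ ≤ ENNReal.ofReal (W r) * ENNReal.ofReal (K * (1 - ρ * r) ^ (1 - γ)) := by
              rw [one_mul, lintegral_const_mul' _ _ ENNReal.ofReal_ne_top]
              gcongr
              exact lintegral_kernel_circle_le hγ (by positivity) (by nlinarith)
          _ = _ := by
              rw [← ENNReal.ofReal_mul hWr, ← ENNReal.ofReal_mul hK0.le]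
              congr 1; ring
    _ ≤ _ := by
        rw [lintegral_const_mul' _ _ ENNReal.ofReal_ne_top, mul_assoc, ENNReal.ofReal_mul hK0.le]
        gcongr
        exact hW.lintegral_mul_rpow_le hα hγ hβ hρ0 ha1

/-! ### Norms, change of weight, and local bounds -/

/-- The integral of `|f|^p W` over the disc. -/
def energy (p : ℝ) (W : ℝ → ℝ) (f : ℂ → ℂ) : ℝ≥0∞ :=
  ∫⁻ z in disc, ENNReal.ofReal (W ‖z‖) * ‖f z‖ₑ ^ p

lemma bergmanNorm_rpow {p : ℝ} (hp : 0 < p) {W : ℝ → ℝ} (hW : Measurable W) (f : ℂ → ℂ) :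
    bergmanNorm p W f ^ p = ENNReal.ofReal Real.pi⁻¹ * energy p W f := by
  have h0 : ENNReal.ofReal p ≠ 0 := by simpa using hp
  rw [bergmanNorm, eLpNorm_eq_lintegral_rpow_enorm_toReal h0 ENNReal.ofReal_ne_top,
    ENNReal.toReal_ofReal hp.le, ← ENNReal.rpow_mul, one_div_mul_cancel hp.ne', ENNReal.rpow_one,
    weightedArea, lintegral_withDensity_eq_lintegral_mul_non_measurable, discArea,
    lintegral_smul_measure]
  · rfl
  · exact ENNReal.measurable_ofReal.comp (hW.comp measurable_norm)
  · exact Eventually.of_forall fun z => ENNReal.ofReal_lt_top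

lemma energy_eq {p : ℝ} (hp : 0 < p) {W : ℝ → ℝ} (hW : Measurable W) (f : ℂ → ℂ) :
    energy p W f = ENNReal.ofReal Real.pi * bergmanNorm p W f ^ p := by
  rw [bergmanNorm_rpow hp hW, ← mul_assoc, ← ENNReal.ofReal_mul Real.pi_pos.le,
    mul_inv_cancel₀ Real.pi_pos.ne']
  simp

namespace Comparable

variable {w W : ℝ → ℝ}

lemma symm (h : Comparable w W) : Comparable W w := by
  obtain ⟨C, hC, h⟩ := h
  exact ⟨C, hC, fun r hr => (h r hr).symm⟩

/-- The comparison is made between the measures themselves, so neither f nor the weights need be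
measurable. -/
lemma exists_bergmanNorm_le (h : Comparable w W) {p : ℝ} (hp : 0 < p) :
    ∃ K : ℝ≥0, 0 < K ∧ ∀ f, bergmanNorm p w f ≤ K * bergmanNorm p W f := by
  obtain ⟨C, hC, h⟩ := h
  have hle : weightedArea w ≤ ENNReal.ofReal C • weightedArea W := by
    rw [weightedArea, weightedArea, ← withDensity_smul' _ _ ENNReal.ofReal_ne_top]
    refine withDensity_mono ?_
    refine Measure.ae_smul_measure ?_ _
    refine (ae_restrict_iff' Metric.isOpen_ball.measurableSet).2 (Eventually.of_forall fun z hz => ?_)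
    rw [Pi.smul_apply, smul_eq_mul, ← ENNReal.ofReal_mul hC.le]
    exact ENNReal.ofReal_le_ofReal (h ‖z‖ ⟨norm_nonneg z, mem_ball_zero_iff.1 hz⟩).1
  refine ⟨(C.toNNReal) ^ (1 / p), NNReal.rpow_pos (by simpa using hC), fun f => ?_⟩
  refine (eLpNorm_mono_measure f hle).trans (le_of_eq ?_)
  rw [eLpNorm_smul_measure_of_ne_top ENNReal.ofReal_ne_top, smul_eq_mul,
    ENNReal.toReal_div, ENNReal.toReal_ofReal hp.le, ENNReal.toReal_one]
  rw [ENNReal.coe_rpow_of_nonneg _ (by positivity)]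
  rfl

lemma boundedSeq (h : Comparable w W) {p : ℝ} (hp : 0 < p) {f : ℕ → ℂ → ℂ}
    (hf : BoundedSeq p w f) : BoundedSeq p W f := by
  obtain ⟨K, -, hK⟩ := h.symm.exists_bergmanNorm_le hp
  obtain ⟨h1, C, hC⟩ := hf
  refine ⟨fun k => ⟨(h1 k).1, (hK _).trans_lt (ENNReal.mul_lt_top ENNReal.coe_lt_top (h1 k).2)⟩,
    K * C, fun k => (hK _).trans ?_⟩
  push_cast
  gcongr
  exact hC k

lemma mem_bergmanSpace (h : Comparable w W) {p : ℝ} (hp : 0 < p) {f : ℂ → ℂ}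
    (hf : f ∈ bergmanSpace p w) : f ∈ bergmanSpace p W := by
  obtain ⟨K, -, hK⟩ := h.symm.exists_bergmanNorm_le hp
  exact ⟨hf.1, (hK _).trans_lt (ENNReal.mul_lt_top ENNReal.coe_lt_top hf.2)⟩

lemma isVanishingCarleson (h : Comparable w W) {p q : ℝ} (hp : 0 < p) {μ : Measure ℂ}
    (hμ : IsVanishingCarleson q p w μ) : IsVanishingCarleson q p W μ :=
  ⟨fun f hf => hμ.1 f (h.symm.mem_bergmanSpace hp hf),
    fun f hf => hμ.2 f (h.symm.boundedSeq hp hf)⟩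

lemma prod {ι : Type*} [Fintype ι] {w W : ι → ℝ → ℝ} (h : ∀ i, Comparable (w i) (W i))
    (hw : ∀ i, ∀ r ∈ Set.Ico (0 : ℝ) 1, 0 < w i r) (hW : ∀ i, ∀ r ∈ Set.Ico (0 : ℝ) 1, 0 < W i r)
    {θ : ι → ℝ} (hθ : ∀ i, 0 ≤ θ i) :
    Comparable (fun r => ∏ i, w i r ^ θ i) (fun r => ∏ i, W i r ^ θ i) := by
  choose C hC h using h
  refine ⟨∏ i, C i ^ θ i, Finset.prod_pos fun i _ => Real.rpow_pos_of_pos (hC i) _, ?_⟩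
  intro r hr
  rw [← Finset.prod_mul_distrib, ← Finset.prod_mul_distrib]
  constructor
  · refine Finset.prod_le_prod (fun i _ => Real.rpow_nonneg (hw i r hr).le _) fun i _ => ?_
    rw [← Real.mul_rpow (hC i).le (hW i r hr).le]
    exact Real.rpow_le_rpow (hw i r hr).le (h i r hr).1 (hθ i)
  · refine Finset.prod_le_prod (fun i _ => Real.rpow_nonneg (hW i r hr).le _) fun i _ => ?_
    rw [← Real.mul_rpow (hC i).le (hw i r hr).le]
    exact Real.rpow_le_rpow (hW i r hr).le (h i r hr).2 (hθ i)

end Comparable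

/-- The size `(1 - |a|)² W(a)` of the Whitney disc around `a`. -/
def discSize (W : ℝ → ℝ) (a : ℂ) : ℝ := (1 - ‖a‖) ^ 2 * W ‖a‖

lemma IsPowerWeight.discSize_pos {α β : ℝ} {W : ℝ → ℝ} (hW : IsPowerWeight α β W) {a : ℂ}
    (ha : a ∈ disc) : 0 < discSize W a := by
  have ha1 : ‖a‖ < 1 := mem_ball_zero_iff.1 ha
  have : 0 < 1 - ‖a‖ := by linarith
  exact mul_pos (by positivity) (hW.pos _ ⟨norm_nonneg a, ha1⟩)

/-- Monotonicity of W(r)(1 - r)^(1-β) between 0 and |a|. This crude bound controls point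
evaluations, and the normalization of the test functions on compact sets. -/
lemma IsPowerWeight.le_discSize {α β : ℝ} {W : ℝ → ℝ} (hW : IsPowerWeight α β W) {a : ℂ}
    (ha : a ∈ disc) : W 0 * (1 - ‖a‖) ^ (β + 1) ≤ discSize W a := by
  have ha1 : ‖a‖ < 1 := mem_ball_zero_iff.1 ha
  have hd : 0 < 1 - ‖a‖ := by linarith
  have h := hW.mono 0 ‖a‖ le_rfl (norm_nonneg a) ha1
  simp only [sub_zero, Real.one_rpow, mul_one] at h
  calc W 0 * (1 - ‖a‖) ^ (β + 1)
      ≤ W ‖a‖ * (1 - ‖a‖) ^ (1 - β) * (1 - ‖a‖) ^ (β + 1) := by gcongr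
    _ = discSize W a := by
      rw [mul_assoc, ← Real.rpow_add hd, show 1 - β + (β + 1) = 2 by ring, Real.rpow_two, discSize]
      ring

lemma ball_subset_disc {a : ℂ} (ha : a ∈ disc) : Metric.ball a ((1 - ‖a‖) / 2) ⊆ disc := by
  intro z hz
  rw [mem_ball_iff_norm] at hz
  have ha1 : ‖a‖ < 1 := mem_ball_zero_iff.1 ha
  have : ‖z‖ ≤ ‖a‖ + ‖z - a‖ := by simpa using norm_add_le a (z - a)
  exact mem_ball_zero_iff.2 (by linarith)

lemma one_sub_norm_bounds {a z : ℂ} (hz : z ∈ Metric.ball a ((1 - ‖a‖) / 2)) :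
    1 - ‖a‖ ≤ 2 * (1 - ‖z‖) ∧ 1 - ‖z‖ ≤ 2 * (1 - ‖a‖) := by
  rw [mem_ball_iff_norm] at hz
  have n1 : ‖z‖ ≤ ‖a‖ + ‖z - a‖ := by simpa using norm_add_le a (z - a)
  have n2 : ‖a‖ ≤ ‖z‖ + ‖z - a‖ := by simpa using norm_sub_le z (z - a)
  have := norm_nonneg (z - a)
  constructor <;> linarith

/-- The value of an analytic function in a Whitney cell is controlled by its mean over the enlarged
cell. -/
lemma IsPowerWeight.exists_local_bound {α β : ℝ} {W : ℝ → ℝ} (hW : IsPowerWeight α β W) {p : ℝ}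
    (hp : 0 < p) : ∃ C : ℝ, 0 < C ∧ ∀ f : ℂ → ℂ, DifferentiableOn ℂ f disc → ∀ a ∈ disc,
      ∀ z ∈ Metric.closedBall a ((1 - ‖a‖) / 4),
      ENNReal.ofReal (discSize W a) * ‖f z‖ₑ ^ p ≤ ENNReal.ofReal C *
        ∫⁻ ζ in Metric.ball a ((1 - ‖a‖) / 2), ENNReal.ofReal (W ‖ζ‖) * ‖f ζ‖ₑ ^ p := by
  obtain ⟨C₀, hC₀, h₀⟩ := exists_submean hp
  obtain ⟨C₁, hC₁, h₁⟩ := hW.exists_comparable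
  -- 16 comes from the squared radius ((1 - |a|)/4)² of a disc about z, C₀ from the sub-mean value
  -- property, and C₁ from moving W inside the integral.
  refine ⟨16 * C₁ * C₀, by positivity, fun f hf a ha z hz => ?_⟩
  have ha1 : ‖a‖ < 1 := mem_ball_zero_iff.1 ha
  have hd : 0 < 1 - ‖a‖ := by linarith
  have hWa := hW.pos _ ⟨norm_nonneg a, ha1⟩
  have hsub : Metric.ball z ((1 - ‖a‖) / 4) ⊆ Metric.ball a ((1 - ‖a‖) / 2) := by
    refine Metric.ball_subset_ball' ?_
    have := Metric.mem_closedBall.1 hz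
    linarith
  have h2 := h₀ f z ((1 - ‖a‖) / 4) (by positivity)
    (hf.mono (hsub.trans (ball_subset_disc ha)))
  calc ENNReal.ofReal (discSize W a) * ‖f z‖ₑ ^ p
      = ENNReal.ofReal (16 * W ‖a‖) * (ENNReal.ofReal (((1 - ‖a‖) / 4) ^ 2) * ‖f z‖ₑ ^ p) := by
        rw [← mul_assoc, ← ENNReal.ofReal_mul (by positivity), discSize]
        congr 2; ring
    _ ≤ ENNReal.ofReal (16 * W ‖a‖) * (ENNReal.ofReal C₀ *
          ∫⁻ ζ in Metric.ball z ((1 - ‖a‖) / 4), ‖f ζ‖ₑ ^ p) := by gcongr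
    _ ≤ ENNReal.ofReal (16 * W ‖a‖) * (ENNReal.ofReal C₀ *
          ∫⁻ ζ in Metric.ball a ((1 - ‖a‖) / 2), ‖f ζ‖ₑ ^ p) := by
        gcongr
    _ = ENNReal.ofReal (16 * C₀) * ∫⁻ ζ in Metric.ball a ((1 - ‖a‖) / 2),
          ENNReal.ofReal (W ‖a‖) * ‖f ζ‖ₑ ^ p := by
        rw [lintegral_const_mul' _ _ ENNReal.ofReal_ne_top, ← mul_assoc, ← mul_assoc,
          ← ENNReal.ofReal_mul (by positivity), ← ENNReal.ofReal_mul (by positivity)]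
        congr 2; ring
    _ ≤ ENNReal.ofReal (16 * C₀) * ∫⁻ ζ in Metric.ball a ((1 - ‖a‖) / 2),
          ENNReal.ofReal C₁ * (ENNReal.ofReal (W ‖ζ‖) * ‖f ζ‖ₑ ^ p) := by
        refine mul_le_mul_right ?_ _
        refine setLIntegral_mono' Metric.isOpen_ball.measurableSet fun ζ hζ => ?_
        rw [← mul_assoc, ← ENNReal.ofReal_mul hC₁.le]
        gcongr
        have hζ1 := mem_ball_zero_iff.1 (ball_subset_disc ha hζ)
        obtain ⟨b1, b2⟩ := one_sub_norm_bounds hζ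
        exact h₁ _ ⟨norm_nonneg ζ, hζ1⟩ _ ⟨norm_nonneg a, ha1⟩ b2 b1
    _ = _ := by
        rw [lintegral_const_mul' _ _ ENNReal.ofReal_ne_top, ← mul_assoc,
          ← ENNReal.ofReal_mul (by positivity)]
        congr 2; ring

/-- Point evaluations are bounded on the weighted Bergman space, uniformly on compact sets. -/
lemma IsPowerWeight.exists_enorm_le {α β : ℝ} {W : ℝ → ℝ} (hW : IsPowerWeight α β W) {p : ℝ}
    (hp : 0 < p) {r : ℝ} (hr : r < 1) : ∃ C : ℝ≥0, ∀ f : ℂ → ℂ, DifferentiableOn ℂ f disc →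
      ∀ z ∈ Metric.closedBall (0 : ℂ) r, ‖f z‖ₑ ≤ C * bergmanNorm p W f := by
  obtain ⟨C, hC, h⟩ := hW.exists_local_bound hp
  have hW0 := hW.pos 0 (by simp)
  -- The absolute value makes this a lower bound for the disc size whatever the sign of β + 1.
  set m := W 0 * (1 - r) ^ |β + 1| with hm
  have hr' : 0 < 1 - r := by linarith
  have hm0 : 0 < m := by positivity
  refine ⟨(C * Real.pi / m).toNNReal ^ (1 / p), fun f hf z hz => ?_⟩
  have hz1 : ‖z‖ ≤ r := by simpa using hz
  have hzd : z ∈ disc := mem_ball_zero_iff.2 (by linarith)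
  have hδ : 0 < 1 - ‖z‖ := by linarith
  have hms : m ≤ discSize W z := by
    refine le_trans ?_ (hW.le_discSize hzd)
    rw [hm]
    gcongr
    calc (1 - r) ^ |β + 1| ≤ (1 - ‖z‖) ^ |β + 1| := by gcongr
      _ ≤ (1 - ‖z‖) ^ (β + 1) :=
        Real.rpow_le_rpow_of_exponent_ge hδ (by linarith [norm_nonneg z]) (le_abs_self _)
  have h1 := h f hf z hzd z (Metric.mem_closedBall_self (by positivity))
  have h2 : ENNReal.ofReal m * ‖f z‖ₑ ^ p ≤
      ENNReal.ofReal (C * Real.pi) * bergmanNorm p W f ^ p := by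
    calc _ ≤ ENNReal.ofReal (discSize W z) * ‖f z‖ₑ ^ p := by gcongr
      _ ≤ _ := h1
      _ ≤ ENNReal.ofReal C * energy p W f := by
          gcongr
          exact lintegral_mono_set (ball_subset_disc hzd)
      _ = _ := by rw [energy_eq hp hW.measurable, ← mul_assoc, ← ENNReal.ofReal_mul hC.le]
  have h3 : ‖f z‖ₑ ^ p ≤ ENNReal.ofReal (C * Real.pi / m) * bergmanNorm p W f ^ p := by
    have hm0' : ENNReal.ofReal m ≠ 0 := by simpa using hm0
    rw [← ENNReal.mul_le_mul_iff_right hm0' ENNReal.ofReal_ne_top, ← mul_assoc,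
      ← ENNReal.ofReal_mul hm0.le, mul_div_cancel₀ _ hm0.ne']
    exact h2
  rw [← ENNReal.rpow_le_rpow_iff hp, ENNReal.mul_rpow_of_nonneg _ _ hp.le,
    ENNReal.coe_rpow_of_nonneg _ (by positivity), ← ENNReal.rpow_mul, one_div_mul_cancel hp.ne',
    ENNReal.rpow_one]
  exact h3

namespace WhitneyCover

variable {ι : Type} (P : WhitneyCover ι)

/-- The distance of the center of a cell to the unit circle. -/
def depth (j : ι) : ℝ := 1 - ‖P.center j‖

/-- The enlarged cells. -/
def bigCell (j : ι) : Set ℂ := Metric.ball (P.center j) (P.depth j / 2)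

lemma depth_pos (j : ι) : 0 < P.depth j := by
  have := mem_ball_zero_iff.1 (P.center_mem j)
  rw [depth]; linarith

lemma depth_le_one (j : ι) : P.depth j ≤ 1 := by
  rw [depth]; linarith [norm_nonneg (P.center j)]

lemma measurableSet_bigCell (j : ι) : MeasurableSet (P.bigCell j) :=
  Metric.isOpen_ball.measurableSet

lemma bigCell_subset (j : ι) : P.bigCell j ⊆ disc := ball_subset_disc (P.center_mem j)

lemma cell_subset_disc (j : ι) : P.cell j ⊆ disc := by
  rw [← P.iUnion_cell]; exact Set.subset_iUnion P.cell j

/-- Interchange sum and integral: the sum of the indicators of the enlarged cells is at most the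
overlap at every point. -/
lemma tsum_lintegral_bigCell_le [Countable ι] {F : ℂ → ℝ≥0∞}
    (hF : AEMeasurable F (volume.restrict disc)) :
    ∑' j, ∫⁻ z in P.bigCell j, F z ≤ P.overlap * ∫⁻ z in disc, F z := by
  have h1 : ∀ j, ∫⁻ z in P.bigCell j, F z =
      ∫⁻ z in disc, (P.bigCell j).indicator (fun _ => (1 : ℝ≥0∞)) z * F z := by
    intro j
    have e : ∀ z, (P.bigCell j).indicator (fun _ => (1 : ℝ≥0∞)) z * F z =
        (P.bigCell j).indicator F z := by
      intro z; by_cases hz : z ∈ P.bigCell j <;> simp [hz]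
    simp only [e]
    rw [lintegral_indicator (P.measurableSet_bigCell j),
      Measure.restrict_restrict (P.measurableSet_bigCell j),
      Set.inter_eq_left.2 (P.bigCell_subset j)]
  simp only [h1]
  rw [← lintegral_tsum (f := fun j z => (P.bigCell j).indicator (fun _ => (1 : ℝ≥0∞)) z * F z)
    fun j => ((measurable_const.indicator (P.measurableSet_bigCell j)).aemeasurable.mul hF)]
  rw [← lintegral_const_mul' _ _ (ENNReal.natCast_ne_top _)]
  refine lintegral_mono fun z => ?_
  rw [ENNReal.tsum_mul_right]
  gcongr
  exact P.tsum_indicator_le z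

end WhitneyCover

/-! ### The cell condition and the upper estimate -/

lemma ennreal_rpow_sum {κ : Type*} (s : Finset κ) (x : ℝ≥0∞) {θ : κ → ℝ} (hθ : ∀ i, 0 ≤ θ i) :
    ∏ i ∈ s, x ^ θ i = x ^ ∑ i ∈ s, θ i := by
  classical
  induction s using Finset.induction_on with
  | empty => simp
  | insert i s hi ih =>
    rw [Finset.prod_insert hi, Finset.sum_insert hi, ih,
      ENNReal.rpow_add_of_nonneg _ _ (hθ i) (Finset.sum_nonneg fun i _ => hθ i)]

lemma ennreal_prod_rpow {κ : Type*} (s : Finset κ) (x : κ → ℝ≥0∞) {r : ℝ} (hr : 0 ≤ r) :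
    (∏ i ∈ s, x i) ^ r = ∏ i ∈ s, x i ^ r := by
  classical
  induction s using Finset.induction_on with
  | empty => simp
  | insert i s hi ih =>
    rw [Finset.prod_insert hi, Finset.prod_insert hi, ENNReal.mul_rpow_of_nonneg _ _ hr, ih]

/-- A weighted geometric mean is at most the sum. -/
lemma ennreal_geom_mean_le_sum {κ : Type*} [Fintype κ] (x : κ → ℝ≥0∞) {θ : κ → ℝ}
    (hθ : ∀ i, 0 ≤ θ i) (hsum : ∑ i, θ i = 1) : ∏ i, x i ^ θ i ≤ ∑ i, x i := by
  calc ∏ i, x i ^ θ i ≤ ∏ i, (∑ j, x j) ^ θ i := by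
        refine Finset.prod_le_prod' fun i _ => ENNReal.rpow_le_rpow ?_ (hθ i)
        exact Finset.single_le_sum (f := x) (fun _ _ => zero_le) (Finset.mem_univ i)
    _ = _ := by rw [ennreal_rpow_sum _ _ hθ, hsum, ENNReal.rpow_one]

/-- The normalized mass of a Whitney cell. -/
def cellMass {ι : Type} (P : WhitneyCover ι) (lam : ℝ) (Om : ℝ → ℝ) (μ : Measure ℂ) (j : ι) :
    ℝ≥0∞ :=
  μ (P.cell j) * ENNReal.ofReal (discSize Om (P.center j) ^ (-lam))

/-- The discrete form of the vanishing Carleson condition: the multiplier with the normalized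
masses of the cells maps `ℓ^{1/lam}` into `ℓ^1`, with small norm on the cells near the
boundary. -/
def CellCondition {ι : Type} (P : WhitneyCover ι) (lam : ℝ) (Om : ℝ → ℝ) (μ : Measure ℂ) : Prop :=
  (∀ r < 1, μ (Metric.closedBall 0 r) < ∞) ∧
  ∀ ε : ℝ≥0∞, ε ≠ 0 → ∃ t : ℝ, 0 < t ∧ ∀ x : ι → ℝ≥0∞, ∑' j, x j ≤ 1 →
    ∑' j, (if P.depth j < t then cellMass P lam Om μ j * x j ^ lam else 0) ≤ ε

section Upper

variable {ι κ : Type} [Fintype κ] {α β p q : κ → ℝ} {W : κ → ℝ → ℝ} {lam : ℝ} {Om : ℝ → ℝ}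

/-- The exponents -q_i/p_i add up to -λ, which takes care of the powers of 1 - |a|; the weights
combine because -q_i/p_i = -λ · q_i/(λ p_i). This identity makes the cell condition the same for the
n factors and for the single weight Ω. -/
lemma prod_discSize_rpow (hW : ∀ i, IsPowerWeight (α i) (β i) (W i)) (hlam : 0 < lam)
    (hsum : lam = ∑ i, q i / p i)
    (hOm : ∀ r ∈ Set.Ico (0 : ℝ) 1, Om r = ∏ i, W i r ^ (q i / (lam * p i)))
    {a : ℂ} (ha : a ∈ disc) :
    ∏ i, discSize (W i) a ^ (-(q i / p i)) = discSize Om a ^ (-lam) := by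
  have ha1 : ‖a‖ < 1 := mem_ball_zero_iff.1 ha
  have hd : 0 < 1 - ‖a‖ := by linarith
  have hWp : ∀ i, 0 < W i ‖a‖ := fun i => (hW i).pos _ ⟨norm_nonneg a, ha1⟩
  have hd2 : 0 < (1 - ‖a‖) ^ 2 := by positivity
  rw [discSize, hOm _ ⟨norm_nonneg a, ha1⟩, Real.mul_rpow hd2.le
    (Finset.prod_nonneg fun i _ => Real.rpow_nonneg (hWp i).le _),
    ← Real.finsetProd_rpow _ _ (fun i _ => Real.rpow_nonneg (hWp i).le _)]
  have e : ((1 - ‖a‖) ^ 2) ^ (-lam) = ∏ i, ((1 - ‖a‖) ^ 2) ^ (-(q i / p i)) := by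
    rw [← Real.rpow_sum_of_pos hd2, Finset.sum_neg_distrib, ← hsum]
  rw [e, ← Finset.prod_mul_distrib]
  refine Finset.prod_congr rfl fun i _ => ?_
  rw [discSize, Real.mul_rpow hd2.le (hWp i).le, ← Real.rpow_mul (hWp i).le]
  congr 2
  field_simp

/-- The integral of a product of analytic functions over a Whitney cell. -/
lemma exists_lintegral_cell_le (P : WhitneyCover ι)
    (hW : ∀ i, IsPowerWeight (α i) (β i) (W i)) (hp : ∀ i, 0 < p i) (hq : ∀ i, 0 < q i)
    (hlam : 0 < lam) (hsum : lam = ∑ i, q i / p i)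
    (hOm : ∀ r ∈ Set.Ico (0 : ℝ) 1, Om r = ∏ i, W i r ^ (q i / (lam * p i))) (μ : Measure ℂ) :
    ∃ K : ℝ≥0∞, K ≠ 0 ∧ K ≠ ∞ ∧ ∀ f : κ → ℂ → ℂ, (∀ i, DifferentiableOn ℂ (f i) disc) → ∀ j,
      ∫⁻ z in P.cell j, ∏ i, ‖f i z‖ₑ ^ q i ∂μ ≤ K * (cellMass P lam Om μ j *
        (∏ i, (∫⁻ z in P.bigCell j, ENNReal.ofReal (W i ‖z‖) * ‖f i z‖ₑ ^ p i) ^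
          (q i / (lam * p i))) ^ lam) := by
  choose C hC h using fun i => (hW i).exists_local_bound (hp i)
  have hqp : ∀ i, 0 < q i / p i := fun i => div_pos (hq i) (hp i)
  refine ⟨∏ i, ENNReal.ofReal (C i) ^ (q i / p i), ?_, ?_, fun f hf j => ?_⟩
  · refine Finset.prod_ne_zero_iff.2 fun i _ => ?_
    simp [ENNReal.rpow_eq_zero_iff, hC i]
  · exact ENNReal.prod_ne_top fun i _ =>
      ENNReal.rpow_ne_top_of_nonneg (hqp i).le ENNReal.ofReal_ne_top
  set a := P.center j with ha
  have had : a ∈ disc := P.center_mem j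
  set x : κ → ℝ≥0∞ := fun i =>
    ∫⁻ z in P.bigCell j, ENNReal.ofReal (W i ‖z‖) * ‖f i z‖ₑ ^ p i with hx
  have hpt : ∀ z ∈ P.cell j, ∏ i, ‖f i z‖ₑ ^ q i ≤
      (∏ i, ENNReal.ofReal (C i) ^ (q i / p i)) * (ENNReal.ofReal (discSize Om a ^ (-lam)) *
        (∏ i, x i ^ (q i / (lam * p i))) ^ lam) := by
    intro z hz
    have e1 : (∏ i, x i ^ (q i / (lam * p i))) ^ lam = ∏ i, x i ^ (q i / p i) := by
      rw [ennreal_prod_rpow _ _ hlam.le]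
      refine Finset.prod_congr rfl fun i _ => ?_
      rw [← ENNReal.rpow_mul]
      congr 1; field_simp
    have e2 : ENNReal.ofReal (discSize Om a ^ (-lam)) =
        ∏ i, ENNReal.ofReal (discSize (W i) a ^ (-(q i / p i))) := by
      rw [← prod_discSize_rpow hW hlam hsum hOm had, ENNReal.ofReal_prod_of_nonneg]
      exact fun i _ => Real.rpow_nonneg ((hW i).discSize_pos had).le _
    rw [e1, e2, ← Finset.prod_mul_distrib, ← Finset.prod_mul_distrib]
    refine Finset.prod_le_prod' fun i _ => ?_
    have hV := (hW i).discSize_pos had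
    have h1 := h i (f i) (hf i) a had z (P.cell_subset j hz)
    have h2 : ‖f i z‖ₑ ^ p i ≤ ENNReal.ofReal (C i) *
        (ENNReal.ofReal ((discSize (W i) a)⁻¹) * x i) := by
      have hV0 : ENNReal.ofReal (discSize (W i) a) ≠ 0 := by simpa using hV
      rw [← ENNReal.mul_le_mul_iff_right hV0 ENNReal.ofReal_ne_top]
      refine h1.trans (le_of_eq ?_)
      rw [mul_left_comm, ← mul_assoc (ENNReal.ofReal (discSize _ _)), ← ENNReal.ofReal_mul hV.le,
        mul_inv_cancel₀ hV.ne', ENNReal.ofReal_one, one_mul]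
      rfl
    have h3 := ENNReal.rpow_le_rpow h2 (hqp i).le
    rw [← ENNReal.rpow_mul, mul_div_cancel₀ _ (hp i).ne', ENNReal.mul_rpow_of_nonneg _ _ (hqp i).le,
      ENNReal.mul_rpow_of_nonneg _ _ (hqp i).le,
      ENNReal.ofReal_rpow_of_nonneg (inv_nonneg.2 hV.le) (hqp i).le, Real.inv_rpow hV.le,
      ← Real.rpow_neg hV.le] at h3
    exact h3
  calc _ ≤ ∫⁻ _ in P.cell j, (∏ i, ENNReal.ofReal (C i) ^ (q i / p i)) *
        (ENNReal.ofReal (discSize Om a ^ (-lam)) *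
          (∏ i, x i ^ (q i / (lam * p i))) ^ lam) ∂μ :=
        setLIntegral_mono' (P.measurableSet_cell j) hpt
    _ = _ := by
        rw [setLIntegral_const, cellMass]
        ring

/-- Under the cell condition the mass of a product near the boundary is uniformly small. -/
lemma CellCondition.exists_lintegral_le [Countable ι] {P : WhitneyCover ι} {μ : Measure ℂ}
    (hD : CellCondition P lam Om μ)
    (hW : ∀ i, IsPowerWeight (α i) (β i) (W i)) (hp : ∀ i, 0 < p i) (hq : ∀ i, 0 < q i)
    (hlam : 0 < lam) (hsum : lam = ∑ i, q i / p i)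
    (hOm : ∀ r ∈ Set.Ico (0 : ℝ) 1, Om r = ∏ i, W i r ^ (q i / (lam * p i)))
    (M : ℝ≥0) {ε : ℝ≥0∞} (hε : ε ≠ 0) :
    ∃ r < 1, ∀ f : κ → ℂ → ℂ, (∀ i, DifferentiableOn ℂ (f i) disc) →
      (∀ i, bergmanNorm (p i) (W i) (f i) ≤ M) →
      ∫⁻ z in disc, ∏ i, ‖f i z‖ₑ ^ q i ∂μ ≤
        ∫⁻ z in Metric.closedBall 0 r, ∏ i, ‖f i z‖ₑ ^ q i ∂μ + ε := by
  obtain ⟨K, hK0, hKt, hK⟩ := exists_lintegral_cell_le P hW hp hq hlam hsum hOm μ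
  set θ : κ → ℝ := fun i => q i / (lam * p i) with hθ
  have hθ0 : ∀ i, 0 ≤ θ i := fun i => (div_pos (hq i) (mul_pos hlam (hp i))).le
  have hθ1 : ∑ i, θ i = 1 := by
    have : ∀ i, θ i = (q i / p i) / lam := fun i => by rw [hθ]; field_simp
    simp only [this]
    rw [← Finset.sum_div, ← hsum, div_self hlam.ne']
  -- An upper bound for the sum of the geometric means y_j; the summand 1 allows division by Y, so
  -- that y/Y is admissible in the cell condition.
  set Y : ℝ≥0∞ := (∑ i, P.overlap * (ENNReal.ofReal Real.pi * (M : ℝ≥0∞) ^ p i)) + 1 with hY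
  have hY0 : Y ≠ 0 := by rw [hY]; simp
  have hYt : Y ≠ ∞ := by
    rw [hY]
    refine ENNReal.add_ne_top.2 ⟨ENNReal.sum_ne_top.2 fun i _ => ?_, ENNReal.one_ne_top⟩
    exact ENNReal.mul_ne_top (ENNReal.natCast_ne_top _) (ENNReal.mul_ne_top ENNReal.ofReal_ne_top
      (ENNReal.rpow_ne_top_of_nonneg (hp i).le ENNReal.coe_ne_top))
  have hKYt : K * Y ^ lam ≠ ∞ :=
    ENNReal.mul_ne_top hKt (ENNReal.rpow_ne_top_of_nonneg hlam.le hYt)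
  obtain ⟨t, ht, hcond⟩ := hD.2 (ε / (K * Y ^ lam)) (by simp [ENNReal.div_eq_zero_iff, hε, hKYt])
  -- A cell of depth δ ≥ t lies in |z| ≤ (1 - δ) + δ/4 ≤ 1 - 3t/4, so the points outside this disc
  -- lie in cells of depth less than t.
  refine ⟨1 - 3 * t / 4, by linarith, fun f hf hM => ?_⟩
  set F : ℂ → ℝ≥0∞ := fun z => ∏ i, ‖f i z‖ₑ ^ q i with hF
  set x : κ → ι → ℝ≥0∞ := fun i j =>
    ∫⁻ z in P.bigCell j, ENNReal.ofReal (W i ‖z‖) * ‖f i z‖ₑ ^ p i with hx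
  set y : ι → ℝ≥0∞ := fun j => ∏ i, x i j ^ θ i with hy
  have hysum : ∑' j, y j ≤ Y := by
    calc ∑' j, y j ≤ ∑' j, ∑ i, x i j :=
          ENNReal.tsum_le_tsum fun j => ennreal_geom_mean_le_sum (fun i => x i j) hθ0 hθ1
      _ = ∑ i, ∑' j, x i j := Summable.tsum_finsetSum fun i _ => ENNReal.summable
      _ ≤ ∑ i, P.overlap * (ENNReal.ofReal Real.pi * (M : ℝ≥0∞) ^ p i) := by
          refine Finset.sum_le_sum fun i _ => ?_
          have hm : AEMeasurable (fun z => ENNReal.ofReal (W i ‖z‖) * ‖f i z‖ₑ ^ p i)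
              (volume.restrict disc) := by
            refine AEMeasurable.mul ?_ ?_
            · exact (ENNReal.measurable_ofReal.comp
                ((hW i).measurable.comp measurable_norm)).aemeasurable
            · exact (((hf i).continuousOn.aemeasurable
                Metric.isOpen_ball.measurableSet).enorm).pow_const _
          refine (P.tsum_lintegral_bigCell_le hm).trans ?_
          gcongr
          change energy (p i) (W i) (f i) ≤ _
          rw [energy_eq (hp i) (hW i).measurable]
          gcongr
          · exact (hp i).le
          · exact hM i
      _ ≤ Y := by rw [hY]; exact le_self_add
  have hx1 : ∑' j, y j / Y ≤ 1 := by
    simp only [div_eq_mul_inv]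
    rw [ENNReal.tsum_mul_right, ← div_eq_mul_inv]
    exact ENNReal.div_le_of_le_mul (by simpa using hysum)
  have htail := hcond (fun j => y j / Y) hx1
  have hcov : disc ⊆ Metric.closedBall 0 (1 - 3 * t / 4) ∪
      ⋃ j, (if P.depth j < t then P.cell j else ∅) := by
    intro z hz
    rw [← P.iUnion_cell] at hz
    obtain ⟨j, hj⟩ := Set.mem_iUnion.1 hz
    by_cases hjt : P.depth j < t
    · exact Or.inr (Set.mem_iUnion.2 ⟨j, by simpa [hjt] using hj⟩)
    · left
      have h1 := mem_closedBall_iff_norm.1 (P.cell_subset j hj)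
      have h2 : ‖z‖ ≤ ‖P.center j‖ + ‖z - P.center j‖ := by
        simpa using norm_add_le (P.center j) (z - P.center j)
      rw [mem_closedBall_zero_iff]
      rw [WhitneyCover.depth] at hjt
      linarith
  calc ∫⁻ z in disc, F z ∂μ ≤ _ := lintegral_mono_set hcov
    _ ≤ ∫⁻ z in Metric.closedBall 0 (1 - 3 * t / 4), F z ∂μ +
        ∫⁻ z in ⋃ j, (if P.depth j < t then P.cell j else ∅), F z ∂μ := lintegral_union_le _ _ _
    _ ≤ ∫⁻ z in Metric.closedBall 0 (1 - 3 * t / 4), F z ∂μ +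
        ∑' j, ∫⁻ z in (if P.depth j < t then P.cell j else ∅), F z ∂μ := by
        gcongr
        exact lintegral_iUnion_le _ _
    _ ≤ _ := by
        gcongr
        calc _ ≤ ∑' j, (K * Y ^ lam) *
              (if P.depth j < t then cellMass P lam Om μ j * (y j / Y) ^ lam else 0) := by
              refine ENNReal.tsum_le_tsum fun j => ?_
              by_cases hjt : P.depth j < t
              · rw [if_pos hjt, if_pos hjt]
                refine (hK f hf j).trans (le_of_eq ?_)
                change K * (_ * y j ^ lam) = _
                have e : y j ^ lam = Y ^ lam * (y j / Y) ^ lam := by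
                  rw [← ENNReal.mul_rpow_of_nonneg _ _ hlam.le, ENNReal.mul_div_cancel hY0 hYt]
                rw [e]; ring
              · rw [if_neg hjt, if_neg hjt]; simp
          _ = (K * Y ^ lam) * _ := ENNReal.tsum_mul_left
          _ ≤ (K * Y ^ lam) * (ε / (K * Y ^ lam)) := by gcongr
          _ ≤ ε := ENNReal.mul_div_le

end Upper

/-! ### Montel's theorem and null sequences -/

lemma exists_closedBall_of_isCompact {K : Set ℂ} (hK : K ⊆ disc) (hc : IsCompact K) :
    ∃ r : ℝ, 0 < r ∧ r < 1 ∧ K ⊆ Metric.closedBall 0 r := by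
  obtain ⟨r, hr, hKr⟩ := exists_lt_subset_ball hc.isClosed hK
  refine ⟨max r (1 / 2), by positivity, max_lt hr (by norm_num), ?_⟩
  exact hKr.trans (Metric.ball_subset_closedBall.trans
    (Metric.closedBall_subset_closedBall (le_max_left _ _)))

lemma tendstoZeroOnCompacts_of_closedBall {f : ℕ → ℂ → ℂ}
    (h : ∀ r : ℝ, 0 < r → r < 1 →
      TendstoUniformlyOn f (fun _ => (0 : ℂ)) atTop (Metric.closedBall 0 r)) :
    TendstoZeroOnCompacts f := by
  intro K hK hc
  obtain ⟨r, hr0, hr1, hKr⟩ := exists_closedBall_of_isCompact hK hc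
  exact (h r hr0 hr1).mono hKr

lemma norm_taylor_coeff_le {f : ℂ → ℂ} (hf : DifferentiableOn ℂ f disc) {r C : ℝ} (hr0 : 0 < r)
    (hr : r < 1) (hC : ∀ z ∈ Metric.closedBall (0 : ℂ) r, ‖f z‖ ≤ C) (m : ℕ) :
    ‖((m.factorial : ℂ))⁻¹ * iteratedDeriv m f 0‖ ≤ C / r ^ m := by
  have h := Complex.norm_iteratedDeriv_le_of_forall_mem_sphere_norm_le (c := 0) m hr0
    (hf.diffContOnCl_ball (Metric.closedBall_subset_ball hr))
    (fun z hz => hC z (Metric.sphere_subset_closedBall hz))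
  have hm : (0 : ℝ) < m.factorial := by exact_mod_cast m.factorial_pos
  rw [norm_mul, norm_inv, Complex.norm_natCast, inv_mul_le_iff₀ hm, ← mul_div_assoc]
  exact h

/-- Montel's theorem in the unit disc. -/
lemma exists_subseq_tendsto_on_compacts {f : ℕ → ℂ → ℂ} (hf : ∀ k, DifferentiableOn ℂ (f k) disc)
    (hb : ∀ r < 1, ∃ C : ℝ, ∀ k, ∀ z ∈ Metric.closedBall (0 : ℂ) r, ‖f k z‖ ≤ C) :
    ∃ φ : ℕ → ℕ, StrictMono φ ∧ ∃ g : ℂ → ℂ, DifferentiableOn ℂ g disc ∧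
      TendstoZeroOnCompacts fun k => f (φ k) - g := by
  set a : ℕ → ℕ → ℂ := fun k m => ((m.factorial : ℂ))⁻¹ * iteratedDeriv m (f k) 0 with ha
  have hsum : ∀ k, ∀ z ∈ disc, HasSum (fun m => a k m * z ^ m) (f k z) := by
    intro k z hz
    have := Complex.hasSum_taylorSeries_on_ball (hf k) hz
    simp only [sub_zero, smul_eq_mul] at this
    refine this.congr_fun fun m => ?_
    rw [ha]; ring
  choose! C hC using hb
  have hbound : ∀ r, 0 < r → r < 1 → ∀ k m, ‖a k m‖ ≤ C r / r ^ m := fun r hr0 hr k m =>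
    norm_taylor_coeff_le (hf k) hr0 hr (hC r hr k) m
  -- By Cauchy's estimate on |z| = 1/2 the sequences of Taylor coefficients stay in a product of
  -- compact discs; Tychonoff's theorem replaces the diagonal argument.
  obtain ⟨b, -, φ, hφ, hlim⟩ := (isCompact_univ_pi fun m : ℕ =>
    isCompact_closedBall (0 : ℂ) (C (1 / 2) / (1 / 2) ^ m)).tendsto_subseq (x := a) (fun k m _ => by
      simpa using hbound (1 / 2) (by norm_num) (by norm_num) k m)
  have hlim' : ∀ m, Tendsto (fun k => a (φ k) m) atTop (𝓝 (b m)) := fun m =>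
    (tendsto_pi_nhds.1 hlim) m
  have hbb : ∀ r, 0 < r → r < 1 → ∀ m, ‖b m‖ ≤ C r / r ^ m := fun r hr0 hr m =>
    le_of_tendsto (hlim' m).norm (Eventually.of_forall fun k => hbound r hr0 hr _ m)
  set g : ℂ → ℂ := fun z => ∑' m, b m * z ^ m with hg
  have hunif : TendstoZeroOnCompacts fun k => f (φ k) - g := by
    refine tendstoZeroOnCompacts_of_closedBall fun ρ hρ0 hρ => ?_
    set r := (1 + ρ) / 2 with hr
    have hr0 : 0 < r := by linarith
    have hr1 : r < 1 := by linarith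
    have hq0 : 0 ≤ ρ / r := by positivity
    have hq1 : ρ / r < 1 := by rw [div_lt_one hr0]; linarith
    have hgeo : Summable fun m : ℕ => C r * (ρ / r) ^ m :=
      (summable_geometric_of_lt_one hq0 hq1).mul_left _
    have hterm : ∀ c : ℂ, ∀ m : ℕ, ‖c‖ ≤ C r / r ^ m → ‖c‖ * ρ ^ m ≤ C r * (ρ / r) ^ m := by
      intro c m hc
      calc ‖c‖ * ρ ^ m ≤ C r / r ^ m * ρ ^ m := by gcongr
        _ = _ := by rw [div_pow ρ r m, div_mul_eq_mul_div, mul_div_assoc]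
    have hz : ∀ z ∈ Metric.closedBall (0 : ℂ) ρ, ∀ c : ℕ → ℂ, (∀ m, ‖c m‖ ≤ C r / r ^ m) →
        Summable fun m => c m * z ^ m := by
      intro z hz c hc
      refine Summable.of_norm_bounded hgeo fun m => le_trans ?_ (hterm (c m) m (hc m))
      rw [norm_mul, norm_pow]
      have : ‖z‖ ≤ ρ := by simpa using hz
      gcongr
    -- Cauchy's estimate at the larger radius r gives the geometric majorant (ρ/r)^m, so dominated
    -- convergence upgrades coefficientwise convergence to uniform convergence on |z| ≤ ρ.
    have hT : Tendsto (fun k => ∑' m, ‖a (φ k) m - b m‖ * ρ ^ m) atTop (𝓝 0) := by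
      have := tendsto_tsum_of_dominated_convergence (𝓕 := atTop)
        (f := fun k m => ‖a (φ k) m - b m‖ * ρ ^ m) (g := fun _ => (0 : ℝ))
        (bound := fun m => 2 * (C r * (ρ / r) ^ m)) (hgeo.mul_left 2) ?_ ?_
      · simpa using this
      · intro m
        have h1 : Tendsto (fun k => ‖a (φ k) m - b m‖) atTop (𝓝 0) := by
          simpa using ((hlim' m).sub_const (b m)).norm
        simpa using h1.mul_const (ρ ^ m)
      · refine Eventually.of_forall fun k m => ?_
        rw [Real.norm_of_nonneg (by positivity)]
        have h1 := hterm _ m (hbound r hr0 hr1 (φ k) m)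
        have h2 := hterm _ m (hbb r hr0 hr1 m)
        calc ‖a (φ k) m - b m‖ * ρ ^ m ≤ (‖a (φ k) m‖ + ‖b m‖) * ρ ^ m := by
              gcongr; exact norm_sub_le _ _
          _ ≤ _ := by linarith
    rw [Metric.tendstoUniformlyOn_iff]
    intro ε hε
    filter_upwards [hT.eventually (gt_mem_nhds hε)] with k hk z hzρ
    refine lt_of_le_of_lt ?_ hk
    have hzρ' : ‖z‖ ≤ ρ := by simpa using hzρ
    have hzd : z ∈ disc := mem_ball_zero_iff.2 (by linarith)
    have hs1 := hsum (φ k) z hzd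
    have hs2 := (hz z hzρ b (hbb r hr0 hr1)).hasSum
    have hs := hs1.sub hs2
    rw [dist_eq_norm, zero_sub, norm_neg, Pi.sub_apply, hg, ← hs.tsum_eq]
    refine tsum_of_norm_bounded (Summable.hasSum ?_) fun m => ?_
    · refine Summable.of_nonneg_of_le (fun m => by positivity) (fun m => ?_) (hgeo.mul_left 2)
      have h1 := hterm _ m (hbound r hr0 hr1 (φ k) m)
      have h2 := hterm _ m (hbb r hr0 hr1 m)
      calc ‖a (φ k) m - b m‖ * ρ ^ m ≤ (‖a (φ k) m‖ + ‖b m‖) * ρ ^ m := by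
            gcongr; exact norm_sub_le _ _
        _ ≤ _ := by linarith
    · rw [← sub_mul, norm_mul, norm_pow]
      gcongr
  refine ⟨φ, hφ, g, ?_, hunif⟩
  have hloc : TendstoLocallyUniformlyOn (fun k => f (φ k)) g atTop disc := by
    rw [tendstoLocallyUniformlyOn_iff_forall_isCompact Metric.isOpen_ball]
    intro K hK hc
    have := hunif K hK hc
    rw [Metric.tendstoUniformlyOn_iff] at this ⊢
    intro ε hε
    filter_upwards [this ε hε] with k hk z hz
    have := hk z hz
    rwa [dist_eq_norm, zero_sub, norm_neg, Pi.sub_apply, ← dist_eq_norm, dist_comm] at this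
  exact hloc.differentiableOn (Eventually.of_forall fun k => hf (φ k)) Metric.isOpen_ball

lemma TendstoZeroOnCompacts.tendsto_apply {f : ℕ → ℂ → ℂ} (hf : TendstoZeroOnCompacts f) {z : ℂ}
    (hz : z ∈ disc) : Tendsto (fun k => f k z) atTop (𝓝 0) :=
  (hf {z} (Set.singleton_subset_iff.2 hz) isCompact_singleton).tendsto_at rfl

lemma weightedArea_absolutelyContinuous (w : ℝ → ℝ) :
    weightedArea w ≪ volume.restrict disc :=
  (withDensity_absolutelyContinuous _ _).trans (Measure.smul_absolutelyContinuous)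

lemma aestronglyMeasurable_weightedArea {f : ℂ → ℂ} (hf : DifferentiableOn ℂ f disc) (w : ℝ → ℝ) :
    AEStronglyMeasurable f (weightedArea w) :=
  (hf.continuousOn.aestronglyMeasurable Metric.isOpen_ball.measurableSet).mono_ac
    (weightedArea_absolutelyContinuous w)

lemma lintegral_enorm_rpow_eq {q : ℝ} (hq : 0 < q) (f : ℂ → ℂ) (ν : Measure ℂ) :
    ∫⁻ z, ‖f z‖ₑ ^ q ∂ν = eLpNorm f (ENNReal.ofReal q) ν ^ q := by
  have h0 : ENNReal.ofReal q ≠ 0 := by simpa using hq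
  rw [eLpNorm_eq_lintegral_rpow_enorm_toReal h0 ENNReal.ofReal_ne_top,
    ENNReal.toReal_ofReal hq.le, ← ENNReal.rpow_mul, one_div_mul_cancel hq.ne', ENNReal.rpow_one]

lemma tendsto_lintegral_iff {q : ℝ} (hq : 0 < q) (f : ℕ → ℂ → ℂ) (ν : Measure ℂ) :
    Tendsto (fun k => ∫⁻ z, ‖f k z‖ₑ ^ q ∂ν) atTop (𝓝 0) ↔
      Tendsto (fun k => eLpNorm (f k) (ENNReal.ofReal q) ν) atTop (𝓝 0) := by
  simp only [lintegral_enorm_rpow_eq hq]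
  constructor
  · intro h
    have := h.ennrpow_const (1 / q)
    simp only [← ENNReal.rpow_mul, mul_one_div_cancel hq.ne', ENNReal.rpow_one] at this
    rwa [ENNReal.zero_rpow_of_pos (by positivity)] at this
  · intro h
    have := h.ennrpow_const q
    rwa [ENNReal.zero_rpow_of_pos hq] at this

/-- For a vanishing Carleson measure, bounded sequences that tend to zero locally uniformly tend to
zero in the mean. -/
lemma IsVanishingCarleson.tendsto_lintegral {q p : ℝ} (hq : 0 < q) {w : ℝ → ℝ} {μ : Measure ℂ}
    (h : IsVanishingCarleson q p w μ) {f : ℕ → ℂ → ℂ} (hf : BoundedSeq p w f)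
    (h0 : TendstoZeroOnCompacts f) :
    Tendsto (fun k => ∫⁻ z in disc, ‖f k z‖ₑ ^ q ∂μ) atTop (𝓝 0) := by
  rw [tendsto_lintegral_iff hq]
  refine tendsto_of_subseq_tendsto fun ns hns => ?_
  have hb : BoundedSeq p w fun k => f (ns k) := ⟨fun k => hf.1 _, hf.2.imp fun C hC k => hC _⟩
  obtain ⟨g, hg, φ, hφ, hlim⟩ := h.2 _ hb
  refine ⟨φ, ?_⟩
  have hmeas : ∀ k, AEStronglyMeasurable (f (ns (φ k))) (μ.restrict disc) := fun k =>
    (hf.1 _).1.continuousOn.aestronglyMeasurable Metric.isOpen_ball.measurableSet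
  have hq0 : ENNReal.ofReal q ≠ 0 := by simpa using hq
  obtain ⟨ms, hms, hae⟩ :=
    (tendstoInMeasure_of_tendsto_eLpNorm hq0 hmeas hg.1 hlim).exists_seq_tendsto_ae
  -- Convergence in L^q(μ) gives a.e. convergence of a further subsequence, and the pointwise limit
  -- is zero.
  have hg0 : g =ᵐ[μ.restrict disc] 0 := by
    filter_upwards [hae, ae_restrict_mem Metric.isOpen_ball.measurableSet] with z hz hzd
    refine tendsto_nhds_unique hz ?_
    exact (h0.tendsto_apply hzd).comp
      (hns.comp (hφ.tendsto_atTop.comp hms.tendsto_atTop))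
  refine hlim.congr fun k => eLpNorm_congr_ae ?_
  filter_upwards [hg0] with z hz
  simp [hz]

/-! ### Sufficiency of the cell condition -/

section Sufficiency

variable {ι : Type} [Countable ι] {P : WhitneyCover ι} {μ : Measure ℂ} {lam : ℝ} {Om : ℝ → ℝ}

/-- The cell condition makes the integrals of products small, uniformly in all the factors but the
first. -/
lemma CellCondition.eventually_lintegral_le (hD : CellCondition P lam Om μ) {n : ℕ}
    {α β p q : Fin (n + 1) → ℝ} {W : Fin (n + 1) → ℝ → ℝ}
    (hW : ∀ i, IsPowerWeight (α i) (β i) (W i)) (hp : ∀ i, 0 < p i) (hq : ∀ i, 0 < q i)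
    (hlam : 0 < lam) (hsum : lam = ∑ i, q i / p i)
    (hOm : ∀ r ∈ Set.Ico (0 : ℝ) 1, Om r = ∏ i, W i r ^ (q i / (lam * p i)))
    {f : ℕ → ℂ → ℂ} (hf : BoundedSeq (p 0) (W 0) f) (h0 : TendstoZeroOnCompacts f) (M : ℝ≥0)
    {ε : ℝ≥0∞} (hε : ε ≠ 0) :
    ∀ᶠ k in atTop, ∀ g : Fin n → ℂ → ℂ, (∀ i, DifferentiableOn ℂ (g i) disc ∧
      bergmanNorm (p i.succ) (W i.succ) (g i) ≤ M) →
      ∫⁻ z in disc, ‖f k z‖ₑ ^ q 0 * ∏ i, ‖g i z‖ₑ ^ q i.succ ∂μ ≤ ε := by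
  obtain ⟨hf1, M₀, hM₀⟩ := hf
  set M' := max M₀ M with hM'
  have hε2 : ε / 2 ≠ 0 := by simp [ENNReal.div_eq_zero_iff, hε]
  obtain ⟨r, hr, hint⟩ := hD.exists_lintegral_le hW hp hq hlam hsum hOm M' hε2
  choose C hC using fun i => (hW i).exists_enorm_le (hp i) hr
  set B : ℝ≥0∞ := (∏ i : Fin n, ((C i.succ : ℝ≥0∞) * M) ^ q i.succ) * μ (Metric.closedBall 0 r)
    with hB
  have hBt : B ≠ ∞ := by
    refine ENNReal.mul_ne_top (ENNReal.prod_ne_top fun i _ => ?_) (hD.1 r hr).ne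
    exact ENNReal.rpow_ne_top_of_nonneg (hq _).le
      (ENNReal.mul_ne_top ENNReal.coe_ne_top ENNReal.coe_ne_top)
  -- On |z| ≤ r the other factors are bounded by point evaluations, so the integral there is at most
  -- sup |f_k|^(q_0) · B. The choice of η makes this at most ε/2; B + 1 avoids a zero denominator.
  set η : ℝ≥0∞ := (ε / 2 / (B + 1)) ^ (1 / q 0) with hη
  have hη0 : 0 < η := by
    refine ENNReal.rpow_pos_of_nonneg ?_ (one_div_pos.2 (hq 0)).le
    exact ENNReal.div_pos hε2 (ENNReal.add_ne_top.2 ⟨hBt, ENNReal.one_ne_top⟩)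
  have hηq : η ^ q 0 = ε / 2 / (B + 1) := by
    rw [hη, ← ENNReal.rpow_mul, one_div_mul_cancel (hq 0).ne', ENNReal.rpow_one]
  have hunif := h0 (Metric.closedBall 0 r) (Metric.closedBall_subset_ball hr)
    (isCompact_closedBall _ _)
  rw [EMetric.tendstoUniformlyOn_iff] at hunif
  filter_upwards [hunif η hη0] with k hk g hg
  set h : Fin (n + 1) → ℂ → ℂ := Fin.cons (f k) g with hh
  have e : ∀ z, ‖f k z‖ₑ ^ q 0 * ∏ i, ‖g i z‖ₑ ^ q i.succ = ∏ i, ‖h i z‖ₑ ^ q i := by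
    intro z; rw [Fin.prod_univ_succ]; simp [hh]
  have h1 := hint h
    (fun i => Fin.cases (by simpa [hh] using (hf1 k).1) (fun i => by simpa [hh] using (hg i).1) i)
    (fun i => Fin.cases ((hM₀ k).trans (ENNReal.coe_le_coe.2 (le_max_left _ _)))
      (fun i => (hg i).2.trans (ENNReal.coe_le_coe.2 (le_max_right _ _))) i)
  simp only [e]
  refine h1.trans ?_
  have h2 : ∫⁻ z in Metric.closedBall 0 r, ∏ i, ‖h i z‖ₑ ^ q i ∂μ ≤ ε / 2 := by
    calc _ ≤ ∫⁻ _ in Metric.closedBall (0 : ℂ) r,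
          η ^ q 0 * ∏ i : Fin n, ((C i.succ : ℝ≥0∞) * M) ^ q i.succ ∂μ := by
          refine setLIntegral_mono' Metric.isClosed_closedBall.measurableSet fun z hz => ?_
          rw [← e]
          gcongr with i
          · exact (hq 0).le
          · have := hk z hz
            rw [edist_comm, edist_zero_right] at this
            exact this.le
          · exact (hq i.succ).le
          · refine (hC i.succ (g i) (hg i).1 z hz).trans ?_
            gcongr
            exact (hg i).2
      _ = η ^ q 0 * B := by rw [setLIntegral_const, hB, mul_assoc]
      _ ≤ ε / 2 / (B + 1) * (B + 1) := by
          rw [hηq]; gcongr; exact le_self_add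
      _ ≤ ε / 2 := by rw [mul_comm]; exact ENNReal.mul_div_le
  calc _ ≤ ε / 2 + ε / 2 := by gcongr
    _ = ε := ENNReal.add_halves ε

/-- The cell condition is sufficient for vanishing Carleson measures. -/
lemma CellCondition.isVanishingCarleson (hD : CellCondition P lam Om μ) (hlam : 0 < lam)
    {α β : ℝ} (hOm : IsPowerWeight α β Om) : IsVanishingCarleson lam 1 Om μ := by
  -- The case of a single factor with p = 1 and q = λ, so the exponent of the weight is 1.
  have hOm' : ∀ r ∈ Set.Ico (0 : ℝ) 1, Om r = ∏ _i : Fin (0 + 1), Om r ^ (lam / (lam * 1)) := by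
    intro r _
    simp [hlam.ne']
  have hsum : lam = ∑ _i : Fin (0 + 1), lam / 1 := by simp
  have hmem : ∀ f ∈ bergmanSpace 1 Om, MemLp f (ENNReal.ofReal lam) (μ.restrict disc) := by
    intro f hf
    refine ⟨hf.1.continuousOn.aestronglyMeasurable Metric.isOpen_ball.measurableSet, ?_⟩
    obtain ⟨r, hr, hint⟩ := hD.exists_lintegral_le (κ := Fin (0 + 1)) (α := fun _ => α)
      (β := fun _ => β) (W := fun _ => Om) (p := fun _ => 1) (q := fun _ => lam) (fun _ => hOm)
      (fun _ => one_pos) (fun _ => hlam) hlam hsum hOm' (bergmanNorm 1 Om f).toNNReal one_ne_zero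
    obtain ⟨C, hC⟩ := hOm.exists_enorm_le one_pos hr
    have h1 := hint (fun _ => f) (fun _ => hf.1) (fun _ => by
      rw [ENNReal.coe_toNNReal hf.2.ne])
    simp only [Finset.prod_const, Finset.card_univ, Fintype.card_fin, zero_add, pow_one] at h1
    have h2 : ∫⁻ z in disc, ‖f z‖ₑ ^ lam ∂μ < ∞ := by
      refine h1.trans_lt (ENNReal.add_lt_top.2 ⟨?_, ENNReal.one_lt_top⟩)
      calc _ ≤ ∫⁻ _ in Metric.closedBall (0 : ℂ) r, (C * bergmanNorm 1 Om f) ^ lam ∂μ := by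
            refine setLIntegral_mono' Metric.isClosed_closedBall.measurableSet fun z hz => ?_
            gcongr
            exact hC f hf.1 z hz
        _ < ∞ := by
            rw [setLIntegral_const]
            exact ENNReal.mul_lt_top (ENNReal.rpow_lt_top_of_nonneg hlam.le
              (ENNReal.mul_ne_top ENNReal.coe_ne_top hf.2.ne)) (hD.1 r hr)
    rw [lintegral_enorm_rpow_eq hlam] at h2
    by_contra h
    rw [not_lt_top_iff.1 h, ENNReal.top_rpow_of_pos hlam] at h2
    exact lt_irrefl _ h2
  · refine ⟨hmem, fun f hf => ?_⟩
    obtain ⟨hf1, M, hM⟩ := hf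
    obtain ⟨φ, hφ, g, hg, hlim⟩ := exists_subseq_tendsto_on_compacts (fun k => (hf1 k).1)
      (fun r hr => by
        obtain ⟨C, hC⟩ := hOm.exists_enorm_le one_pos hr
        refine ⟨(C * M : ℝ≥0), fun k z hz => ?_⟩
        have h1 : ‖f k z‖ₑ ≤ ((C * M : ℝ≥0) : ℝ≥0∞) := by
          refine (hC (f k) (hf1 k).1 z hz).trans ?_
          push_cast
          gcongr
          exact hM k
        exact_mod_cast h1)
    -- Fatou's lemma: the locally uniform limit stays in the space, so f_k - g is a bounded null
    -- sequence.
    have hgM : bergmanNorm 1 Om g ≤ M := by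
      have hae : ∀ᵐ z ∂(weightedArea Om), Tendsto (fun k => f (φ k) z) atTop (𝓝 (g z)) := by
        refine (weightedArea_absolutelyContinuous Om).ae_le ?_
        filter_upwards [ae_restrict_mem Metric.isOpen_ball.measurableSet] with z hz
        have := (hlim.tendsto_apply hz).add_const (g z)
        simpa using this
      refine (Lp.eLpNorm_lim_le_liminf_eLpNorm
        (fun k => aestronglyMeasurable_weightedArea (hf1 (φ k)).1 Om) g hae).trans ?_
      refine (liminf_le_liminf (Eventually.of_forall fun k => hM (φ k))).trans ?_
      simp
    have hdiff : BoundedSeq 1 Om fun k => f (φ k) - g := by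
      have hb : ∀ k, bergmanNorm 1 Om (f (φ k) - g) ≤ ((M + M : ℝ≥0) : ℝ≥0∞) := by
        intro k
        refine (eLpNorm_sub_le (aestronglyMeasurable_weightedArea (hf1 (φ k)).1 Om)
          (aestronglyMeasurable_weightedArea hg Om) (by simp)).trans ?_
        push_cast
        exact add_le_add (hM (φ k)) hgM
      exact ⟨fun k => ⟨(hf1 (φ k)).1.sub hg, (hb k).trans_lt ENNReal.coe_lt_top⟩, _, hb⟩
    have htend : Tendsto (fun k => ∫⁻ z in disc, ‖(f (φ k) - g) z‖ₑ ^ lam ∂μ) atTop (𝓝 0) := by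
      rw [ENNReal.tendsto_nhds_zero]
      intro ε hε
      filter_upwards [hD.eventually_lintegral_le (n := 0) (α := fun _ => α)
        (β := fun _ => β) (W := fun _ => Om) (p := fun _ => 1) (q := fun _ => lam) (fun _ => hOm)
        (fun _ => one_pos) (fun _ => hlam) hlam hsum hOm' hdiff hlim 0 hε.ne'] with k hk
      simpa using hk (fun _ => 0) (fun i => i.elim0)
    rw [tendsto_lintegral_iff hlam] at htend
    exact ⟨g, hmem g ⟨hg, hgM.trans_lt ENNReal.coe_lt_top⟩, φ, hφ, htend⟩

end Sufficiency

/-! ### Kernel sums and test functions -/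

lemma norm_one_sub_conj_mul_comm (a z : ℂ) :
    ‖1 - starRingEnd ℂ a * z‖ = ‖1 - starRingEnd ℂ z * a‖ := by
  rw [← Complex.norm_conj (1 - starRingEnd ℂ a * z)]
  simp [mul_comm]

lemma one_sub_norm_le_norm_one_sub {a z : ℂ} (hz : z ∈ disc) :
    1 - ‖a‖ ≤ ‖1 - starRingEnd ℂ a * z‖ := by
  have hz1 : ‖z‖ < 1 := mem_ball_zero_iff.1 hz
  have h := norm_sub_norm_le (1 : ℂ) (starRingEnd ℂ a * z)
  rw [norm_mul, Complex.norm_conj, norm_one] at h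
  nlinarith [norm_nonneg a]

namespace WhitneyCover

variable {ι : Type} (P : WhitneyCover ι)

/-- The modulus of the normalized Cauchy kernel of a cell. -/
def kernel (j : ι) (z : ℂ) : ℝ := P.depth j / ‖1 - starRingEnd ℂ (P.center j) * z‖

lemma norm_one_sub_pos (j : ι) {z : ℂ} (hz : z ∈ disc) :
    0 < ‖1 - starRingEnd ℂ (P.center j) * z‖ :=
  (P.depth_pos j).trans_le (one_sub_norm_le_norm_one_sub hz)

lemma kernel_pos (j : ι) {z : ℂ} (hz : z ∈ disc) : 0 < P.kernel j z :=
  div_pos (P.depth_pos j) (P.norm_one_sub_pos j hz)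

lemma kernel_le_one (j : ι) {z : ℂ} (hz : z ∈ disc) : P.kernel j z ≤ 1 :=
  (div_le_one (P.norm_one_sub_pos j hz)).2 (one_sub_norm_le_norm_one_sub hz)

lemma kernel_rpow (j : ι) (z : ℂ) (γ : ℝ) :
    P.kernel j z ^ γ = P.depth j ^ γ * ‖1 - starRingEnd ℂ (P.center j) * z‖ ^ (-γ) := by
  rw [kernel, Real.div_rpow (P.depth_pos j).le (norm_nonneg _), Real.rpow_neg (norm_nonneg _),
    div_eq_mul_inv]

/-- For a cell of depth δ, 1 - āz = (1 - |a|²) - ā(z - a) has modulus at most 2δ + δ/4. -/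
lemma one_third_le_kernel (j : ι) {z : ℂ} (hz : z ∈ P.cell j) : 1 / 3 ≤ P.kernel j z := by
  have hzd := P.cell_subset_disc j hz
  rw [kernel, div_le_div_iff₀ (by norm_num) (P.norm_one_sub_pos j hzd), one_mul]
  set a := P.center j with ha
  have hz4 : ‖z - a‖ ≤ P.depth j / 4 := mem_closedBall_iff_norm.1 (P.cell_subset j hz)
  have ha1 : ‖a‖ < 1 := mem_ball_zero_iff.1 (P.center_mem j)
  have hd : P.depth j = 1 - ‖a‖ := rfl
  have e : 1 - starRingEnd ℂ a * z =
      ((1 - ‖a‖ ^ 2 : ℝ) : ℂ) - starRingEnd ℂ a * (z - a) := by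
    have : starRingEnd ℂ a * a = ((‖a‖ ^ 2 : ℝ) : ℂ) := by
      rw [← Complex.normSq_eq_conj_mul_self, Complex.normSq_eq_norm_sq]
    push_cast at this ⊢
    rw [mul_sub, this]; ring
  rw [e]
  refine (norm_sub_le _ _).trans ?_
  rw [norm_mul, Complex.norm_conj, Complex.norm_of_nonneg (by nlinarith [norm_nonneg a])]
  nlinarith [norm_nonneg a, norm_nonneg (z - a)]

/-- A discrete Forelli–Rudin estimate. As the enlarged cell has area comparable to δ², each term is
at most a multiple of the integral over that cell of (1 - |ζ|)^x |1 - z̄ζ|^(-γ), where x = γ - η -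
2. Bounded overlap and the integral estimate for the weight (1 - r)^x finish; x > -1 is the
hypothesis γ > 1 + η. -/
lemma exists_sum_kernel_le [Countable ι] {γ η : ℝ} (hη : 0 < η) (hγ : 1 + η < γ) :
    ∃ C : ℝ, 0 < C ∧ ∀ (s : Finset ι), ∀ z ∈ disc,
      ∑ j ∈ s, P.kernel j z ^ γ * P.depth j ^ (-η) ≤ C * (1 - ‖z‖) ^ (-η) := by
  set x := γ - η - 2 with hx
  obtain ⟨C₁, hC₁, h₁⟩ := (IsPowerWeight.one_sub_rpow x).lintegral_kernel_le (γ := γ)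
    (by linarith) (by linarith) (by linarith)
  -- The factors undo the area πδ²/4, the change of 1 - |ζ| by at most a factor 2, and |1 - z̄ζ| ≤ k
  -- + δ/2 ≤ 3k/2 with k = |1 - āz|.
  set C₀ : ℝ := 4 / Real.pi * 2 ^ |x| * (3 / 2) ^ γ with hC₀
  have hC₀p : 0 < C₀ := by have := Real.pi_pos; positivity
  refine ⟨C₀ * (P.overlap + 1) * C₁, by positivity, fun s z hz => ?_⟩
  have hz1 : ‖z‖ < 1 := mem_ball_zero_iff.1 hz
  have hδz : 0 < 1 - ‖z‖ := by linarith
  set H : ℂ → ℝ≥0∞ := fun ζ =>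
    ENNReal.ofReal ((1 - ‖ζ‖) ^ x * ‖1 - starRingEnd ℂ z * ζ‖ ^ (-γ)) with hH
  have hterm : ∀ j, ENNReal.ofReal (P.kernel j z ^ γ * P.depth j ^ (-η)) ≤
      ENNReal.ofReal C₀ * ∫⁻ ζ in P.bigCell j, H ζ := by
    intro j
    set a := P.center j with ha
    set δ := P.depth j with hδ
    have hδ0 : 0 < δ := P.depth_pos j
    set k := ‖1 - starRingEnd ℂ a * z‖ with hk
    have hk0 : 0 < k := P.norm_one_sub_pos j hz
    have hδk : δ ≤ k := one_sub_norm_le_norm_one_sub hz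
    have hlow : ∀ ζ ∈ P.bigCell j,
        ENNReal.ofReal ((2 ^ |x|)⁻¹ * δ ^ x * (((3 / 2) ^ γ)⁻¹ * k ^ (-γ))) ≤ H ζ := by
      intro ζ hζ
      refine ENNReal.ofReal_le_ofReal ?_
      obtain ⟨b1, b2⟩ := one_sub_norm_bounds hζ
      have hζ1 : ‖ζ‖ < 1 := mem_ball_zero_iff.1 (P.bigCell_subset j hζ)
      have hδζ : 0 < 1 - ‖ζ‖ := by linarith
      have hδ' : δ = 1 - ‖a‖ := rfl
      have i1 : (2 ^ |x|)⁻¹ * δ ^ x ≤ (1 - ‖ζ‖) ^ x := by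
        rcases le_total 0 x with hx0 | hx0
        · rw [abs_of_nonneg hx0, ← Real.inv_rpow (by norm_num), ← Real.mul_rpow (by norm_num) hδ0.le]
          exact Real.rpow_le_rpow (by positivity) (by linarith) hx0
        · rw [abs_of_nonpos hx0, Real.rpow_neg (by norm_num), inv_inv,
            ← Real.mul_rpow (by norm_num) hδ0.le]
          exact Real.rpow_le_rpow_of_nonpos hδζ (by linarith) hx0
      have i2 : ((3 / 2) ^ γ)⁻¹ * k ^ (-γ) ≤ ‖1 - starRingEnd ℂ z * ζ‖ ^ (-γ) := by
        rw [← Real.rpow_neg (by norm_num), ← Real.mul_rpow (by norm_num) hk0.le]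
        have hpos : 0 < ‖1 - starRingEnd ℂ z * ζ‖ :=
          lt_of_lt_of_le hδz (one_sub_norm_le_norm_one_sub (P.bigCell_subset j hζ))
        refine Real.rpow_le_rpow_of_nonpos hpos ?_ (by linarith)
        have e : 1 - starRingEnd ℂ z * ζ = (1 - starRingEnd ℂ z * a) - starRingEnd ℂ z * (ζ - a) := by
          ring
        have h1 : ‖ζ - a‖ ≤ δ / 2 := (mem_ball_iff_norm.1 hζ).le
        rw [e]
        refine (norm_sub_le _ _).trans ?_
        rw [norm_mul, Complex.norm_conj, ← norm_one_sub_conj_mul_comm a z]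
        nlinarith [norm_nonneg (ζ - a)]
      exact mul_le_mul i1 i2 (by positivity) (Real.rpow_nonneg hδζ.le _)
    have hvol : volume (P.bigCell j) = ENNReal.ofReal (Real.pi * (δ / 2) ^ 2) := by
      rw [bigCell, Complex.volume_ball, mul_comm Real.pi, ENNReal.ofReal_mul (by positivity),
        ENNReal.ofReal_pow (by positivity)]
      congr 1
      rw [← NNReal.coe_real_pi, ENNReal.ofReal_coe_nnreal]
    calc ENNReal.ofReal (P.kernel j z ^ γ * δ ^ (-η))
        = ENNReal.ofReal C₀ * (ENNReal.ofReal ((2 ^ |x|)⁻¹ * δ ^ x * (((3 / 2) ^ γ)⁻¹ * k ^ (-γ))) *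
            volume (P.bigCell j)) := by
          rw [hvol, ← ENNReal.ofReal_mul (by positivity), ← ENNReal.ofReal_mul hC₀p.le,
            P.kernel_rpow j z]
          congr 1
          have e1 : δ ^ x * δ ^ 2 = δ ^ γ * δ ^ (-η) := by
            rw [← Real.rpow_two, ← Real.rpow_add hδ0, ← Real.rpow_add hδ0]
            congr 1; rw [hx]; ring
          have hpi := Real.pi_ne_zero
          have h2 : (2 : ℝ) ^ |x| ≠ 0 := by positivity
          have h3 : ((3 : ℝ) / 2) ^ γ ≠ 0 := by positivity
          calc δ ^ γ * k ^ (-γ) * δ ^ (-η) = (δ ^ x * δ ^ 2) * k ^ (-γ) := by rw [e1]; ring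
            _ = (Real.pi * Real.pi⁻¹) * ((2 ^ |x|) * (2 ^ |x|)⁻¹) *
                (((3 / 2) ^ γ) * ((3 / 2) ^ γ)⁻¹) * ((δ ^ x * δ ^ 2) * k ^ (-γ)) := by
                  rw [mul_inv_cancel₀ hpi, mul_inv_cancel₀ h2, mul_inv_cancel₀ h3]; ring
            _ = _ := by rw [hC₀]; ring
      _ ≤ _ := by
          gcongr
          rw [← setLIntegral_const]
          exact setLIntegral_mono' (P.measurableSet_bigCell j) hlow
  have hmeas : Measurable H := by
    rw [hH]; fun_prop
  have hfin : ENNReal.ofReal (∑ j ∈ s, P.kernel j z ^ γ * P.depth j ^ (-η)) ≤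
      ENNReal.ofReal (C₀ * (P.overlap + 1) * C₁ * (1 - ‖z‖) ^ (-η)) := by
    rw [ENNReal.ofReal_sum_of_nonneg fun j _ => mul_nonneg
      (Real.rpow_nonneg (P.kernel_pos j hz).le _) (Real.rpow_nonneg (P.depth_pos j).le _)]
    calc _ ≤ ∑ j ∈ s, ENNReal.ofReal C₀ * ∫⁻ ζ in P.bigCell j, H ζ :=
          Finset.sum_le_sum fun j _ => hterm j
      _ = ENNReal.ofReal C₀ * ∑ j ∈ s, ∫⁻ ζ in P.bigCell j, H ζ := by rw [Finset.mul_sum]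
      _ ≤ ENNReal.ofReal C₀ * ∑' j, ∫⁻ ζ in P.bigCell j, H ζ := by
          gcongr; exact ENNReal.sum_le_tsum s
      _ ≤ ENNReal.ofReal C₀ * (P.overlap * ∫⁻ ζ in disc, H ζ) := by
          gcongr; exact P.tsum_lintegral_bigCell_le hmeas.aemeasurable
      _ ≤ ENNReal.ofReal C₀ * (ENNReal.ofReal (P.overlap + 1) *
          ENNReal.ofReal (C₁ * ((1 - ‖z‖) ^ x * (1 - ‖z‖) ^ (2 - γ)))) := by
          gcongr
          · rw [← ENNReal.ofReal_natCast]
            exact ENNReal.ofReal_le_ofReal (by linarith)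
          · exact h₁ z hz
      _ = _ := by
          rw [← ENNReal.ofReal_mul (by positivity), ← ENNReal.ofReal_mul (by positivity),
            ← Real.rpow_add hδz]
          congr 1
          rw [show x + (2 - γ) = -η by rw [hx]; ring]; ring
  exact (ENNReal.ofReal_le_ofReal_iff (by positivity)).1 hfin

/-- The normalized power of the Cauchy kernel of a cell. -/
def testFun (N : ℕ) (p : ℝ) (W : ℝ → ℝ) (j : ι) (z : ℂ) : ℂ :=
  (discSize W (P.center j) ^ (-(1 / p)) : ℝ) *
    ((P.depth j : ℂ) / (1 - starRingEnd ℂ (P.center j) * z)) ^ N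

lemma differentiableOn_testFun (N : ℕ) (p : ℝ) (W : ℝ → ℝ) (j : ι) :
    DifferentiableOn ℂ (P.testFun N p W j) disc := by
  unfold testFun
  refine DifferentiableOn.const_mul (DifferentiableOn.pow ?_ N) _
  refine DifferentiableOn.div (by fun_prop) (by fun_prop) fun z hz => ?_
  exact norm_pos_iff.1 (P.norm_one_sub_pos j hz)

lemma measurable_testFun (N : ℕ) (p : ℝ) (W : ℝ → ℝ) (j : ι) :
    Measurable (P.testFun N p W j) := by
  unfold testFun; fun_prop

variable {α β p : ℝ} {W : ℝ → ℝ}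

lemma norm_testFun (hW : IsPowerWeight α β W) (N : ℕ) (p : ℝ) (j : ι) (z : ℂ) :
    ‖P.testFun N p W j z‖ = discSize W (P.center j) ^ (-(1 / p)) * P.kernel j z ^ N := by
  rw [testFun, norm_mul, norm_pow, norm_div, Complex.norm_of_nonneg
    (Real.rpow_nonneg (hW.discSize_pos (P.center_mem j)).le _),
    Complex.norm_of_nonneg (P.depth_pos j).le, kernel]

lemma le_norm_testFun (hW : IsPowerWeight α β W) (N : ℕ) (p : ℝ) (j : ι) {z : ℂ}
    (hz : z ∈ P.cell j) :
    discSize W (P.center j) ^ (-(1 / p)) * (1 / 3) ^ N ≤ ‖P.testFun N p W j z‖ := by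
  rw [P.norm_testFun hW]
  have := P.one_third_le_kernel j hz
  have := (hW.discSize_pos (P.center_mem j)).le
  gcongr

end WhitneyCover

lemma real_rpow_sum_le {κ : Type*} (s : Finset κ) {x : κ → ℝ} (hx : ∀ i, 0 ≤ x i) {p : ℝ}
    (hp : 0 < p) (hp1 : p ≤ 1) : (∑ i ∈ s, x i) ^ p ≤ ∑ i ∈ s, x i ^ p := by
  classical
  induction s using Finset.induction_on with
  | empty => simp [Real.zero_rpow hp.ne']
  | insert i s hi ih =>
    rw [Finset.sum_insert hi, Finset.sum_insert hi]
    refine (Real.rpow_add_le_add_rpow (hx i) (Finset.sum_nonneg fun i _ => hx i) hp.le hp1).trans ?_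
    gcongr

namespace WhitneyCover

variable {ι : Type} (P : WhitneyCover ι) {α β p : ℝ} {W : ℝ → ℝ}

/-- A pointwise bound linear in |c_j|^p, ready to be integrated term by term. For p ≤ 1,
subadditivity of x^p gives σ = 0. For p > 1, Hölder's inequality is applied to kernel^N =
(kernel^(N/2) δ^η)(kernel^(N/2) δ^(-η)); the second factors are summed by `exists_sum_kernel_le`, at
the price of (1 - |z|)^(-σ). Having σ < α keeps W(r)(1 - r)^(-σ) within reach of the Forelli–Rudin
estimate. -/
lemma exists_norm_sum_testFun_rpow_le [Countable ι] (hW : IsPowerWeight α β W) (hα : 0 < α)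
    (hp : 0 < p) {N : ℕ} (hN : 4 + 2 * (|β| + 2) / p + α / p ≤ N) :
    ∃ C σ : ℝ, 0 < C ∧ 0 ≤ σ ∧ σ < α ∧ ∀ (s : Finset ι) (c : ι → ℂ), ∀ z ∈ disc,
      ‖∑ j ∈ s, c j * P.testFun N p W j z‖ ^ p ≤ C * ∑ j ∈ s, ‖c j‖ ^ p *
        ((discSize W (P.center j))⁻¹ *
          (P.kernel j z ^ (N * p / 2) * (P.depth j / (1 - ‖z‖)) ^ σ)) := by
  have hV : ∀ j, 0 < discSize W (P.center j) := fun j => hW.discSize_pos (P.center_mem j)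
  have hnorm : ∀ (s : Finset ι) (c : ι → ℂ) (z : ℂ), ‖∑ j ∈ s, c j * P.testFun N p W j z‖ ≤
      ∑ j ∈ s, ‖c j‖ * (discSize W (P.center j) ^ (-(1 / p)) * P.kernel j z ^ N) := by
    intro s c z
    refine (norm_sum_le _ _).trans (le_of_eq (Finset.sum_congr rfl fun j _ => ?_))
    rw [norm_mul, P.norm_testFun hW]
  have hVp : ∀ j, (discSize W (P.center j) ^ (-(1 / p))) ^ p = (discSize W (P.center j))⁻¹ := by
    intro j
    rw [← Real.rpow_mul (hV j).le, neg_mul, one_div_mul_cancel hp.ne', Real.rpow_neg_one]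
  rcases le_or_gt p 1 with hp1 | hp1
  · refine ⟨1, 0, one_pos, le_rfl, hα, fun s c z hz => ?_⟩
    have hk : ∀ j, 0 ≤ P.kernel j z := fun j => (P.kernel_pos j hz).le
    refine (Real.rpow_le_rpow (norm_nonneg _) (hnorm s c z) hp.le).trans ?_
    refine (real_rpow_sum_le s (fun j => mul_nonneg (norm_nonneg _)
      (mul_nonneg (Real.rpow_nonneg (hV j).le _) (pow_nonneg (hk j) _))) hp hp1).trans ?_
    rw [one_mul]
    refine Finset.sum_le_sum fun j _ => ?_
    rw [Real.rpow_zero, mul_one, Real.mul_rpow (norm_nonneg _)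
      (mul_nonneg (Real.rpow_nonneg (hV j).le _) (pow_nonneg (hk j) _)),
      Real.mul_rpow (Real.rpow_nonneg (hV j).le _) (pow_nonneg (hk j) _), hVp,
      ← Real.rpow_natCast, ← Real.rpow_mul (hk j)]
    have := (inv_pos.2 (hV j)).le
    gcongr ?_ * (?_ * ?_)
    refine Real.rpow_le_rpow_of_exponent_ge (P.kernel_pos j hz) (P.kernel_le_one j hz) ?_
    have : 0 ≤ (N : ℝ) * p := by positivity
    linarith
  · set p' := p.conjExponent with hp'
    have hpq : p.HolderConjugate p' := Real.HolderConjugate.conjExponent hp1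
    have hp'1 : 1 < p' := hpq.symm.lt
    have hp'0 : 0 < p' := by linarith
    -- Chosen so that σ = ηp = α/2 < α.
    set η := α / (2 * p) with hη
    have hη0 : 0 < η := by positivity
    have hηp : η * p = α / 2 := by rw [hη]; field_simp
    have hNη : 1 + η < (N : ℝ) / 2 := by
      have h1 : 0 < 2 * (|β| + 2) / p := by positivity
      have h2 : η = α / p / 2 := by rw [hη]; field_simp
      linarith
    have hγ : 1 + η * p' < N / 2 * p' := by nlinarith
    obtain ⟨C, hC, h⟩ := P.exists_sum_kernel_le (mul_pos hη0 hp'0) hγ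
    refine ⟨C ^ (p / p'), α / 2, by positivity, by positivity, by linarith, fun s c z hz => ?_⟩
    have hk : ∀ j, 0 < P.kernel j z := fun j => P.kernel_pos j hz
    have hd : ∀ j, 0 < P.depth j := P.depth_pos
    have hz1 : 0 < 1 - ‖z‖ := by have := mem_ball_zero_iff.1 hz; linarith
    set u : ι → ℝ := fun j => ‖c j‖ * (discSize W (P.center j) ^ (-(1 / p)) *
      (P.kernel j z ^ ((N : ℝ) / 2) * P.depth j ^ η)) with hu
    set v : ι → ℝ := fun j => P.kernel j z ^ ((N : ℝ) / 2) * P.depth j ^ (-η) with hv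
    have hu0 : ∀ j, 0 ≤ u j := fun j => mul_nonneg (norm_nonneg _)
      (mul_nonneg (Real.rpow_nonneg (hV j).le _)
        (mul_nonneg (Real.rpow_nonneg (hk j).le _) (Real.rpow_nonneg (hd j).le _)))
    have hv0 : ∀ j, 0 ≤ v j := fun j =>
      mul_nonneg (Real.rpow_nonneg (hk j).le _) (Real.rpow_nonneg (hd j).le _)
    have huv : ∀ j, ‖c j‖ * (discSize W (P.center j) ^ (-(1 / p)) * P.kernel j z ^ N) =
        u j * v j := by
      intro j
      have e1 : P.kernel j z ^ N = P.kernel j z ^ ((N : ℝ) / 2) * P.kernel j z ^ ((N : ℝ) / 2) := by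
        rw [← Real.rpow_add (hk j), add_halves, Real.rpow_natCast]
      have e2 : P.depth j ^ η * P.depth j ^ (-η) = 1 := by
        rw [← Real.rpow_add (hd j)]; simp
      rw [e1, hu, hv]
      linear_combination (-(‖c j‖ * discSize W (P.center j) ^ (-(1 / p)) *
        P.kernel j z ^ ((N : ℝ) / 2) * P.kernel j z ^ ((N : ℝ) / 2))) * e2
    have hH : ‖∑ j ∈ s, c j * P.testFun N p W j z‖ ≤
        (∑ j ∈ s, u j ^ p) ^ (1 / p) * (∑ j ∈ s, v j ^ p') ^ (1 / p') := by
      refine (hnorm s c z).trans ?_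
      simp only [huv]
      exact Real.inner_le_Lp_mul_Lq_of_nonneg s hpq (fun j _ => hu0 j) (fun j _ => hv0 j)
    have hvs : ∑ j ∈ s, v j ^ p' ≤ C * (1 - ‖z‖) ^ (-(η * p')) := by
      refine le_trans (le_of_eq (Finset.sum_congr rfl fun j _ => ?_)) (h s z hz)
      rw [hv, Real.mul_rpow (Real.rpow_nonneg (hk j).le _) (Real.rpow_nonneg (hd j).le _),
        ← Real.rpow_mul (hk j).le, ← Real.rpow_mul (hd j).le, neg_mul]
    have hus : 0 ≤ ∑ j ∈ s, u j ^ p := Finset.sum_nonneg fun j _ => Real.rpow_nonneg (hu0 j) _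
    have hvs0 : 0 ≤ ∑ j ∈ s, v j ^ p' := Finset.sum_nonneg fun j _ => Real.rpow_nonneg (hv0 j) _
    have hzr : 0 ≤ (1 - ‖z‖) ^ (-(η * p')) := Real.rpow_nonneg hz1.le _
    calc ‖∑ j ∈ s, c j * P.testFun N p W j z‖ ^ p
        ≤ ((∑ j ∈ s, u j ^ p) ^ (1 / p) * (C * (1 - ‖z‖) ^ (-(η * p'))) ^ (1 / p')) ^ p := by
          refine Real.rpow_le_rpow (norm_nonneg _) (hH.trans ?_) hp.le
          gcongr
      _ = (∑ j ∈ s, u j ^ p) * (C ^ (p / p') * (1 - ‖z‖) ^ (-(α / 2))) := by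
          rw [Real.mul_rpow (Real.rpow_nonneg hus _) (Real.rpow_nonneg (by positivity) _),
            ← Real.rpow_mul hus, one_div_mul_cancel hp.ne', Real.rpow_one,
            ← Real.rpow_mul (by positivity), one_div_mul_eq_div, Real.mul_rpow hC.le hzr,
            ← Real.rpow_mul hz1.le]
          congr 3
          rw [← hηp]; field_simp
      _ = C ^ (p / p') * ∑ j ∈ s, u j ^ p * (1 - ‖z‖) ^ (-(α / 2)) := by
          rw [← Finset.sum_mul]; ring
      _ = _ := by
          congr 1
          refine Finset.sum_congr rfl fun j _ => ?_
          rw [hu, Real.mul_rpow (norm_nonneg _) (mul_nonneg (Real.rpow_nonneg (hV j).le _)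
            (mul_nonneg (Real.rpow_nonneg (hk j).le _) (Real.rpow_nonneg (hd j).le _))),
            Real.mul_rpow (Real.rpow_nonneg (hV j).le _)
            (mul_nonneg (Real.rpow_nonneg (hk j).le _) (Real.rpow_nonneg (hd j).le _)), hVp,
            Real.mul_rpow (Real.rpow_nonneg (hk j).le _) (Real.rpow_nonneg (hd j).le _),
            ← Real.rpow_mul (hk j).le, ← Real.rpow_mul (hd j).le, hηp,
            Real.div_rpow (hd j).le hz1.le, Real.rpow_neg hz1.le,
            show (N : ℝ) / 2 * p = N * p / 2 by ring]
          ring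

/-- The norm of a combination of test functions is controlled by the coefficients. -/
lemma exists_energy_sum_testFun_le [Countable ι] (hW : IsPowerWeight α β W) (hα : 0 < α)
    (hp : 0 < p) {N : ℕ} (hN : 4 + 2 * (|β| + 2) / p + α / p ≤ N) :
    ∃ C : ℝ, 0 < C ∧ ∀ (s : Finset ι) (c : ι → ℂ),
      energy p W (fun z => ∑ j ∈ s, c j * P.testFun N p W j z) ≤
        ENNReal.ofReal (C * ∑ j ∈ s, ‖c j‖ ^ p) := by
  obtain ⟨C, σ, hC, hσ0, hσ, h⟩ := P.exists_norm_sum_testFun_rpow_le hW hα hp hN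
  set γ := (N : ℝ) * p / 2 with hγ
  have hγβ : |β| + 2 ≤ γ := by
    have h1 : 2 * (|β| + 2) / p ≤ N := by
      have : 0 < α / p := by positivity
      linarith
    rw [div_le_iff₀ hp] at h1
    rw [hγ]; linarith
  have hβ := le_abs_self β
  have hβ0 := abs_nonneg β
  -- The weight W(r)(1 - r)^(-σ) has exponents α - σ > 0 and β - σ, and γ ≥ |β| + 2 exceeds β - σ +
  -- 1.
  obtain ⟨C₁, hC₁, h₁⟩ := (hW.mul_rpow (-σ)).lintegral_kernel_le (γ := γ) (by linarith)
    (by linarith) (by linarith)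
  refine ⟨C * C₁, by positivity, fun s c => ?_⟩
  have hV : ∀ j, 0 < discSize W (P.center j) := fun j => hW.discSize_pos (P.center_mem j)
  have hd : ∀ j, 0 < P.depth j := P.depth_pos
  set A : ι → ℝ := fun j =>
    C * (‖c j‖ ^ p * ((discSize W (P.center j))⁻¹ * (P.depth j ^ γ * P.depth j ^ σ))) with hA
  have hA0 : ∀ j, 0 ≤ A j := fun j => by
    have := (inv_pos.2 (hV j)).le
    have := (hd j).le
    positivity
  have hpt : ∀ z ∈ disc,
      ENNReal.ofReal (W ‖z‖) * ‖∑ j ∈ s, c j * P.testFun N p W j z‖ₑ ^ p ≤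
      ∑ j ∈ s, ENNReal.ofReal (A j) * ENNReal.ofReal (W ‖z‖ * (1 - ‖z‖) ^ (-σ) *
        ‖1 - starRingEnd ℂ (P.center j) * z‖ ^ (-γ)) := by
    intro z hz
    have hz1 : ‖z‖ < 1 := mem_ball_zero_iff.1 hz
    have hz0 : 0 < 1 - ‖z‖ := by linarith
    have hWz := (hW.pos _ ⟨norm_nonneg z, hz1⟩).le
    rw [← ofReal_norm, ENNReal.ofReal_rpow_of_nonneg (norm_nonneg _) hp.le,
      ← ENNReal.ofReal_mul hWz]
    calc _ ≤ ENNReal.ofReal (W ‖z‖ * (C * ∑ j ∈ s, ‖c j‖ ^ p *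
          ((discSize W (P.center j))⁻¹ *
          (P.kernel j z ^ γ * (P.depth j / (1 - ‖z‖)) ^ σ)))) := by
          refine ENNReal.ofReal_le_ofReal (mul_le_mul_of_nonneg_left (h s c z hz) hWz)
      _ = ENNReal.ofReal (∑ j ∈ s, A j * (W ‖z‖ * (1 - ‖z‖) ^ (-σ) *
            ‖1 - starRingEnd ℂ (P.center j) * z‖ ^ (-γ))) := by
          congr 1
          rw [Finset.mul_sum, Finset.mul_sum]
          refine Finset.sum_congr rfl fun j _ => ?_
          rw [P.kernel_rpow j z, Real.div_rpow (hd j).le hz0.le, Real.rpow_neg hz0.le σ, hA]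
          ring
      _ = _ := by
          rw [ENNReal.ofReal_sum_of_nonneg]
          · exact Finset.sum_congr rfl fun j _ => ENNReal.ofReal_mul (hA0 j)
          · intro j _
            have := hA0 j
            positivity
  have hmeas : Measurable fun z : ℂ => W ‖z‖ := hW.measurable.comp measurable_norm
  calc energy p W (fun z => ∑ j ∈ s, c j * P.testFun N p W j z)
      ≤ ∫⁻ z in disc, ∑ j ∈ s, ENNReal.ofReal (A j) * ENNReal.ofReal (W ‖z‖ * (1 - ‖z‖) ^ (-σ) *
        ‖1 - starRingEnd ℂ (P.center j) * z‖ ^ (-γ)) :=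
        setLIntegral_mono' Metric.isOpen_ball.measurableSet hpt
    _ = ∑ j ∈ s, ENNReal.ofReal (A j) * ∫⁻ z in disc, ENNReal.ofReal (W ‖z‖ * (1 - ‖z‖) ^ (-σ) *
        ‖1 - starRingEnd ℂ (P.center j) * z‖ ^ (-γ)) := by
        rw [lintegral_finsetSum]
        · exact Finset.sum_congr rfl fun j _ => lintegral_const_mul' _ _ ENNReal.ofReal_ne_top
        · intro j _
          have h2 : Measurable fun z : ℂ => (1 - ‖z‖) ^ (-σ) := by fun_prop
          have h3 : Measurable fun z : ℂ => ‖1 - starRingEnd ℂ (P.center j) * z‖ ^ (-γ) := by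
            fun_prop
          exact (ENNReal.measurable_ofReal.comp ((hmeas.mul h2).mul h3)).const_mul _
    _ ≤ ∑ j ∈ s, ENNReal.ofReal (A j) * ENNReal.ofReal (C₁ * (W ‖P.center j‖ *
          (1 - ‖P.center j‖) ^ (-σ) * (1 - ‖P.center j‖) ^ (2 - γ))) := by
        gcongr with j hj
        exact h₁ _ (P.center_mem j)
    _ = ∑ j ∈ s, ENNReal.ofReal (C * C₁ * ‖c j‖ ^ p) := by
        refine Finset.sum_congr rfl fun j _ => ?_
        rw [← ENNReal.ofReal_mul (hA0 j)]
        congr 1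
        change A j * (C₁ * (W ‖P.center j‖ * P.depth j ^ (-σ) * P.depth j ^ (2 - γ))) = _
        have e1 : P.depth j ^ γ * P.depth j ^ (2 - γ) = P.depth j ^ 2 := by
          rw [← Real.rpow_add (hd j), ← Real.rpow_two]; congr 1; ring
        have e2 : P.depth j ^ σ * P.depth j ^ (-σ) = 1 := by
          rw [← Real.rpow_add (hd j)]; simp
        have e3 : (discSize W (P.center j))⁻¹ * (P.depth j ^ 2 * W ‖P.center j‖) = 1 :=
          inv_mul_cancel₀ (hV j).ne'
        calc _ = C * C₁ * ‖c j‖ ^ p * ((discSize W (P.center j))⁻¹ *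
              ((P.depth j ^ γ * P.depth j ^ (2 - γ)) * W ‖P.center j‖)) *
              (P.depth j ^ σ * P.depth j ^ (-σ)) := by rw [hA]; ring
          _ = _ := by rw [e1, e2, e3]; ring
    _ = _ := by
        rw [← ENNReal.ofReal_sum_of_nonneg fun j _ => by positivity, Finset.mul_sum]

/-- Combinations of the test functions of deep cells are small on compact sets. -/
lemma exists_norm_sum_testFun_le [Countable ι] (hW : IsPowerWeight α β W) (hα : 0 < α)
    (hp : 0 < p) {N : ℕ} (hN : 4 + 2 * (|β| + 2) / p + α / p ≤ N) {r : ℝ} (hr : r < 1) :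
    ∃ C : ℝ, 0 < C ∧ ∀ (s : Finset ι) (c : ι → ℂ) (t : ℝ), 0 ≤ t → (∀ j ∈ s, ‖c j‖ ≤ 1) →
      (∀ j ∈ s, P.depth j ≤ t) → ∀ z ∈ Metric.closedBall (0 : ℂ) r,
      ‖∑ j ∈ s, c j * P.testFun N p W j z‖ ≤ C * t := by
  obtain ⟨C, hC, h⟩ := P.exists_sum_kernel_le (γ := 3) (η := 1) one_pos (by norm_num)
  have hW0 := hW.pos 0 (by simp)
  have hr' : 0 < 1 - r := by linarith
  refine ⟨W 0 ^ (-(1 / p)) * ((1 - r) ^ N)⁻¹ * C, by positivity, fun s c t ht0 hc ht z hz => ?_⟩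
  have hz1 : ‖z‖ ≤ r := by simpa using hz
  have hzd : z ∈ disc := mem_ball_zero_iff.2 (by linarith)
  have hd : ∀ j, 0 < P.depth j := P.depth_pos
  have hV : ∀ j, 0 < discSize W (P.center j) := fun j => hW.discSize_pos (P.center_mem j)
  -- At z = 0 the kernel equals the depth, so the kernel sum with γ = 3 and η = 1 is ∑ δ_j².
  have hs : ∑ j ∈ s, P.depth j ^ 2 ≤ C := by
    have h0 := h s 0 (by simp)
    simp only [norm_zero, sub_zero, Real.one_rpow, mul_one] at h0
    refine le_trans (le_of_eq (Finset.sum_congr rfl fun j _ => ?_)) h0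
    rw [kernel, mul_zero, sub_zero, norm_one, div_one, ← Real.rpow_add (hd j), ← Real.rpow_two]
    norm_num
  have hterm : ∀ j ∈ s, ‖c j * P.testFun N p W j z‖ ≤
      W 0 ^ (-(1 / p)) * ((1 - r) ^ N)⁻¹ * (P.depth j ^ 2 * t) := by
    intro j hj
    rw [norm_mul, P.norm_testFun hW]
    have hk : P.kernel j z ≤ P.depth j / (1 - r) := by
      rw [kernel]
      have : 1 - r ≤ ‖1 - starRingEnd ℂ (P.center j) * z‖ := by
        rw [norm_one_sub_conj_mul_comm]
        have := one_sub_norm_le_norm_one_sub (a := z) (P.center_mem j)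
        linarith
      gcongr
      exact (hd j).le
    have hV1 : discSize W (P.center j) ^ (-(1 / p)) ≤
        W 0 ^ (-(1 / p)) * P.depth j ^ (-((β + 1) / p)) := by
      have := Real.rpow_le_rpow_of_nonpos (by have := hd j; rw [depth] at this; positivity)
        (hW.le_discSize (P.center_mem j)) (z := -(1 / p)) (by
          have : 0 < 1 / p := by positivity
          linarith)
      refine this.trans (le_of_eq ?_)
      change (W 0 * P.depth j ^ (β + 1)) ^ (-(1 / p)) = _
      rw [Real.mul_rpow hW0.le (Real.rpow_nonneg (hd j).le _), ← Real.rpow_mul (hd j).le]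
      congr 2; ring
    -- N is large enough to absorb the normalization; of the three remaining powers, two make the
    -- sum converge and one yields t.
    have hpow : P.depth j ^ (-((β + 1) / p)) * P.depth j ^ N ≤ P.depth j ^ 3 := by
      rw [← Real.rpow_natCast, ← Real.rpow_natCast, ← Real.rpow_add (hd j)]
      refine Real.rpow_le_rpow_of_exponent_ge (hd j) (P.depth_le_one j) ?_
      have h1 : (β + 1) / p ≤ 2 * (|β| + 2) / p := by
        gcongr
        have := le_abs_self β
        have := abs_nonneg β
        linarith
      have h2 : 0 < α / p := by positivity
      push_cast
      linarith
    have hk0 := (P.kernel_pos j hzd).le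
    have hdj := (hd j).le
    have hVj := Real.rpow_nonneg (hV j).le (-(1 / p))
    have hWp := Real.rpow_nonneg hW0.le (-(1 / p))
    calc ‖c j‖ * (discSize W (P.center j) ^ (-(1 / p)) * P.kernel j z ^ N)
        ≤ 1 * ((W 0 ^ (-(1 / p)) * P.depth j ^ (-((β + 1) / p))) * (P.depth j / (1 - r)) ^ N) := by
          gcongr
          exact hc j hj
      _ = W 0 ^ (-(1 / p)) * ((1 - r) ^ N)⁻¹ *
          (P.depth j ^ (-((β + 1) / p)) * P.depth j ^ N) := by
          rw [div_pow]; ring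
      _ ≤ W 0 ^ (-(1 / p)) * ((1 - r) ^ N)⁻¹ * (P.depth j ^ 2 * t) := by
          refine mul_le_mul_of_nonneg_left (hpow.trans ?_) (by positivity)
          rw [pow_succ]
          gcongr
          exact ht j hj
  calc _ ≤ ∑ j ∈ s, W 0 ^ (-(1 / p)) * ((1 - r) ^ N)⁻¹ * (P.depth j ^ 2 * t) :=
        (norm_sum_le _ _).trans (Finset.sum_le_sum hterm)
    _ = W 0 ^ (-(1 / p)) * ((1 - r) ^ N)⁻¹ * (∑ j ∈ s, P.depth j ^ 2) * t := by
        rw [← Finset.mul_sum, ← Finset.sum_mul]; ring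
    _ ≤ _ := by gcongr

end WhitneyCover

/-! ### Random signs and necessity of the cell condition -/

/-- Averaging over signs, a sum is at least half as large as each of its terms. -/
lemma card_mul_enorm_rpow_le {B : Type} [Fintype B] [DecidableEq B] (u : B → ℂ) (j₀ : B) {q : ℝ}
    (hq : 0 < q) :
    (Fintype.card (B → ℤˣ) : ℝ≥0∞) * ‖u j₀‖ₑ ^ q ≤
      2 * ∑ σ : B → ℤˣ, ‖∑ j, ((σ j : ℤ) : ℂ) * u j‖ₑ ^ q := by
  set S : (B → ℤˣ) → ℂ := fun σ => ∑ j, ((σ j : ℤ) : ℂ) * u j with hS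
  -- Flipping the sign at j₀ permutes the choices of signs and changes the sum by ±2u_{j₀}, so one
  -- of the two sums has modulus at least |u_{j₀}|. This works for every q > 0.
  set e : B → ℤˣ := Pi.mulSingle j₀ (-1) with he
  have hflip : ∀ σ, S σ - S (σ * e) = 2 * (((σ j₀ : ℤ) : ℂ) * u j₀) := by
    intro σ
    rw [hS]
    simp only
    rw [← Finset.sum_sub_distrib, Finset.sum_eq_single j₀]
    · simp [he]; ring
    · intro j _ hj
      simp [he, Pi.mulSingle_eq_of_ne hj]
    · simp
  have hle : ∀ σ, ‖u j₀‖ₑ ^ q ≤ ‖S σ‖ₑ ^ q + ‖S (σ * e)‖ₑ ^ q := by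
    intro σ
    have hn : ‖u j₀‖ ≤ max ‖S σ‖ ‖S (σ * e)‖ := by
      have h1 := norm_sub_le (S σ) (S (σ * e))
      rw [hflip, norm_mul, norm_mul] at h1
      have h2 : ‖((σ j₀ : ℤ) : ℂ)‖ = 1 := by
        rcases Int.units_eq_one_or (σ j₀) with h | h <;> simp [h]
      rw [h2, one_mul, Complex.norm_two] at h1
      by_contra hc
      rw [not_le, max_lt_iff] at hc
      linarith
    have hn' : ‖u j₀‖ₑ ≤ max ‖S σ‖ₑ ‖S (σ * e)‖ₑ := by
      rcases le_max_iff.1 hn with h | h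
      · exact le_max_of_le_left (enorm_le_iff_norm_le.2 h)
      · exact le_max_of_le_right (enorm_le_iff_norm_le.2 h)
    rcases le_max_iff.1 hn' with h | h
    · exact (ENNReal.rpow_le_rpow h hq.le).trans le_self_add
    · exact (ENNReal.rpow_le_rpow h hq.le).trans le_add_self
  have hsum : ∑ σ, ‖S (σ * e)‖ₑ ^ q = ∑ σ, ‖S σ‖ₑ ^ q :=
    Equiv.sum_comp (Equiv.mulRight e) fun σ => ‖S σ‖ₑ ^ q
  calc _ = ∑ _σ : B → ℤˣ, ‖u j₀‖ₑ ^ q := by simp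
    _ ≤ ∑ σ, (‖S σ‖ₑ ^ q + ‖S (σ * e)‖ₑ ^ q) := Finset.sum_le_sum fun σ _ => hle σ
    _ = _ := by rw [Finset.sum_add_distrib, hsum, two_mul]

section Necessity

variable {ι κ : Type} [Fintype κ] {α β p q : κ → ℝ} {W : κ → ℝ → ℝ} {lam : ℝ} {Om : ℝ → ℝ}

/-- The signs are independent for different factors, so the average of the product is the product of
the averages, each at least half of |u_{i,j}|^(q_i) for any single j. On the cell j the product of
the j-th terms is at least k₀ V_j^(-λ) x_j^λ. Integrating over the disjoint cells bounds the average
integral below, and some choice of signs does no worse than the average. -/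
lemma exists_signs_le (P : WhitneyCover ι) (hW : ∀ i, IsPowerWeight (α i) (β i) (W i))
    (hp : ∀ i, 0 < p i) (hq : ∀ i, 0 < q i) (hlam : 0 < lam) (hsum : lam = ∑ i, q i / p i)
    (hOm : ∀ r ∈ Set.Ico (0 : ℝ) 1, Om r = ∏ i, W i r ^ (q i / (lam * p i))) (μ : Measure ℂ)
    (N : κ → ℕ) :
    ∃ K : ℝ≥0∞, K ≠ ∞ ∧ ∀ (B : Finset ι) (x : ι → ℝ), (∀ j, 0 ≤ x j) → ∃ c : κ → ι → ℂ,
      (∀ i, ∀ j ∈ B, ‖c i j‖ = x j ^ (1 / p i)) ∧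
      ∑ j ∈ B, cellMass P lam Om μ j * ENNReal.ofReal (x j) ^ lam ≤
        K * ∫⁻ z in disc, ∏ i, ‖∑ j ∈ B, c i j * P.testFun (N i) (p i) (W i) j z‖ₑ ^ q i ∂μ := by
  classical
  set k₀ : ℝ≥0∞ := ∏ i, ENNReal.ofReal ((1 / 3) ^ N i) ^ q i with hk₀
  have hk₀0 : k₀ ≠ 0 := by
    refine Finset.prod_ne_zero_iff.2 fun i _ => ?_
    have : (0 : ℝ) < (1 / 3) ^ N i := by positivity
    simp only [ne_eq, ENNReal.rpow_eq_zero_iff, ENNReal.ofReal_eq_zero, not_or, not_and, not_lt]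
    exact ⟨fun h => absurd h (not_le.2 this), fun _ => (hq i).le⟩
  have hk₀t : k₀ ≠ ∞ := ENNReal.prod_ne_top fun i _ =>
    ENNReal.rpow_ne_top_of_nonneg (hq i).le ENNReal.ofReal_ne_top
  refine ⟨k₀⁻¹ * 2 ^ Fintype.card κ, ENNReal.mul_ne_top (ENNReal.inv_ne_top.2 hk₀0)
    (ENNReal.pow_ne_top ENNReal.ofNat_ne_top), fun B x hx => ?_⟩
  set u : κ → ι → ℂ → ℂ := fun i j z =>
    ((x j ^ (1 / p i) : ℝ) : ℂ) * P.testFun (N i) (p i) (W i) j z with hu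
  set S : κ → (B → ℤˣ) → ℂ → ℂ := fun i τ z => ∑ j : B, ((τ j : ℤ) : ℂ) * u i j z with hS
  set F : (κ → B → ℤˣ) → ℂ → ℝ≥0∞ := fun σ z => ∏ i, ‖S i (σ i) z‖ₑ ^ q i with hF
  have hFm : ∀ σ, Measurable (F σ) := by
    intro σ
    refine Finset.measurable_prod _ fun i _ => Measurable.pow_const (Measurable.enorm ?_) _
    refine Finset.measurable_sum _ fun j _ => Measurable.const_mul ?_ _
    exact (P.measurable_testFun _ _ _ _).const_mul _
  set T : ℝ≥0∞ := (Fintype.card (B → ℤˣ) : ℝ≥0∞) ^ Fintype.card κ with hT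
  have hT0 : T ≠ 0 := by
    refine pow_ne_zero _ (Nat.cast_ne_zero.2 Fintype.card_ne_zero)
  have hTt : T ≠ ∞ := ENNReal.pow_ne_top (ENNReal.natCast_ne_top _)
  have hTc : (Fintype.card (κ → B → ℤˣ) : ℝ≥0∞) = T := by
    rw [Fintype.card_fun, hT]; push_cast; rfl
  have hlow : ∀ j ∈ B, ∀ z ∈ P.cell j,
      k₀ * (ENNReal.ofReal (discSize Om (P.center j) ^ (-lam)) * ENNReal.ofReal (x j) ^ lam) ≤
        ∏ i, ‖u i j z‖ₑ ^ q i := by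
    intro j _ z hz
    have had := P.center_mem j
    have e1 : ENNReal.ofReal (x j) ^ lam = ∏ i, ENNReal.ofReal (x j) ^ (q i / p i) := by
      rw [ennreal_rpow_sum _ _ fun i => (div_pos (hq i) (hp i)).le, ← hsum]
    have e2 : ENNReal.ofReal (discSize Om (P.center j) ^ (-lam)) =
        ∏ i, ENNReal.ofReal (discSize (W i) (P.center j) ^ (-(q i / p i))) := by
      rw [← prod_discSize_rpow hW hlam hsum hOm had, ENNReal.ofReal_prod_of_nonneg]
      exact fun i _ => Real.rpow_nonneg ((hW i).discSize_pos had).le _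
    rw [hk₀, e1, e2, ← Finset.prod_mul_distrib, ← Finset.prod_mul_distrib]
    refine Finset.prod_le_prod' fun i _ => ?_
    have hV := (hW i).discSize_pos had
    have hVr := Real.rpow_nonneg hV.le (-(1 / p i))
    have hxr := Real.rpow_nonneg (hx j) (1 / p i)
    have h1 : ENNReal.ofReal (x j ^ (1 / p i) *
        (discSize (W i) (P.center j) ^ (-(1 / p i)) * (1 / 3) ^ N i)) ≤ ‖u i j z‖ₑ := by
      rw [← ofReal_norm]
      refine ENNReal.ofReal_le_ofReal ?_
      rw [hu, norm_mul, Complex.norm_of_nonneg hxr]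
      exact mul_le_mul_of_nonneg_left (P.le_norm_testFun (hW i) (N i) (p i) j hz) hxr
    refine le_trans (le_of_eq ?_) (ENNReal.rpow_le_rpow h1 (hq i).le)
    rw [ENNReal.ofReal_mul hxr, ENNReal.ofReal_mul hVr, ENNReal.mul_rpow_of_nonneg _ _ (hq i).le,
      ENNReal.mul_rpow_of_nonneg _ _ (hq i).le, ENNReal.ofReal_rpow_of_nonneg hVr (hq i).le,
      ← Real.rpow_mul hV.le, ← ENNReal.ofReal_rpow_of_nonneg (hx j) (one_div_pos.2 (hp i)).le,
      ← ENNReal.rpow_mul, one_div_mul_eq_div, neg_mul, one_div_mul_eq_div]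
    ring
  have havg : ∀ j ∈ B, ∀ z, T * ∏ i, ‖u i j z‖ₑ ^ q i ≤
      2 ^ Fintype.card κ * ∑ σ, F σ z := by
    intro j hj z
    -- Independence of the signs, as distributivity of the product over the sums.
    have e1 : ∑ σ, F σ z = ∏ i, ∑ τ : B → ℤˣ, ‖S i τ z‖ₑ ^ q i := by
      rw [Finset.prod_univ_sum, Fintype.piFinset_univ]
    have e2 : T = ∏ _i : κ, (Fintype.card (B → ℤˣ) : ℝ≥0∞) := by simp [hT]
    have e3 : (2 : ℝ≥0∞) ^ Fintype.card κ = ∏ _i : κ, 2 := by simp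
    rw [e1, e2, e3, ← Finset.prod_mul_distrib, ← Finset.prod_mul_distrib]
    exact Finset.prod_le_prod' fun i _ =>
      card_mul_enorm_rpow_le (fun j : B => u i j z) ⟨j, hj⟩ (hq i)
  obtain ⟨σ, -, hmax⟩ := Finset.exists_max_image (Finset.univ : Finset (κ → B → ℤˣ))
    (fun σ => ∫⁻ z in disc, F σ z ∂μ) Finset.univ_nonempty
  set M := ∑ j ∈ B, cellMass P lam Om μ j * ENNReal.ofReal (x j) ^ lam with hM
  have hmain : T * (k₀ * M) ≤ T * (2 ^ Fintype.card κ * ∫⁻ z in disc, F σ z ∂μ) := by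
    calc T * (k₀ * M) = ∑ j ∈ B, ∫⁻ _ in P.cell j, T * (k₀ *
          (ENNReal.ofReal (discSize Om (P.center j) ^ (-lam)) * ENNReal.ofReal (x j) ^ lam)) ∂μ := by
          rw [hM, Finset.mul_sum, Finset.mul_sum]
          refine Finset.sum_congr rfl fun j _ => ?_
          rw [setLIntegral_const, cellMass]; ring
      _ ≤ ∑ j ∈ B, ∫⁻ z in P.cell j, 2 ^ Fintype.card κ * ∑ σ, F σ z ∂μ := by
          refine Finset.sum_le_sum fun j hj => ?_
          refine setLIntegral_mono' (P.measurableSet_cell j) fun z hz => ?_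
          refine le_trans ?_ (havg j hj z)
          gcongr
          exact hlow j hj z hz
      _ = ∫⁻ z in ⋃ j ∈ B, P.cell j, 2 ^ Fintype.card κ * ∑ σ, F σ z ∂μ := by
          rw [lintegral_biUnion_finset (P.pairwise_disjoint.set_pairwise _)
            fun j _ => P.measurableSet_cell j]
      _ ≤ ∫⁻ z in disc, 2 ^ Fintype.card κ * ∑ σ, F σ z ∂μ :=
          lintegral_mono_set (Set.iUnion₂_subset fun j _ => P.cell_subset_disc j)
      _ = 2 ^ Fintype.card κ * ∑ σ, ∫⁻ z in disc, F σ z ∂μ := by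
          rw [lintegral_const_mul' _ _ (ENNReal.pow_ne_top ENNReal.ofNat_ne_top),
            lintegral_finsetSum _ fun σ _ => hFm σ]
      _ ≤ 2 ^ Fintype.card κ * ∑ _τ : κ → B → ℤˣ, ∫⁻ z in disc, F σ z ∂μ := by
          exact mul_le_mul_right (Finset.sum_le_sum hmax) _
      _ = _ := by
          rw [Finset.sum_const, Finset.card_univ, nsmul_eq_mul, hTc]; ring
  rw [ENNReal.mul_le_mul_iff_right hT0 hTt] at hmain
  refine ⟨fun i j => if h : j ∈ B then ((σ i ⟨j, h⟩ : ℤ) : ℂ) * ((x j ^ (1 / p i) : ℝ) : ℂ) else 0,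
    fun i j hj => ?_, ?_⟩
  · have h2 : ‖((σ i ⟨j, hj⟩ : ℤ) : ℂ)‖ = 1 := by
      rcases Int.units_eq_one_or (σ i ⟨j, hj⟩) with h | h <;> simp [h]
    simp only [dif_pos hj]
    rw [norm_mul, h2, one_mul, Complex.norm_of_nonneg (Real.rpow_nonneg (hx j) _)]
  · have hFσ : ∀ z, F σ z = ∏ i, ‖∑ j ∈ B, (if h : j ∈ B then ((σ i ⟨j, h⟩ : ℤ) : ℂ) *
        ((x j ^ (1 / p i) : ℝ) : ℂ) else 0) * P.testFun (N i) (p i) (W i) j z‖ₑ ^ q i := by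
      intro z
      refine Finset.prod_congr rfl fun i _ => ?_
      rw [← Finset.sum_coe_sort B, hS]
      congr 2
      refine Finset.sum_congr rfl fun j _ => ?_
      rw [dif_pos j.2, hu, mul_assoc]
    simp only [← hFσ]
    rw [mul_assoc, ← ENNReal.mul_le_mul_iff_right hk₀0 hk₀t, ← mul_assoc,
      ENNReal.mul_inv_cancel hk₀0 hk₀t, one_mul]
    exact hmain

end Necessity

lemma boundedSeq_of_energy_le {p : ℝ} (hp : 0 < p) {W : ℝ → ℝ} (hW : Measurable W)
    {f : ℕ → ℂ → ℂ} (hf : ∀ k, DifferentiableOn ℂ (f k) disc) {E : ℝ≥0∞} (hE : E ≠ ∞)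
    (h : ∀ k, energy p W (f k) ≤ E) : BoundedSeq p W f := by
  set D : ℝ≥0∞ := (ENNReal.ofReal Real.pi⁻¹ * E) ^ (1 / p) with hD
  have hDt : D ≠ ∞ := ENNReal.rpow_ne_top_of_nonneg (one_div_pos.2 hp).le
    (ENNReal.mul_ne_top ENNReal.ofReal_ne_top hE)
  have hb : ∀ k, bergmanNorm p W (f k) ≤ D := by
    intro k
    rw [← ENNReal.rpow_le_rpow_iff hp, bergmanNorm_rpow hp hW, hD, ← ENNReal.rpow_mul,
      one_div_mul_cancel hp.ne', ENNReal.rpow_one]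
    gcongr
    exact h k
  exact ⟨fun k => ⟨hf k, (hb k).trans_lt hDt.lt_top⟩, D.toNNReal, fun k => by
    rw [ENNReal.coe_toNNReal hDt]; exact hb k⟩

/-- The Forelli–Rudin estimate at a = 0, where the kernel is 1. -/
lemma IsPowerWeight.lintegral_ne_top {α β : ℝ} {W : ℝ → ℝ} (hW : IsPowerWeight α β W)
    (hα : 0 < α) : ∫⁻ z in disc, ENNReal.ofReal (W ‖z‖) ≠ ∞ := by
  obtain ⟨C, -, hC⟩ := hW.lintegral_kernel_le hα (γ := |β| + 2)
    (by linarith [abs_nonneg β]) (by linarith [le_abs_self β])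
  have h := hC 0 (by simp)
  simp only [map_zero, zero_mul, sub_zero, norm_one, Real.one_rpow, mul_one] at h
  exact ne_top_of_le_ne_top ENNReal.ofReal_ne_top h

section Necessity

variable {ι κ : Type} [Fintype κ] {α β p q : κ → ℝ} {W : κ → ℝ → ℝ} {lam : ℝ} {Om : ℝ → ℝ}

/-- A measure for which products of null sequences have null integrals is finite on compact
subsets of the disc. -/
lemma measure_closedBall_lt_top (hW : ∀ i, IsPowerWeight (α i) (β i) (W i)) (hα : ∀ i, 0 < α i)
    (hp : ∀ i, 0 < p i) {μ : Measure ℂ}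
    (H : ∀ f : κ → ℕ → ℂ → ℂ, (∀ i, BoundedSeq (p i) (W i) (f i)) →
      (∀ i, TendstoZeroOnCompacts (f i)) →
      Tendsto (fun k : ℕ => ∫⁻ z in disc, ∏ i, ‖f i k z‖ₑ ^ q i ∂μ) atTop (𝓝 0))
    {r : ℝ} (hr : r < 1) : μ (Metric.closedBall 0 r) < ∞ := by
  -- Nonzero constants tending to zero are admissible in every factor; if μ had infinite mass on the
  -- disc, their integrals would all be infinite.
  set e : ℕ → ℂ := fun k => ((1 / ((k : ℝ) + 1) : ℝ) : ℂ) with he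
  have hen : ∀ k, ‖e k‖ = 1 / ((k : ℝ) + 1) := fun k =>
    Complex.norm_of_nonneg (by positivity)
  have hlim : Tendsto e atTop (𝓝 0) := by
    rw [tendsto_zero_iff_norm_tendsto_zero]
    simp only [hen]
    exact tendsto_one_div_add_atTop_nhds_zero_nat
  have h := H (fun _ k _ => e k) (fun i => ?_) (fun i K _ _ => ?_)
  · have hfin : ∀ᶠ k in atTop, ∫⁻ _ in disc, ∏ i, ‖e k‖ₑ ^ q i ∂μ < 1 :=
      h.eventually (gt_mem_nhds one_pos)
    obtain ⟨k, hk⟩ := hfin.exists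
    rw [setLIntegral_const] at hk
    have hprod : ∏ i, ‖e k‖ₑ ^ q i ≠ 0 := by
      refine Finset.prod_ne_zero_iff.2 fun i _ => ?_
      have h0 : ‖e k‖ₑ ≠ 0 := by
        rw [enorm_ne_zero, ← norm_pos_iff, hen]; positivity
      simp [ENNReal.rpow_eq_zero_iff, h0]
    have hdisc : μ disc < ∞ := by
      by_contra hc
      rw [not_lt_top_iff.1 hc, ENNReal.mul_top hprod] at hk
      exact absurd hk (by simp)
    exact (measure_mono (Metric.closedBall_subset_ball hr)).trans_lt hdisc
  · refine boundedSeq_of_energy_le (hp i) (hW i).measurable (fun k => differentiableOn_const _)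
      ((hW i).lintegral_ne_top (hα i)) fun k => ?_
    refine lintegral_mono fun z => ?_
    have h1 : ‖e k‖ₑ ≤ 1 := by
      rw [← ofReal_norm, hen, ENNReal.ofReal_le_one, div_le_one (by positivity)]
      have : (0 : ℝ) ≤ k := by positivity
      linarith
    calc ENNReal.ofReal (W i ‖z‖) * ‖e k‖ₑ ^ p i ≤ ENNReal.ofReal (W i ‖z‖) * 1 := by
          gcongr
          exact ENNReal.rpow_le_one h1 (hp i).le
      _ = _ := mul_one _
  · exact hlim.tendstoUniformlyOn_const _

/-- The cell condition is necessary for products of null sequences to have null integrals. -/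
lemma cellCondition_of_tendsto [Countable ι] (P : WhitneyCover ι)
    (hW : ∀ i, IsPowerWeight (α i) (β i) (W i)) (hα : ∀ i, 0 < α i)
    (hp : ∀ i, 0 < p i) (hq : ∀ i, 0 < q i) (hlam : 0 < lam) (hsum : lam = ∑ i, q i / p i)
    (hOm : ∀ r ∈ Set.Ico (0 : ℝ) 1, Om r = ∏ i, W i r ^ (q i / (lam * p i))) {μ : Measure ℂ}
    (H : ∀ f : κ → ℕ → ℂ → ℂ, (∀ i, BoundedSeq (p i) (W i) (f i)) →
      (∀ i, TendstoZeroOnCompacts (f i)) →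
      Tendsto (fun k : ℕ => ∫⁻ z in disc, ∏ i, ‖f i k z‖ₑ ^ q i ∂μ) atTop (𝓝 0)) :
    CellCondition P lam Om μ := by
  classical
  refine ⟨fun r hr => measure_closedBall_lt_top hW hα hp H hr, fun ε hε => ?_⟩
  by_contra! hcon
  choose N hN using fun i => exists_nat_ge (4 + 2 * (|β i| + 2) / p i + α i / p i)
  obtain ⟨K, hKt, hK⟩ := exists_signs_le P hW hp hq hlam hsum hOm μ N
  choose x hx1 hx2 using fun k : ℕ => hcon (1 / ((k : ℝ) + 1)) (by positivity)
  have hxle : ∀ k j, x k j ≤ 1 := fun k j => (ENNReal.le_tsum j).trans (hx1 k)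
  have hxt : ∀ k j, x k j ≠ ∞ := fun k j => ne_top_of_le_ne_top ENNReal.one_ne_top (hxle k j)
  -- The strict excess over ε is already reached by a finite partial sum, so only finite
  -- combinations of test functions are needed.
  have hB : ∀ k : ℕ, ∃ B : Finset ι, (∀ j ∈ B, P.depth j ≤ 1 / ((k : ℝ) + 1)) ∧
      ε < ∑ j ∈ B, cellMass P lam Om μ j * x k j ^ lam := by
    intro k
    have h := hx2 k
    rw [ENNReal.tsum_eq_iSup_sum, lt_iSup_iff] at h
    obtain ⟨B, hB⟩ := h
    rw [← Finset.sum_filter] at hB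
    exact ⟨_, fun j hj => (Finset.mem_filter.1 hj).2.le, hB⟩
  choose B hBd hBε using hB
  choose c hc hcK using fun k => hK (B k) (fun j => (x k j).toReal) fun j => ENNReal.toReal_nonneg
  set f : κ → ℕ → ℂ → ℂ := fun i k z =>
    ∑ j ∈ B k, c k i j * P.testFun (N i) (p i) (W i) j z with hf
  have hbdd : ∀ i, BoundedSeq (p i) (W i) (f i) := by
    intro i
    obtain ⟨C, hC, h⟩ := P.exists_energy_sum_testFun_le (hW i) (hα i) (hp i) (hN i)
    refine boundedSeq_of_energy_le (hp i) (hW i).measurable (fun k => ?_)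
      (E := ENNReal.ofReal C) ENNReal.ofReal_ne_top fun k => ?_
    · exact DifferentiableOn.fun_sum fun j _ => (P.differentiableOn_testFun _ _ _ j).const_mul _
    · refine (h (B k) (c k i)).trans (ENNReal.ofReal_le_ofReal ?_)
      have h1 : ∑ j ∈ B k, ‖c k i j‖ ^ p i ≤ 1 := by
        calc ∑ j ∈ B k, ‖c k i j‖ ^ p i = ∑ j ∈ B k, (x k j).toReal := by
              refine Finset.sum_congr rfl fun j hj => ?_
              rw [hc k i j hj, ← Real.rpow_mul ENNReal.toReal_nonneg,
                one_div_mul_cancel (hp i).ne', Real.rpow_one]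
          _ = (∑ j ∈ B k, x k j).toReal := (ENNReal.toReal_sum fun j _ => hxt k j).symm
          _ ≤ 1 := by
              rw [← ENNReal.toReal_one]
              exact ENNReal.toReal_mono ENNReal.one_ne_top ((ENNReal.sum_le_tsum _).trans (hx1 k))
      nlinarith
  have hzero : ∀ i, TendstoZeroOnCompacts (f i) := by
    intro i
    refine tendstoZeroOnCompacts_of_closedBall fun r _ hr => ?_
    obtain ⟨C, hC, h⟩ := P.exists_norm_sum_testFun_le (hW i) (hα i) (hp i) (hN i) hr
    have hT : Tendsto (fun k : ℕ => C * (1 / ((k : ℝ) + 1))) atTop (𝓝 0) := by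
      simpa using (tendsto_one_div_add_atTop_nhds_zero_nat (𝕜 := ℝ)).const_mul C
    rw [Metric.tendstoUniformlyOn_iff]
    intro δ hδ
    filter_upwards [hT.eventually (gt_mem_nhds hδ)] with k hk z hz
    rw [dist_zero_left]
    refine lt_of_le_of_lt (h (B k) (c k i) _ (by positivity) (fun j hj => ?_) (hBd k) z hz) hk
    rw [hc k i j hj]
    refine Real.rpow_le_one ENNReal.toReal_nonneg ?_ (one_div_pos.2 (hp i)).le
    rw [← ENNReal.toReal_one]
    exact ENNReal.toReal_mono ENNReal.one_ne_top (hxle k j)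
  -- By the choice of signs, K times each integral exceeds ε, yet these tend to zero.
  have hlim := ENNReal.Tendsto.const_mul (a := K) (H f hbdd hzero) (Or.inr hKt)
  rw [mul_zero] at hlim
  obtain ⟨k, hk⟩ := (hlim.eventually (gt_mem_nhds (pos_iff_ne_zero.2 hε))).exists
  have h1 := hcK k
  simp only [ENNReal.ofReal_toReal (hxt k _)] at h1
  exact lt_irrefl _ ((hBε k).trans_le (h1.trans hk.le))

end Necessity

end WeightedBergman

end

/-! ### The equivalence of the three statements -/

open WeightedBergman in
/-- There are `n + 1 ≥ 1` factors, indexed by `Fin (n + 1)`; the distinguished one has index `0`.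
A positive Borel measure on the disc is given as the restriction to the disc of a Borel measure `μ`
on the plane. -/
theorem theorem3 (n : ℕ) (p q : Fin (n + 1) → ℝ) (hp : ∀ i, 0 < p i) (hq : ∀ i, 0 < q i)
    (w : Fin (n + 1) → ℝ → ℝ) (hw : ∀ i, WeightedBergman.IsRegularWeight (w i))
    (μ : Measure ℂ)
    (lam : ℝ) (hlam : lam = ∑ i, q i / p i)
    (om : ℝ → ℝ) (hom : om = fun r => ∏ i, w i r ^ (q i / (lam * p i))) :
    List.TFAE [
      WeightedBergman.IsVanishingCarleson lam 1 om μ,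
      ∀ f : ℕ → ℂ → ℂ, WeightedBergman.BoundedSeq (p 0) (w 0) f →
        WeightedBergman.TendstoZeroOnCompacts f →
        Tendsto (fun k : ℕ =>
          ⨆ (g : Fin n → ℂ → ℂ)
            (_ : ∀ i, g i ∈ WeightedBergman.bergmanSpace (p i.succ) (w i.succ) ∧
              WeightedBergman.bergmanNorm (p i.succ) (w i.succ) (g i) ≤ 1),
            ∫⁻ z in WeightedBergman.disc,
              ‖f k z‖ₑ ^ q 0 * ∏ i, ‖g i z‖ₑ ^ q i.succ ∂μ)
          atTop (𝓝 0),
      ∀ f : Fin (n + 1) → ℕ → ℂ → ℂ,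
        (∀ i, WeightedBergman.BoundedSeq (p i) (w i) (f i)) →
        (∀ i, WeightedBergman.TendstoZeroOnCompacts (f i)) →
        Tendsto (fun k : ℕ =>
          ∫⁻ z in WeightedBergman.disc, ∏ i, ‖f i k z‖ₑ ^ q i ∂μ)
          atTop (𝓝 0)] := by
  choose α β W hα hW hcomp using fun i => (hw i).exists_isPowerWeight
  have hlam0 : 0 < lam := by
    rw [hlam]
    exact Finset.sum_pos (fun i _ => div_pos (hq i) (hp i)) Finset.univ_nonempty
  set θ : Fin (n + 1) → ℝ := fun i => q i / (lam * p i) with hθ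
  have hθ0 : ∀ i, 0 < θ i := fun i => div_pos (hq i) (mul_pos hlam0 (hp i))
  have hθ1 : ∑ i, θ i = 1 := by
    have : ∀ i, θ i = (q i / p i) / lam := fun i => by rw [hθ]; field_simp
    simp only [this]
    rw [← Finset.sum_div, ← hlam, div_self hlam0.ne']
  set Om : ℝ → ℝ := fun r => ∏ i, W i r ^ θ i with hOm
  have hOmW : IsPowerWeight (∑ i, θ i * α i) (∑ i, θ i * β i) Om :=
    IsPowerWeight.prod hW (fun i => (hθ0 i).le) hθ1
  have hOmα : 0 < ∑ i, θ i * α i :=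
    Finset.sum_pos (fun i _ => mul_pos (hθ0 i) (hα i)) Finset.univ_nonempty
  have hOmc : Comparable om Om := by
    rw [hom]
    exact Comparable.prod hcomp (fun i => (hw i).pos) (fun i => (hW i).pos) (fun i => (hθ0 i).le)
  have hOmeq : ∀ r ∈ Set.Ico (0 : ℝ) 1, Om r = ∏ i, W i r ^ (q i / (lam * p i)) :=
    fun r _ => rfl
  -- The necessity argument for one factor, with p = 1, q = λ and weight Ω.
  have h1D : IsVanishingCarleson lam 1 om μ → CellCondition dyadicCover lam Om μ := by
    intro h
    have h' := hOmc.isVanishingCarleson one_pos h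
    refine cellCondition_of_tendsto (κ := Fin 1) (α := fun _ => ∑ i, θ i * α i)
      (β := fun _ => ∑ i, θ i * β i) (W := fun _ => Om) (p := fun _ => 1) (q := fun _ => lam)
      dyadicCover (fun _ => hOmW) (fun _ => hOmα) (fun _ => one_pos) (fun _ => hlam0) hlam0
      (by simp) (fun r _ => by simp [hlam0.ne']) fun f hf h0 => ?_
    simpa using h'.tendsto_lintegral hlam0 (hf 0) (h0 0)
  have hD1 : CellCondition dyadicCover lam Om μ → IsVanishingCarleson lam 1 om μ := fun h =>
    hOmc.symm.isVanishingCarleson one_pos (h.isVanishingCarleson hlam0 hOmW)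
  tfae_have 1 → 2 := by
    intro h f hf h0
    choose K _ hK using fun i => (hcomp i).symm.exists_bergmanNorm_le (hp i)
    rw [ENNReal.tendsto_nhds_zero]
    intro ε hε
    filter_upwards [(h1D h).eventually_lintegral_le hW hp hq hlam0 hlam hOmeq
      -- The sum of the comparison constants serves as a common norm bound for all unit-ball factors
      -- in the new weights.
      ((hcomp 0).boundedSeq (hp 0) hf) h0 (∑ i, K i) hε.ne'] with k hk
    refine iSup₂_le fun g hg => hk g fun i => ⟨(hg i).1.1, (hK i.succ (g i)).trans ?_⟩
    calc (K i.succ : ℝ≥0∞) * bergmanNorm (p i.succ) (w i.succ) (g i) ≤ K i.succ * 1 := by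
          gcongr
          exact (hg i).2
      _ ≤ _ := by
          rw [mul_one, ENNReal.coe_le_coe]
          exact Finset.single_le_sum (f := K) (fun _ _ => zero_le) (Finset.mem_univ i.succ)
  tfae_have 2 → 3 := by
    intro h f hf h0
    have h2 := h (f 0) (hf 0) (h0 0)
    choose C hC using fun i => (hf i).2
    -- Dividing by the norm bounds puts the other factors into the unit balls; adding 1 keeps the
    -- divisors nonzero.
    set D : Fin (n + 1) → ℝ≥0 := fun i => C i + 1 with hD
    have hD0 : ∀ i, D i ≠ 0 := fun i => by rw [hD]; positivity
    set A : ℝ≥0∞ := ∏ i : Fin n, (D i.succ : ℝ≥0∞) ^ q i.succ with hA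
    have hAt : A ≠ ∞ := ENNReal.prod_ne_top fun i _ =>
      ENNReal.rpow_ne_top_of_nonneg (hq _).le ENNReal.coe_ne_top
    have hlim := ENNReal.Tendsto.const_mul (a := A) h2 (Or.inr hAt)
    rw [mul_zero] at hlim
    refine tendsto_of_tendsto_of_tendsto_of_le_of_le tendsto_const_nhds hlim (fun k => zero_le)
      fun k => ?_
    set g : Fin n → ℂ → ℂ := fun i => ((D i.succ : ℝ) : ℂ)⁻¹ • f i.succ k with hg
    have hDe : ∀ i, ‖((D i : ℝ) : ℂ)‖ₑ = D i := by
      intro i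
      rw [← ofReal_norm, Complex.norm_of_nonneg (D i).coe_nonneg, ENNReal.ofReal_coe_nnreal]
    have hDc : ∀ i, ((D i : ℝ) : ℂ) ≠ 0 := fun i => by
      exact_mod_cast hD0 i
    have hgn : ∀ i, bergmanNorm (p i.succ) (w i.succ) (g i) ≤ 1 := by
      intro i
      rw [bergmanNorm, hg, eLpNorm_const_smul, enorm_inv (hDc _), hDe]
      have h1 : eLpNorm (f i.succ k) (ENNReal.ofReal (p i.succ)) (weightedArea (w i.succ)) ≤
          D i.succ := by
        refine (hC i.succ k).trans (ENNReal.coe_le_coe.2 ?_)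
        rw [hD]; exact le_self_add
      calc _ ≤ (D i.succ : ℝ≥0∞)⁻¹ * D i.succ := by gcongr
        _ = 1 := ENNReal.inv_mul_cancel (by simpa using hD0 i.succ) ENNReal.coe_ne_top
    have hgm : ∀ i, g i ∈ bergmanSpace (p i.succ) (w i.succ) ∧
        bergmanNorm (p i.succ) (w i.succ) (g i) ≤ 1 := fun i =>
      ⟨⟨((hf i.succ).1 k).1.const_smul _, (hgn i).trans_lt ENNReal.one_lt_top⟩, hgn i⟩
    calc ∫⁻ z in disc, ∏ i, ‖f i k z‖ₑ ^ q i ∂μ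
        = ∫⁻ z in disc, A * (‖f 0 k z‖ₑ ^ q 0 * ∏ i, ‖g i z‖ₑ ^ q i.succ) ∂μ := by
          refine lintegral_congr fun z => ?_
          rw [Fin.prod_univ_succ, mul_left_comm, hA, ← Finset.prod_mul_distrib]
          congr 1
          refine Finset.prod_congr rfl fun i _ => ?_
          rw [← ENNReal.mul_rpow_of_nonneg _ _ (hq _).le, ← hDe, ← enorm_mul, hg]
          simp [hDc]
      _ = A * ∫⁻ z in disc, ‖f 0 k z‖ₑ ^ q 0 * ∏ i, ‖g i z‖ₑ ^ q i.succ ∂μ :=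
          lintegral_const_mul' _ _ hAt
      _ ≤ _ := by
          gcongr
          exact le_iSup₂_of_le g hgm le_rfl
  tfae_have 3 → 1 := by
    intro h
    refine hD1 (cellCondition_of_tendsto dyadicCover hW hα hp hq hlam0 hlam hOmeq
      fun f hf h0 => h f (fun i => (hcomp i).symm.boundedSeq (hp i) (hf i)) h0)
  tfae_finish
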